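/- **Setting.** Let $\Omega\subset\mathbb R^2$ be open and bounded and let $\gamma>0$. Let $\mathcal T_n$ be a conforming decomposition of $\Omega$ into finitely many open polygons such that each $K\in\mathcal T_n$, with diameter $h_K$, has all its edges of length at least $\gamma h_K$ and is star-shaped with respect to a ball of radius at least $\gamma h_K$. Let $p\ge 1$ be an integer. Let $\mathbb K:\Omega\to\mathbb R^{2\times2}$ and $V:\Omega\to\mathbb R$ be measurable such that, almost everywhere in $\Omega$, $\mathbb K$ is symmetric, $$\mathfrak k_*|\xi|^2\le(\mathbb K\xi)\cdot\xi\le\mathfrak k^*|\xi|^2\quad\forall\xi\in\mathbb R^2,\qquad \nu_*\le V\le\nu^*,$$ with constants $0<\mathfrak k_*\le\mathfrak k^*$ and $0\le\nu_*\le\nu^*$. **Projections.** For $\ell\ge0$ let $\Pi^0_\ell$ be the $L^2(K)$-orthogonal projection onto the polynomials $\mathbb P_\ell(K)$ (and onto $\mathbb P_\ell(K)^2$ for vector fields). For $v\in H^1(K)$ let $\Pi^\nabla_\ell v\in\mathbb P_\ell(K)$ be defined by $(\nabla\Pi^\nabla_\ell v-\nabla v,\nabla q)_{0,K}=0$ for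 all $q\in\mathbb P_\ell(K)$ and $\int_{\partial K}(v-\Pi^\nabla_\ell v)=0$. Applied to functions on $\Omega$, the projections act element by element. **Spaces.** $V_n(K)$ is the space of all $v\in C^0(\overline K)\cap H^1(K)$ with $\Delta v\in\mathbb P_{p-1}(K)$, $v|_e\in\mathbb P_p(e)$ on each edge $e$ of $K$, and $\int_K(v-\Pi^\nabla_pv)\,m=0$ for every $m\in\mathbb P_{p-1}(K)$ that is $L^2(K)$-orthogonal to $\mathbb P_{p-2}(K)$ (with $\mathbb P_{-1}=\{0\}$). Moreover $V_n=\{v\in C^0(\overline\Omega)\cap H^1_0(\Omega): v|_K\in V_n(K)\ \forall K\in\mathcal T_n\}$. **Stabilizations.** For each $K\in\mathcal T_n$ let $S_1^K$ and $S_0^K$ be symmetric positive semidefinite bilinear forms on $\{v\in H^1(K):\Pi^\nabla_pv=0\}$ and $\{v\in H^1(K):\Pi^0_{p-1}v=0\}$, respectively, such that, with positive constants $\alpha_*=\alpha_*(p)$, $\alpha^*=\alpha^*(p)$, $\beta_*=\beta_*(p)$, $\beta^*$ that do not depend on $K$, $$\alpha_*|v|_{1,K}^2\le S^K_1(v,v)\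 \text{ if } v\in V_n(K),\ \Pi^\nabla_pv=0,\qquad S^K_1(v,v)\le\alpha^*|v|_{1,K}^2\ \text{ if } v\in H^1(K),\ \Pi^\nabla_pv=0,$$ $$\beta_*\|v\|_{0,K}^2\le S_0^K(v,v)\ \text{ if } v\in V_n(K),\ \Pi^0_{p-1}v=0,$$ $$S_0^K(v-\Pi^0_{p-1}v,v-\Pi^0_{p-1}v)\le h_K^2\beta^*|v-\Pi^\nabla_{p-1}v|_{1,K}^2\ \text{ for all } v\in H^1(K).$$ **Problems.** Let $f\in H^1(\Omega)$ and let $u\in H^1_0(\Omega)$ satisfy $$(\mathbb K\nabla u,\nabla v)_{0,\Omega}+(Vu,v)_{0,\Omega}=(f,v)_{0,\Omega}\quad\forall v\in H^1_0(\Omega).$$ Let $u_n\in V_n$ satisfy, for all $v_n\in V_n$, $$\sum_{K}\Big[(\mathbb K\Pi^0_{p-1}\nabla u_n,\Pi^0_{p-1}\nabla v_n)_{0,K}+S_1^K\big((I-\Pi^\nabla_p)u_n,(I-\Pi^\nabla_p)v_n\big)+(V\Pi^0_{p-1}u_n,\Pi^0_{p-1}v_n)_{0,K}\Big]$$ $$=\sum_K\Big[(\Pi^0_{p-1}f,\Pi^0_{p-1}v_n)_{0,K}+S_0^K\big((I-\Pi^0_{p-1})f,(I-\Pi^0_{p-1})v_n\big)\Big].$$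 **Theorem.** There is a constant $C>0$ that depends only on $\Omega$ and $\gamma$ such that, for all data as above, for every $u_I\in V_n$ and every (possibly discontinuous) piecewise polynomial $u_\pi$ with $u_\pi|_K\in\mathbb P_p(K)$ for all $K\in\mathcal T_n$, $$\begin{aligned}|u-u_n|_{1,\Omega}\le C\Big[&\mu_1\Big(\sum_Kh_K^4|f-\Pi^\nabla_{p-1}f|_{1,K}^2\Big)^{1/2}+\mu_2|u-u_I|_{1,\Omega}+\mu_3\Big(\sum_K|u-u_\pi|_{1,K}^2\Big)^{1/2}\\&+\mu_4\|u-\Pi^0_{p-1}u\|_{0,\Omega}+\mu_5\|\mathbb K\nabla u-\Pi^0_{p-1}(\mathbb K\nabla u)\|_{0,\Omega}+\mu_5\|Vu-\Pi^0_{p-1}(Vu)\|_{0,\Omega}\Big],\end{aligned}$$ where, with $M=\max(\mathfrak k_*^{-1},\alpha_*^{-1})$, $$\mu_1=M\max(1,\beta^*),\quad\mu_2=1+M(\mathfrak k^*+\alpha^*+\nu^*),\quad\mu_3=M(\mathfrak k^*+\alpha^*),\quad\mu_4=M\nu^*,\quad\mu_5=M.$$ -/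

import Mathlib

open MeasureTheory Filter Topology
open scoped ContDiff

namespace VEM

/-- The Euclidean plane. -/
abbrev Plane := EuclideanSpace ℝ (Fin 2)

/-- `L²(D; F)`. -/
noncomputable abbrev L2 (D : Set Plane) (F : Type) [NormedAddCommGroup F] :=
  Lp F 2 (volume.restrict D)

/-! ### The Sobolev spaces `H¹(D)` and `H¹₀(D)` -/

/-- `φ ∈ C_c^∞(D)`. -/
structure IsTestFunction (D : Set Plane) (φ : Plane → ℝ) : Prop where
  smooth : ContDiff ℝ ∞ φ
  compact : HasCompactSupport φ
  supp : tsupport φ ⊆ D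

theorem IsTestFunction.memLp {D : Set Plane} {φ : Plane → ℝ} (h : IsTestFunction D φ)
    (S : Set Plane) : MemLp φ 2 (volume.restrict S) :=
  (h.smooth.continuous.memLp_of_hasCompactSupport h.compact).restrict S

theorem IsTestFunction.memLp_fderiv {D : Set Plane} {φ : Plane → ℝ} (h : IsTestFunction D φ)
    (S : Set Plane) (e : Plane) : MemLp (fun x => fderiv ℝ φ x e) 2 (volume.restrict S) := by
  refine MemLp.restrict S (Continuous.memLp_of_hasCompactSupport ?_ ?_)
  · exact (h.smooth.continuous_fderiv (by simp)).clm_apply continuous_const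
  · exact h.compact.fderiv_apply ℝ e

theorem IsTestFunction.eq_zero {D : Set Plane} {φ : Plane → ℝ} (h : IsTestFunction D φ)
    {x : Plane} (hx : x ∉ D) : φ x = 0 :=
  image_eq_zero_of_notMem_tsupport fun hx' => hx (h.supp hx')

theorem IsTestFunction.fderiv_eq_zero {D : Set Plane} {φ : Plane → ℝ} (h : IsTestFunction D φ)
    {x : Plane} (hx : x ∉ D) (e : Plane) : fderiv ℝ φ x e = 0 := by
  have : fderiv ℝ φ x = 0 := image_eq_zero_of_notMem_tsupport fun hx' =>
    hx (h.supp (tsupport_fderiv_subset ℝ hx'))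
  simp [this]

/-- `H¹(D)`: the pairs `(v, g)` with `v ∈ L²(D)`, `g ∈ L²(D)²` and `g` the weak gradient of `v`.
It carries the (product) topology, which is that of the `H¹` norm. -/
noncomputable def H1 (D : Set Plane) : Submodule ℝ (L2 D ℝ × L2 D Plane) where
  carrier := {w | ∀ φ : Plane → ℝ, IsTestFunction D φ → ∀ e : Plane,
    ∫ x in D, w.1 x * fderiv ℝ φ x e = - ∫ x in D, inner ℝ (w.2 x) e * φ x}
  zero_mem' := by
    intro φ hφ e
    have h1 : (fun x => ((0 : L2 D ℝ) x) * fderiv ℝ φ x e) =ᵐ[volume.restrict D] fun _ => 0 := by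
      filter_upwards [Lp.coeFn_zero ℝ 2 (volume.restrict D)] with x hx
      rw [hx, Pi.zero_apply, zero_mul]
    have h2 : (fun x => inner ℝ ((0 : L2 D Plane) x) e * φ x)
        =ᵐ[volume.restrict D] fun _ => 0 := by
      filter_upwards [Lp.coeFn_zero Plane 2 (volume.restrict D)] with x hx
      rw [hx, Pi.zero_apply, inner_zero_left, zero_mul]
    rw [Prod.fst_zero, Prod.snd_zero, integral_congr_ae h1, integral_congr_ae h2]
    simp
  add_mem' := by
    rintro ⟨v, v'⟩ ⟨w, w'⟩ hv hw φ hφ e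
    have h1 : (fun x => ((v + w : L2 D ℝ) x) * fderiv ℝ φ x e) =ᵐ[volume.restrict D]
        fun x => v x * fderiv ℝ φ x e + w x * fderiv ℝ φ x e := by
      filter_upwards [Lp.coeFn_add v w] with x hx
      rw [hx, Pi.add_apply, add_mul]
    have h2 : (fun x => inner ℝ ((v' + w' : L2 D Plane) x) e * φ x) =ᵐ[volume.restrict D]
        fun x => inner ℝ (v' x) e * φ x + inner ℝ (w' x) e * φ x := by
      filter_upwards [Lp.coeFn_add v' w'] with x hx
      rw [hx, Pi.add_apply, inner_add_left, add_mul]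
    have i1 : ∀ u : L2 D ℝ, Integrable (fun x => u x * fderiv ℝ φ x e) (volume.restrict D) :=
      fun u => (Lp.memLp u).integrable_mul (hφ.memLp_fderiv D e)
    have i2 : ∀ u : L2 D Plane,
        Integrable (fun x => inner ℝ (u x) e * φ x) (volume.restrict D) :=
      fun u => ((Lp.memLp u).inner_const e).integrable_mul (hφ.memLp D)
    have a := hv φ hφ e
    have b := hw φ hφ e
    simp only [Prod.mk_add_mk] at a b ⊢
    rw [integral_congr_ae h1, integral_congr_ae h2, integral_add (i1 v) (i1 w),
      integral_add (i2 v') (i2 w'), a, b]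
    ring
  smul_mem' := by
    rintro c ⟨w, w'⟩ hw φ hφ e
    have h1 : (fun x => ((c • w : L2 D ℝ) x) * fderiv ℝ φ x e) =ᵐ[volume.restrict D]
        fun x => c * (w x * fderiv ℝ φ x e) := by
      filter_upwards [Lp.coeFn_smul c w] with x hx
      rw [hx, Pi.smul_apply, smul_eq_mul, mul_assoc]
    have h2 : (fun x => inner ℝ ((c • w' : L2 D Plane) x) e * φ x) =ᵐ[volume.restrict D]
        fun x => c * (inner ℝ (w' x) e * φ x) := by
      filter_upwards [Lp.coeFn_smul c w'] with x hx
      rw [hx, Pi.smul_apply, real_inner_smul_left, mul_assoc]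
    have a := hw φ hφ e
    simp only [Prod.smul_mk] at a ⊢
    rw [integral_congr_ae h1, integral_congr_ae h2, integral_const_mul, integral_const_mul, a]
    ring

/-- The function underlying an element of `H¹(D)`; `‖v‖_{0,D} = ‖H1.val v‖`. -/
noncomputable def H1.val {D : Set Plane} : H1 D →ₗ[ℝ] L2 D ℝ :=
  LinearMap.fst ℝ (L2 D ℝ) (L2 D Plane) ∘ₗ (H1 D).subtype

/-- The weak gradient; `|v|_{1,D} = ‖H1.grad v‖`. -/
noncomputable def H1.grad {D : Set Plane} : H1 D →ₗ[ℝ] L2 D Plane :=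
  LinearMap.snd ℝ (L2 D ℝ) (L2 D Plane) ∘ₗ (H1 D).subtype

/-- Restriction `L²(D) → L²(A)` for `A ⊆ D`. -/
noncomputable def restrictL2 {F : Type} [NormedAddCommGroup F] [NormedSpace ℝ F]
    {A D : Set Plane} (h : A ⊆ D) : L2 D F →ₗ[ℝ] L2 A F where
  toFun w := ((Lp.memLp w).mono_measure (Measure.restrict_mono h le_rfl)).toLp w
  map_add' v w := by
    rw [← MemLp.toLp_add]
    exact MemLp.toLp_congr _ _
      (ae_mono (Measure.restrict_mono h le_rfl) (Lp.coeFn_add v w))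
  map_smul' c w := by
    rw [RingHom.id_apply, ← MemLp.toLp_const_smul]
    exact MemLp.toLp_congr _ _
      (ae_mono (Measure.restrict_mono h le_rfl) (Lp.coeFn_smul c w))

theorem coeFn_restrictL2 {F : Type} [NormedAddCommGroup F] [NormedSpace ℝ F]
    {A D : Set Plane} (h : A ⊆ D) (w : L2 D F) :
    restrictL2 h w =ᵐ[volume.restrict A] w :=
  MemLp.coeFn_toLp ((Lp.memLp w).mono_measure (Measure.restrict_mono h le_rfl))

/-- Restriction `H¹(D) → H¹(A)` for a subset `A` of an open set `D`. -/
noncomputable def H1.restrict {A D : Set Plane} (hD : IsOpen D) (h : A ⊆ D) :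
    H1 D →ₗ[ℝ] H1 A :=
  LinearMap.restrict ((restrictL2 h).prodMap (restrictL2 h)) (by
    rintro ⟨w, w'⟩ hw φ hφ e
    have h1 : (fun x => restrictL2 h w x * fderiv ℝ φ x e) =ᵐ[volume.restrict A]
        fun x => w x * fderiv ℝ φ x e := by
      filter_upwards [coeFn_restrictL2 h w] with x hx
      rw [hx]
    have h2 : (fun x => inner ℝ (restrictL2 h w' x) e * φ x) =ᵐ[volume.restrict A]
        fun x => inner ℝ (w' x) e * φ x := by
      filter_upwards [coeFn_restrictL2 h w'] with x hx
      rw [hx]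
    have a := hw φ ⟨hφ.smooth, hφ.compact, hφ.supp.trans h⟩ e
    rw [setIntegral_eq_of_subset_of_forall_sdiff_eq_zero hD.measurableSet h
        (fun x hx => by rw [hφ.fderiv_eq_zero hx.2, mul_zero]),
      setIntegral_eq_of_subset_of_forall_sdiff_eq_zero hD.measurableSet h
        (fun x hx => by rw [hφ.eq_zero hx.2, mul_zero])] at a
    simp only [LinearMap.prodMap_apply]
    rw [integral_congr_ae h1, integral_congr_ae h2, a])

/-- `v ∈ H¹(D)` is the class of the smooth function `φ`. -/
def H1.Represents {D : Set Plane} (v : H1 D) (φ : Plane → ℝ) : Prop :=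
  H1.val v =ᵐ[volume.restrict D] φ ∧ H1.grad v =ᵐ[volume.restrict D] gradient φ

/-- `H¹₀(D)`: the closure of `C_c^∞(D)` in `H¹(D)`. -/
def H10 (D : Set Plane) : Set (H1 D) :=
  closure {v | ∃ φ, IsTestFunction D φ ∧ H1.Represents v φ}

theorem memLp_of_continuous {F : Type} [NormedAddCommGroup F] {D : Set Plane}
    (hb : Bornology.IsBounded D) {φ : Plane → F} (hφ : Continuous φ) :
    MemLp φ 2 (volume.restrict D) := by
  obtain ⟨C, hC⟩ := hb.isCompact_closure.exists_bound_of_continuousOn hφ.continuousOn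
  have hfin : IsFiniteMeasure (volume.restrict (closure D)) :=
    ⟨by simpa using hb.isCompact_closure.measure_lt_top⟩
  have hs : AEStronglyMeasurable φ (volume.restrict (closure D)) :=
    hφ.continuousOn.aestronglyMeasurable_of_isCompact hb.isCompact_closure
      isClosed_closure.measurableSet
  have : MemLp φ 2 (volume.restrict (closure D)) :=
    MemLp.of_bound hs C ((ae_restrict_iff' isClosed_closure.measurableSet).2 (ae_of_all _ hC))
  exact this.mono_measure (Measure.restrict_mono subset_closure le_rfl)

theorem continuous_gradient {φ : Plane → ℝ} (hφ : ContDiff ℝ ∞ φ) : Continuous (gradient φ) :=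
  (LinearIsometryEquiv.continuous _).comp (hφ.continuous_fderiv (by simp))

/-- The element of `H¹(D)`, `D` bounded, given by a smooth function. -/
noncomputable def H1.ofSmooth {D : Set Plane} (hb : Bornology.IsBounded D) {φ : Plane → ℝ}
    (hφ : ContDiff ℝ ∞ φ) : H1 D :=
  ⟨((memLp_of_continuous hb hφ.continuous).toLp φ,
    (memLp_of_continuous hb (continuous_gradient hφ)).toLp (gradient φ)), by
    intro ψ hψ e
    have h1 : (fun x => (memLp_of_continuous hb hφ.continuous).toLp φ x * fderiv ℝ ψ x e)
        =ᵐ[volume.restrict D] fun x => φ x * fderiv ℝ ψ x e := by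
      filter_upwards [(memLp_of_continuous hb hφ.continuous).coeFn_toLp] with x hx
      rw [hx]
    have h2 : (fun x => inner ℝ ((memLp_of_continuous hb (continuous_gradient hφ)).toLp
        (gradient φ) x) e * ψ x) =ᵐ[volume.restrict D] fun x => fderiv ℝ φ x e * ψ x := by
      filter_upwards [(memLp_of_continuous hb (continuous_gradient hφ)).coeFn_toLp] with x hx
      rw [hx, gradient, InnerProductSpace.toDual_symm_apply]
    simp only
    rw [integral_congr_ae h1, integral_congr_ae h2,
      setIntegral_eq_integral_of_forall_compl_eq_zero
        (fun x hx => by rw [hψ.fderiv_eq_zero hx, mul_zero]),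
      setIntegral_eq_integral_of_forall_compl_eq_zero
        (fun x hx => by rw [hψ.eq_zero hx, mul_zero])]
    have cφ := hφ.continuous
    have cψ := hψ.smooth.continuous
    have cφ' : Continuous fun x => fderiv ℝ φ x e :=
      (hφ.continuous_fderiv (by simp)).clm_apply continuous_const
    have cψ' : Continuous fun x => fderiv ℝ ψ x e :=
      (hψ.smooth.continuous_fderiv (by simp)).clm_apply continuous_const
    exact integral_mul_fderiv_eq_neg_fderiv_mul_of_integrable
      ((cφ'.mul cψ).integrable_of_hasCompactSupport hψ.compact.mul_left)
      ((cφ.mul cψ').integrable_of_hasCompactSupport (hψ.compact.fderiv_apply ℝ e).mul_left)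
      ((cφ.mul cψ).integrable_of_hasCompactSupport hψ.compact.mul_left)
      (fun x _ => (hφ.differentiable (by simp)) x)
      (fun x _ => (hψ.smooth.differentiable (by simp)) x)⟩

theorem H1.ofSmooth_add {D : Set Plane} (hb : Bornology.IsBounded D) {φ ψ χ : Plane → ℝ}
    (hφ : ContDiff ℝ ∞ φ) (hψ : ContDiff ℝ ∞ ψ) (hχ : ContDiff ℝ ∞ χ) (h : ∀ x, χ x = φ x + ψ x) :
    H1.ofSmooth hb hχ = H1.ofSmooth hb hφ + H1.ofSmooth hb hψ := by
  obtain rfl : χ = φ + ψ := funext h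
  refine Subtype.ext (Prod.ext ?_ ?_)
  · exact MemLp.toLp_add (memLp_of_continuous hb hφ.continuous)
      (memLp_of_continuous hb hψ.continuous)
  · have m1 := memLp_of_continuous hb (continuous_gradient hφ)
    have m2 := memLp_of_continuous hb (continuous_gradient hψ)
    refine Eq.trans (MemLp.toLp_congr (memLp_of_continuous hb (continuous_gradient hχ))
      (m1.add m2) (ae_of_all _ fun x => ?_)) (MemLp.toLp_add m1 m2)
    simp only [gradient, Pi.add_apply]
    rw [fderiv_add (hφ.differentiable (by simp) x) (hψ.differentiable (by simp) x), map_add]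

theorem H1.ofSmooth_smul {D : Set Plane} (hb : Bornology.IsBounded D) {φ χ : Plane → ℝ} (c : ℝ)
    (hφ : ContDiff ℝ ∞ φ) (hχ : ContDiff ℝ ∞ χ) (h : ∀ x, χ x = c * φ x) :
    H1.ofSmooth hb hχ = c • H1.ofSmooth hb hφ := by
  obtain rfl : χ = c • φ := funext h
  refine Subtype.ext (Prod.ext ?_ ?_)
  · exact MemLp.toLp_const_smul c (memLp_of_continuous hb hφ.continuous)
  · have m1 := memLp_of_continuous hb (continuous_gradient hφ)
    refine Eq.trans (MemLp.toLp_congr (memLp_of_continuous hb (continuous_gradient hχ))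
      (m1.const_smul c) (ae_of_all _ fun x => ?_)) (MemLp.toLp_const_smul c m1)
    simp only [gradient, Pi.smul_apply]
    rw [fderiv_const_smul (hφ.differentiable (by simp) x), map_smul]

/-! ### Polygons -/

/-- An open polygon: the bounded open region enclosed by a simple closed polygonal curve. Angles
equal to `π` are allowed. -/
structure Polygon where
  n : ℕ
  three_le : 3 ≤ n
  vertex : Fin n → Plane
  vertex_injective : Function.Injective vertex
  edges_inter : ∀ i j, i ≠ j →
    segment ℝ (vertex i) (vertex (finRotate n i)) ∩ segment ℝ (vertex j) (vertex (finRotate n j)) ⊆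
      {vertex i, vertex (finRotate n i)} ∩ {vertex j, vertex (finRotate n j)}
  carrier : Set Plane
  isOpen : IsOpen carrier
  isBounded : Bornology.IsBounded carrier
  nonempty : carrier.Nonempty
  frontier_eq : frontier carrier = ⋃ i, segment ℝ (vertex i) (vertex (finRotate n i))

namespace Polygon

variable (K : Polygon)

/-- The `i`-th edge. -/
def edge (i : Fin K.n) : Set Plane := segment ℝ (K.vertex i) (K.vertex (finRotate K.n i))

/-- The length of the `i`-th edge. -/
noncomputable def edgeLength (i : Fin K.n) : ℝ := dist (K.vertex i) (K.vertex (finRotate K.n i))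

/-- The parametrization of the `i`-th edge over `[0, 1]`. -/
noncomputable def edgePoint (i : Fin K.n) (t : ℝ) : Plane :=
  AffineMap.lineMap (K.vertex i) (K.vertex (finRotate K.n i)) t

/-- The diameter `h_K`. -/
noncomputable def h : ℝ := Metric.diam K.carrier

/-- The arc length measure on `∂K`. -/
noncomputable def boundaryMeasure : Measure Plane :=
  ∑ i, ENNReal.ofReal (K.edgeLength i) •
    Measure.map (K.edgePoint i) (volume.restrict (Set.Icc (0 : ℝ) 1))

/-- `g ∈ L²(∂K)` is the trace of `v ∈ H¹(K)`: the limit in `L²(∂K)` of the boundary values of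
smooth functions that converge to `v` in `H¹(K)`. -/
def HasTrace (v : H1 K.carrier) (g : Plane → ℝ) : Prop :=
  MemLp g 2 K.boundaryMeasure ∧
  ∃ (φ : ℕ → Plane → ℝ) (w : ℕ → H1 K.carrier),
    (∀ j, ContDiff ℝ ∞ (φ j) ∧ H1.Represents (w j) (φ j)) ∧
    Tendsto w atTop (𝓝 v) ∧
    Tendsto (fun j => eLpNorm (φ j - g) 2 K.boundaryMeasure) atTop (𝓝 0)

/-! ### Polynomials and projections on a polygon -/

theorem contDiff_eval (q : MvPolynomial (Fin 2) ℝ) :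
    ContDiff ℝ ∞ (fun x : Plane => MvPolynomial.eval x q) := by
  induction q using MvPolynomial.induction_on with
  | C a => simpa using contDiff_const
  | add p q hp hq => simpa using hp.add hq
  | mul_X p i hp =>
    have hi : ContDiff ℝ ∞ (fun x : Plane => x i) :=
      (EuclideanSpace.proj (𝕜 := ℝ) i).contDiff
    simpa using hp.mul hi

/-- The polynomial functions of degree at most `ℓ`, as elements of `H¹(K)`. -/
noncomputable def polyMap (ℓ : ℕ) :
    MvPolynomial.restrictTotalDegree (Fin 2) ℝ ℓ →ₗ[ℝ] H1 K.carrier where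
  toFun q := H1.ofSmooth K.isBounded (contDiff_eval q.1)
  map_add' p q := H1.ofSmooth_add _ _ _ _ fun x => by simp
  map_smul' c q := H1.ofSmooth_smul _ c _ _ fun x => by simp

/-- `ℙ_ℓ(K)` as a subspace of `H¹(K)`. -/
noncomputable def polyH1 (ℓ : ℕ) : Submodule ℝ (H1 K.carrier) := LinearMap.range (K.polyMap ℓ)

/-- `ℙ_ℓ(K)` as a subspace of `L²(K)`. -/
noncomputable def polyL2 (ℓ : ℕ) : Submodule ℝ (L2 K.carrier ℝ) := (K.polyH1 ℓ).map H1.val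

/-- `ℙ_ℓ(K)²` as a subspace of `L²(K)²`. -/
noncomputable def polyL2Vec (ℓ : ℕ) : Submodule ℝ (L2 K.carrier Plane) :=
  ⨆ i : Fin 2, (K.polyL2 ℓ).map
    (ContinuousLinearMap.compLpL 2 (volume.restrict K.carrier)
      (ContinuousLinearMap.toSpanSingleton ℝ (EuclideanSpace.single i (1 : ℝ)))).toLinearMap

instance (ℓ : ℕ) : FiniteDimensional ℝ (K.polyH1 ℓ) := by unfold polyH1; infer_instance

instance (ℓ : ℕ) : FiniteDimensional ℝ (K.polyL2 ℓ) := by unfold polyL2; infer_instance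

instance (ℓ : ℕ) : FiniteDimensional ℝ (K.polyL2Vec ℓ) := by unfold polyL2Vec; infer_instance

/-- The `L²(K)`-orthogonal projection `Π⁰_ℓ` onto `ℙ_ℓ(K)`. -/
noncomputable def proj0 (ℓ : ℕ) (v : L2 K.carrier ℝ) : L2 K.carrier ℝ :=
  (K.polyL2 ℓ).starProjection v

/-- The vector version of `Π⁰_ℓ`. -/
noncomputable def proj0Vec (ℓ : ℕ) (g : L2 K.carrier Plane) : L2 K.carrier Plane :=
  (K.polyL2Vec ℓ).starProjection g

theorem exists_proj0 (ℓ : ℕ) (v : H1 K.carrier) :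
    ∃ w ∈ K.polyH1 ℓ, H1.val w = K.proj0 ℓ (H1.val v) :=
  Submodule.mem_map.1 ((K.polyL2 ℓ).starProjection_apply_mem (H1.val v))

/-- `Π⁰_ℓ v` for `v ∈ H¹(K)`, as an element of `H¹(K)`. -/
noncomputable def proj0H1 (ℓ : ℕ) (v : H1 K.carrier) : H1 K.carrier := (K.exists_proj0 ℓ v).choose

/-- `q = Π^∇_ℓ v`: `q ∈ ℙ_ℓ(K)`, `(∇q - ∇v, ∇r)_{0,K} = 0` for all `r ∈ ℙ_ℓ(K)`, and
`∫_{∂K} (v - q) = 0`. -/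
def IsProjGrad (ℓ : ℕ) (v q : H1 K.carrier) : Prop :=
  q ∈ K.polyH1 ℓ ∧
  (∀ r ∈ K.polyH1 ℓ, inner ℝ (H1.grad q - H1.grad v) (H1.grad r) = 0) ∧
  ∃ g, K.HasTrace (v - q) g ∧ ∫ x, g x ∂K.boundaryMeasure = 0

open Classical in
/-- The projection `Π^∇_ℓ v` of `v ∈ H¹(K)`, the unique `q` with `IsProjGrad`. -/
noncomputable def projGrad (ℓ : ℕ) (v : H1 K.carrier) : H1 K.carrier :=
  if h : ∃ q, K.IsProjGrad ℓ v q then h.choose else 0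

/-! ### The local virtual element space -/

/-- The auxiliary space: continuous on the closure of `K`, Laplacian in `ℙ_{p-1}(K)` (in the sense
of distributions), and polynomial of degree at most `p` on each edge. -/
def IsAuxVirtual (p : ℕ) (v : H1 K.carrier) : Prop :=
  (∃ w : Plane → ℝ, ContinuousOn w (closure K.carrier) ∧
    H1.val v =ᵐ[volume.restrict K.carrier] w ∧
    ∀ i, ∃ r : Polynomial ℝ, r.natDegree ≤ p ∧
      ∀ t ∈ Set.Icc (0 : ℝ) 1, w (K.edgePoint i t) = r.eval t) ∧
  ∃ q ∈ K.polyL2 (p - 1), ∀ φ, IsTestFunction K.carrier φ →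
    ∫ x in K.carrier, inner ℝ (H1.grad v x) (gradient φ x) = - ∫ x in K.carrier, q x * φ x

/-- The local (enhanced) virtual element space `V_n(K)` of degree `p ≥ 1`: the functions `v` of the
auxiliary space such that `v - Π^∇_p v` is orthogonal to every `m ∈ ℙ_{p-1}(K)` that is orthogonal
to `ℙ_{p-2}(K)`, where `ℙ_{-1}(K) = 0`. -/
def localSpace (p : ℕ) : Set (H1 K.carrier) :=
  {v | K.IsAuxVirtual p v ∧
    ∀ m ∈ K.polyL2 (p - 1),
      (∀ ℓ : ℕ, ℓ + 2 ≤ p → ∀ r ∈ K.polyL2 ℓ, inner ℝ m r = 0) →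
      inner ℝ (H1.val (v - K.projGrad p v)) m = 0}

/-- The stabilization of the diffusion term. A bilinear form on `ker Π^∇_p ⊆ H¹(K)` is given by a
bilinear form on `H¹(K)`, of which only the values on the kernel matter: there it is symmetric and
nonnegative, and it satisfies the two stability bounds. -/
structure IsStab1 (p : ℕ) (αLo αHi : ℝ) (S : LinearMap.BilinForm ℝ (H1 K.carrier)) : Prop where
  symm : ∀ v w, K.IsProjGrad p v 0 → K.IsProjGrad p w 0 → S v w = S w v
  nonneg : ∀ v, K.IsProjGrad p v 0 → 0 ≤ S v v
  lower : ∀ v ∈ K.localSpace p, K.IsProjGrad p v 0 → αLo * ‖H1.grad v‖ ^ 2 ≤ S v v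
  upper : ∀ v, K.IsProjGrad p v 0 → S v v ≤ αHi * ‖H1.grad v‖ ^ 2

/-- The stabilization of the `L²` product, a bilinear form on `ker Π⁰_{p-1} ⊆ H¹(K)`, represented
in the same way. -/
structure IsStab0 (p : ℕ) (βLo βHi : ℝ) (S : LinearMap.BilinForm ℝ (H1 K.carrier)) : Prop where
  symm : ∀ v w, K.proj0 (p - 1) (H1.val v) = 0 → K.proj0 (p - 1) (H1.val w) = 0 → S v w = S w v
  nonneg : ∀ v, K.proj0 (p - 1) (H1.val v) = 0 → 0 ≤ S v v
  lower : ∀ v ∈ K.localSpace p, K.proj0 (p - 1) (H1.val v) = 0 → βLo * ‖H1.val v‖ ^ 2 ≤ S v v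
  upper : ∀ v, S (v - K.proj0H1 (p - 1) v) (v - K.proj0H1 (p - 1) v) ≤
    K.h ^ 2 * βHi * ‖H1.grad (v - K.projGrad (p - 1) v)‖ ^ 2

end Polygon

/-! ### Coefficients -/

/-- A measurable diffusion tensor on `Ω`, a.e. symmetric, with
`kLo |ξ|² ≤ (𝕂 ξ) · ξ ≤ kHi |ξ|²`. -/
structure DiffusionTensor (Ω : Set Plane) (kLo kHi : ℝ) where
  toFun : Plane → Matrix (Fin 2) (Fin 2) ℝ
  aemeasurable : ∀ i j, AEMeasurable (fun x => toFun x i j) (volume.restrict Ω)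
  symm : ∀ᵐ x ∂volume.restrict Ω, (toFun x).IsSymm
  lower : ∀ᵐ x ∂volume.restrict Ω, ∀ ξ : Plane,
    kLo * ‖ξ‖ ^ 2 ≤ inner ℝ (Matrix.toEuclideanLin (toFun x) ξ) ξ
  upper : ∀ᵐ x ∂volume.restrict Ω, ∀ ξ : Plane,
    inner ℝ (Matrix.toEuclideanLin (toFun x) ξ) ξ ≤ kHi * ‖ξ‖ ^ 2

/-- A measurable potential on `Ω` with `νLo ≤ V ≤ νHi` a.e. -/
structure Potential (Ω : Set Plane) (νLo νHi : ℝ) where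
  toFun : Plane → ℝ
  aemeasurable : AEMeasurable toFun (volume.restrict Ω)
  lower : ∀ᵐ x ∂volume.restrict Ω, νLo ≤ toFun x
  upper : ∀ᵐ x ∂volume.restrict Ω, toFun x ≤ νHi

/-- The bound on the quadratic form of a symmetric tensor bounds the tensor. -/
theorem norm_toEuclideanLin_le {A : Matrix (Fin 2) (Fin 2) ℝ} (hA : A.IsSymm) {M : ℝ}
    (hM : ∀ ξ : Plane, |inner ℝ (Matrix.toEuclideanLin A ξ) ξ| ≤ M * ‖ξ‖ ^ 2) (ξ : Plane) :
    ‖Matrix.toEuclideanLin A ξ‖ ≤ M * ‖ξ‖ := by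
  set L := Matrix.toEuclideanLin A with hL
  have hs : L.IsSymmetric := by
    rw [hL, Matrix.isSymmetric_toEuclideanLin_iff]
    rw [Matrix.IsHermitian, Matrix.conjTranspose_eq_transpose_of_trivial]
    exact hA
  by_cases h0 : L ξ = 0
  · have h1 := (abs_nonneg _).trans (hM ξ)
    rw [h0, norm_zero]
    rcases eq_or_ne ξ 0 with rfl | hξ
    · simp
    · have := norm_pos_iff.2 hξ
      have : 0 ≤ M := nonneg_of_mul_nonneg_left h1 (by positivity)
      positivity
  · have hξ : ξ ≠ 0 := fun h => h0 (by rw [h, map_zero])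
    have p1 := norm_pos_iff.2 hξ
    have p2 := norm_pos_iff.2 h0
    set η : Plane := (‖ξ‖ / ‖L ξ‖) • L ξ with hη
    have nη : ‖η‖ = ‖ξ‖ := by
      rw [hη, norm_smul, norm_div, norm_norm, norm_norm, div_mul_cancel₀ _ p2.ne']
    have iη : inner ℝ (L ξ) η = ‖ξ‖ * ‖L ξ‖ := by
      rw [hη, real_inner_smul_right, real_inner_self_eq_norm_sq]
      field_simp
    have pol : 4 * inner ℝ (L ξ) η =
        inner ℝ (L (ξ + η)) (ξ + η) - inner ℝ (L (ξ - η)) (ξ - η) := by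
      have := hs η ξ
      rw [real_inner_comm] at this
      simp only [map_add, map_sub, inner_add_left, inner_add_right, inner_sub_left,
        inner_sub_right]
      rw [real_inner_comm ξ (L η), this, real_inner_comm (L ξ) η]
      ring
    have b1 := (abs_le.1 (hM (ξ + η))).2
    have b2 := (abs_le.1 (hM (ξ - η))).1
    have par := parallelogram_law_with_norm ℝ ξ η
    have : 4 * (‖ξ‖ * ‖L ξ‖) ≤ 4 * (M * ‖ξ‖ * ‖ξ‖) := by
      rw [← iη, pol]
      rw [nη] at par
      have : M * ‖ξ + η‖ ^ 2 + M * ‖ξ - η‖ ^ 2 = 4 * (M * ‖ξ‖ * ‖ξ‖) := by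
        linear_combination M * par
      linarith
    nlinarith

theorem DiffusionTensor.memLp {Ω : Set Plane} {kLo kHi : ℝ} (k : DiffusionTensor Ω kLo kHi)
    {A : Set Plane} (h : A ⊆ Ω) (g : L2 A Plane) :
    MemLp (fun x => Matrix.toEuclideanLin (k.toFun x) (g x)) 2 (volume.restrict A) := by
  have hle := Measure.restrict_mono (μ := volume) h le_rfl
  refine (Lp.memLp g).of_le_mul (c := max |kLo| |kHi|) ?_ ?_
  · refine AEMeasurable.aestronglyMeasurable ?_
    have hg : AEMeasurable (fun x => (g x : Plane)) (volume.restrict A) :=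
      (Lp.aestronglyMeasurable g).aemeasurable
    have : AEMeasurable (fun x => (fun i => ∑ j, k.toFun x i j * g x j : Fin 2 → ℝ))
        (volume.restrict A) := by
      refine aemeasurable_pi_lambda _ fun i => Finset.aemeasurable_fun_sum _ fun j _ => ?_
      exact ((k.aemeasurable i j).mono_measure hle).mul
        ((EuclideanSpace.proj (𝕜 := ℝ) j).continuous.measurable.comp_aemeasurable hg)
    have h2 := (PiLp.continuous_toLp 2 (fun _ : Fin 2 => ℝ)).measurable.comp_aemeasurable this
    refine h2.congr (ae_of_all _ fun x => ?_)
    ext i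
    rfl
  · filter_upwards [ae_mono hle k.symm, ae_mono hle k.lower, ae_mono hle k.upper] with x h1 h2 h3
    refine norm_toEuclideanLin_le h1 (fun ξ => ?_) (g x)
    have := sq_nonneg ‖ξ‖
    rw [abs_le]
    have a1 := mul_le_mul_of_nonneg_right ((neg_abs_le kLo).trans' (neg_le_neg
      (le_max_left |kLo| |kHi|))) this
    have a2 := mul_le_mul_of_nonneg_right ((le_abs_self kHi).trans
      (le_max_right |kLo| |kHi|)) this
    exact ⟨by linarith [h2 ξ], by linarith [h3 ξ]⟩

theorem Potential.memLp {Ω : Set Plane} {νLo νHi : ℝ} (V : Potential Ω νLo νHi)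
    {A : Set Plane} (h : A ⊆ Ω) (v : L2 A ℝ) :
    MemLp (fun x => V.toFun x * v x) 2 (volume.restrict A) := by
  have hle := Measure.restrict_mono (μ := volume) h le_rfl
  refine (Lp.memLp v).of_le_mul (c := max |νLo| |νHi|) ?_ ?_
  · exact (V.aemeasurable.mono_measure hle).aestronglyMeasurable.mul (Lp.aestronglyMeasurable v)
  · filter_upwards [ae_mono hle V.lower, ae_mono hle V.upper] with x h1 h2
    rw [norm_mul]
    exact mul_le_mul_of_nonneg_right (abs_le_max_abs_abs h1 h2) (norm_nonneg _)

/-- `g ↦ 𝕂 g` on `L²(A)²`, for `A ⊆ Ω`. -/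
noncomputable def DiffusionTensor.mul {Ω : Set Plane} {kLo kHi : ℝ}
    (k : DiffusionTensor Ω kLo kHi) {A : Set Plane} (h : A ⊆ Ω) (g : L2 A Plane) : L2 A Plane :=
  (k.memLp h g).toLp _

/-- `v ↦ V v` on `L²(A)`, for `A ⊆ Ω`. -/
noncomputable def Potential.mul {Ω : Set Plane} {νLo νHi : ℝ} (V : Potential Ω νLo νHi)
    {A : Set Plane} (h : A ⊆ Ω) (v : L2 A ℝ) : L2 A ℝ :=
  (V.memLp h v).toLp _

/-- `u ∈ H¹₀(Ω)` solves the source problem `(𝕂∇u, ∇v) + (V u, v) = (f, v)` for all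
`v ∈ H¹₀(Ω)`. -/
def IsSolution {Ω : Set Plane} {kLo kHi νLo νHi : ℝ} (k : DiffusionTensor Ω kLo kHi)
    (V : Potential Ω νLo νHi) (f u : H1 Ω) : Prop :=
  u ∈ H10 Ω ∧ ∀ v ∈ H10 Ω,
    inner ℝ (k.mul subset_rfl (H1.grad u)) (H1.grad v) +
      inner ℝ (V.mul subset_rfl (H1.val u)) (H1.val v) = inner ℝ (H1.val f) (H1.val v)

/-! ### Meshes and the virtual element method -/

/-- A conforming polygonal decomposition of `Ω`: finitely many pairwise disjoint polygons whose
closures cover the closure of `Ω`, two closed polygons meeting only along common edges or at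
common vertices. -/
structure Mesh (Ω : Set Plane) where
  N : ℕ
  elem : Fin N → Polygon
  subset : ∀ i, (elem i).carrier ⊆ Ω
  disjoint : ∀ i j, i ≠ j → Disjoint (elem i).carrier (elem j).carrier
  cover : closure Ω = ⋃ i, closure (elem i).carrier
  conforming : ∀ i j, i ≠ j → ∀ x ∈ closure (elem i).carrier ∩ closure (elem j).carrier,
    (∃ a b, (elem i).vertex a = x ∧ (elem j).vertex b = x) ∨
    (∃ a b, (elem i).edge a = (elem j).edge b ∧ x ∈ (elem i).edge a)

namespace Mesh

variable {Ω : Set Plane} (T : Mesh Ω)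

/-- Shape regularity with parameter `γ`: every edge of `K` has length at least `γ h_K`, and `K` is
star-shaped with respect to a ball of radius at least `γ h_K`. -/
structure IsRegular (γ : ℝ) : Prop where
  edges : ∀ i a, γ * (T.elem i).h ≤ (T.elem i).edgeLength a
  starShaped : ∀ i, ∃ (c : Plane) (r : ℝ), γ * (T.elem i).h ≤ r ∧
    Metric.ball c r ⊆ (T.elem i).carrier ∧ ∀ y ∈ Metric.ball c r, StarConvex ℝ y (T.elem i).carrier

/-- The restriction `H¹(Ω) → H¹(K)` to the `i`-th element. -/
noncomputable def res (hΩ : IsOpen Ω) (i : Fin T.N) : H1 Ω →ₗ[ℝ] H1 (T.elem i).carrier :=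
  H1.restrict hΩ (T.subset i)

/-- The global virtual element space `V_n`. -/
def space (hΩ : IsOpen Ω) (p : ℕ) : Set (H1 Ω) :=
  {v | v ∈ H10 Ω ∧
    (∃ w : Plane → ℝ, ContinuousOn w (closure Ω) ∧ H1.val v =ᵐ[volume.restrict Ω] w) ∧
    ∀ i, T.res hΩ i v ∈ (T.elem i).localSpace p}

/-- The local discrete form `a_n^K`. -/
noncomputable def aLoc {kLo kHi : ℝ} (k : DiffusionTensor Ω kLo kHi) (p : ℕ)
    (S : ∀ i, LinearMap.BilinForm ℝ (H1 (T.elem i).carrier)) (i : Fin T.N)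
    (u v : H1 (T.elem i).carrier) : ℝ :=
  inner ℝ (k.mul (T.subset i) ((T.elem i).proj0Vec (p - 1) (H1.grad u)))
      ((T.elem i).proj0Vec (p - 1) (H1.grad v)) +
    S i (u - (T.elem i).projGrad p u) (v - (T.elem i).projGrad p v)

/-- The local discrete form `b_n^K`. -/
noncomputable def bLoc {νLo νHi : ℝ} (V : Potential Ω νLo νHi) (p : ℕ) (i : Fin T.N)
    (u v : H1 (T.elem i).carrier) : ℝ :=
  inner ℝ (V.mul (T.subset i) ((T.elem i).proj0 (p - 1) (H1.val u)))
    ((T.elem i).proj0 (p - 1) (H1.val v))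

/-- The local discrete form `c_n^K`. -/
noncomputable def cLoc (p : ℕ) (S : ∀ i, LinearMap.BilinForm ℝ (H1 (T.elem i).carrier))
    (i : Fin T.N) (u v : H1 (T.elem i).carrier) : ℝ :=
  inner ℝ ((T.elem i).proj0 (p - 1) (H1.val u)) ((T.elem i).proj0 (p - 1) (H1.val v)) +
    S i (u - (T.elem i).proj0H1 (p - 1) u) (v - (T.elem i).proj0H1 (p - 1) v)

/-- `u_n ∈ V_n` solves the discrete source problem `a_n(u_n, v) + b_n(u_n, v) = c_n(f, v)` for all
`v ∈ V_n`. -/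
def IsDiscreteSolution (hΩ : IsOpen Ω) (p : ℕ) {kLo kHi νLo νHi : ℝ}
    (k : DiffusionTensor Ω kLo kHi) (V : Potential Ω νLo νHi)
    (S₁ S₀ : ∀ i, LinearMap.BilinForm ℝ (H1 (T.elem i).carrier)) (f un : H1 Ω) : Prop :=
  un ∈ T.space hΩ p ∧ ∀ v ∈ T.space hΩ p,
    ∑ i, T.aLoc k p S₁ i (T.res hΩ i un) (T.res hΩ i v) +
      ∑ i, T.bLoc V p i (T.res hΩ i un) (T.res hΩ i v) =
    ∑ i, T.cLoc p S₀ i (T.res hΩ i f) (T.res hΩ i v)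

end Mesh

end VEM

/-!
The error estimate is proved by the energy argument for `d = u_n - u_I ∈ V_n`. The discrete form is
coercive, `min (𝔨_*, α_*) |d|² ≤ a_n(d, d) + b_n(d, d)` (`Mesh.aLoc_coercive`), and subtracting the
continuous problem from the discrete one, both tested with `d`, bounds the energy of `d` by three
consistency errors (`Mesh.IsRegular.energy_le`), which are estimated element by element:

* the diffusion form and the reaction form differ from the exact ones by the errors of the
  projections of `𝕂∇u`, `∇u`, `Vu`, `u`, by `u - u_I`, and by the stabilization, to which the
  Cauchy–Schwarz inequality on `ker Π^∇_p` applies (`Mesh.inner_sub_aLoc_le`,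
  `Mesh.inner_sub_bLoc_le`);
* the right-hand side contributes a product of two projection errors, each of which gains one power
  of `h_K` from the Poincaré inequality on the element, and a stabilization of the same order
  (`Mesh.IsRegular.cLoc_sub_inner_le`).

The sum over the elements, the Poincaré inequality on `H¹₀(Ω)` (`exists_poincare_H10`), and the
triangle inequality complete the proof; the constant depends on `γ` and on the Poincaré constant of
`Ω` only.

The estimates on the elements come from averaging over the segments that join the points of a
star-shaped set to the points of the ball. With `A_t v(x) = ∫ v((1 - t) y + t x) η(y) dy`, where `η`
is a smooth density on the ball, `A_t v` is smooth, `∇ A_t v = t A_t ∇v`, and `A_t v → v` in `H¹` as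
`t → 1`, and uniformly if `v` is continuous up to the boundary
(`IsStarShapedBall.exists_smooth_approx`). So the functions of the virtual element space have
traces, and `Π^∇` exists for them (`Polygon.exists_isProjGrad`). Averages of the same kind,
integrated over `t ∈ [0, 1]`, give the Poincaré inequality with an explicit constant
(`norm_sub_starProjection_le`).
That `Π^∇` is unique, hence linear on the virtual element space, needs one trace inequality, for the
integral over an edge; it is obtained by integration over the triangle spanned by the edge and the
centre of the ball (`exists_enorm_edge_integral_le`). For `f`, a general element of `H¹`, only the
fact that `Π^∇_{p-1} f` is a polynomial of degree at most `p - 1` on each element is used.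
-/

namespace VEM

/-! ### Star-shaped sets and affine substitutions -/

/-- `D` is open, bounded, and star-shaped with respect to every point of the ball `B(c, r)`. -/
structure IsStarShapedBall (D : Set Plane) (c : Plane) (r : ℝ) : Prop where
  isOpen : IsOpen D
  isBounded : Bornology.IsBounded D
  pos : 0 < r
  ball_subset : Metric.ball c r ⊆ D
  star : ∀ y ∈ Metric.ball c r, StarConvex ℝ y D

/-- The point `(1 - t) y + t x` of the segment from `y` to `x`. -/
def mix (t : ℝ) (q : Plane × Plane) : Plane := (1 - t) • q.2 + t • q.1

theorem continuous_mix (t : ℝ) : Continuous (mix t) := by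
  unfold mix; fun_prop

namespace IsStarShapedBall

variable {D : Set Plane} {c : Plane} {r : ℝ}

theorem mix_mem (h : IsStarShapedBall D c r) {t : ℝ} (ht0 : 0 ≤ t) (ht1 : t ≤ 1) {x y : Plane}
    (hx : x ∈ D) (hy : y ∈ Metric.ball c r) : mix t (x, y) ∈ D :=
  h.star y hy hx (by linarith) ht0 (by ring)

/-- The half-open segment from a point of the ball to a point of the closure of `D` lies in `D`. -/
theorem mix_mem_of_closure (h : IsStarShapedBall D c r) {t : ℝ} (ht0 : 0 ≤ t) (ht1 : t < 1)
    {x y : Plane} (hx : x ∈ closure D) (hy : y ∈ Metric.ball c r) : mix t (x, y) ∈ D := by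
  -- `x` is replaced by a nearby `x' ∈ D`, and `y` is moved to compensate for it.
  have h1 : (0 : ℝ) < 1 - t := by linarith
  set F : Plane → Plane := fun x' => y + (t / (1 - t)) • (x - x') with hF
  have hc : ContinuousAt F x := by fun_prop
  have hFx : F x ∈ Metric.ball c r := by simpa [hF] using hy
  have hev := hc.preimage_mem_nhds (Metric.isOpen_ball.mem_nhds hFx)
  obtain ⟨x', hx'1, hx'2⟩ := mem_closure_iff_nhds.1 hx _ hev
  have := h.mix_mem ht0 ht1.le hx'2 hx'1
  convert this using 1
  simp only [mix, hF, smul_add, smul_smul, smul_sub]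
  rw [mul_div_cancel₀ _ h1.ne']
  abel

end IsStarShapedBall

theorem volume_preimage_affine (a : Plane) {t : ℝ} (ht : t ≠ 0) (S : Set Plane) :
    volume ((fun x => a + t • x) ⁻¹' S) = ENNReal.ofReal ((t ^ 2)⁻¹) * volume S := by
  have h1 : (fun x => a + t • x) ⁻¹' S = (t • ·) ⁻¹' ((fun x => a + x) ⁻¹' S) := rfl
  rw [h1, Measure.addHaar_preimage_smul _ ht, measure_preimage_add]
  simp

theorem map_affine_restrict_le {A D : Set Plane}
    (a : Plane) {t : ℝ} (ht : t ≠ 0) (h : ∀ x ∈ A, a + t • x ∈ D) :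
    (volume.restrict A).map (fun x => a + t • x) ≤
      ENNReal.ofReal ((t ^ 2)⁻¹) • volume.restrict D := by
  have hm : Measurable fun x : Plane => a + t • x := by fun_prop
  refine Measure.le_iff.2 fun S hS => ?_
  rw [Measure.map_apply hm hS, Measure.restrict_apply (hm hS), Measure.smul_apply,
    Measure.restrict_apply hS, smul_eq_mul, ← volume_preimage_affine a ht]
  exact measure_mono fun x hx => ⟨hx.1, h x hx.2⟩

/-- The law of `(1 - t) y + t x`, for `x` uniform on `A` and `y` with law `P`, has a density bounded
by `t⁻²`, whatever `P` is. -/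
theorem map_mix_le {A D : Set Plane}
    (P : Measure Plane) [IsProbabilityMeasure P] {t : ℝ} (ht : t ≠ 0)
    (h : ∀ᵐ y ∂P, ∀ x ∈ A, mix t (x, y) ∈ D) :
    ((volume.restrict A).prod P).map (mix t) ≤
      ENNReal.ofReal ((t ^ 2)⁻¹) • volume.restrict D := by
  have hm : Measurable (mix t) := (continuous_mix t).measurable
  refine Measure.le_iff.2 fun S hS => ?_
  rw [Measure.map_apply hm hS, Measure.prod_apply_symm (hm hS)]
  calc ∫⁻ y, (volume.restrict A) ((fun x => (x, y)) ⁻¹' (mix t ⁻¹' S)) ∂P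
      ≤ ∫⁻ _, (ENNReal.ofReal ((t ^ 2)⁻¹) • volume.restrict D) S ∂P := by
        refine lintegral_mono_ae ?_
        filter_upwards [h] with y hy
        have hm' : Measurable fun x : Plane => (1 - t) • y + t • x := by fun_prop
        have := map_affine_restrict_le ((1 - t) • y) ht hy S
        rwa [Measure.map_apply hm' hS] at this
    _ = _ := by simp

/-! ### Averages along dilations -/

section Average

variable {F : Type} [NormedAddCommGroup F]

section Measurability

variable {D : Set Plane} {c : Plane} {r : ℝ} (P : Measure Plane) [IsProbabilityMeasure P]

theorem aestronglyMeasurable_comp_mix (h : IsStarShapedBall D c r)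
    (hP : ∀ᵐ y ∂P, y ∈ Metric.ball c r) {t : ℝ} (ht0 : 0 < t) (ht1 : t ≤ 1) {g : Plane → F}
    (hg : AEStronglyMeasurable g (volume.restrict D)) :
    AEStronglyMeasurable (fun q => g (mix t q)) ((volume.restrict D).prod P) := by
  have hle := map_mix_le P ht0.ne'
    (hP.mono fun y hy x hx => h.mix_mem ht0.le ht1 hx hy)
  refine AEStronglyMeasurable.comp_measurable (f := mix t) ?_ (continuous_mix t).measurable
  exact (hg.mono_ac (Measure.smul_absolutelyContinuous)).mono_measure hle

/-- Composition with the dilations is bounded on `L²`, uniformly in `t ≥ 1/2`. -/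
theorem eLpNorm_comp_mix_le (h : IsStarShapedBall D c r)
    (hP : ∀ᵐ y ∂P, y ∈ Metric.ball c r) {t : ℝ} (ht0 : 1 / 2 ≤ t) (ht1 : t ≤ 1) {g : Plane → F}
    (hg : AEStronglyMeasurable g (volume.restrict D)) :
    eLpNorm (fun q => g (mix t q)) 2 ((volume.restrict D).prod P) ≤
      2 * eLpNorm g 2 (volume.restrict D) := by
  have ht : 0 < t := by linarith
  have hle := map_mix_le P ht.ne'
    (hP.mono fun y hy x hx => h.mix_mem ht.le ht1 hx hy)
  have h4 : ENNReal.ofReal ((t ^ 2)⁻¹) ≤ 4 := by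
    refine ENNReal.ofReal_le_of_le_toReal ?_
    rw [ENNReal.toReal_ofNat]
    refine inv_le_of_inv_le₀ (by norm_num) ?_
    nlinarith
  have hle' : ((volume.restrict D).prod P).map (mix t) ≤ (4 : ENNReal) • volume.restrict D :=
    hle.trans (Measure.le_iff'.2 fun S => by
      simp only [Measure.smul_apply, smul_eq_mul]; gcongr)
  have hg' : AEStronglyMeasurable g (((volume.restrict D).prod P).map (mix t)) :=
    (hg.mono_ac (Measure.smul_absolutelyContinuous)).mono_measure hle
  have := eLpNorm_map_measure (p := 2) hg' (continuous_mix t).measurable.aemeasurable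
  rw [show (fun q => g (mix t q)) = g ∘ mix t from rfl, ← this]
  refine (eLpNorm_mono_measure g hle').trans (le_of_eq ?_)
  rw [eLpNorm_smul_measure_of_ne_top (by norm_num), smul_eq_mul]
  congr 1
  rw [show (4 : ENNReal) = 2 ^ (2 : ℝ) by norm_num, ← ENNReal.rpow_mul]
  norm_num

end Measurability

variable [NormedSpace ℝ F]

/-- Jensen's inequality for the square, integrated over a parameter. -/
theorem eLpNorm_integral_le {α β : Type} [MeasurableSpace α] [MeasurableSpace β] (μ : Measure α)
    (P : Measure β) [SFinite μ] [IsProbabilityMeasure P] {G : α × β → F}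
    (hG : AEStronglyMeasurable G (μ.prod P)) :
    eLpNorm (fun x => ∫ y, G (x, y) ∂P) 2 μ ≤ eLpNorm G 2 (μ.prod P) := by
  rw [eLpNorm_eq_lintegral_rpow_enorm_toReal (by norm_num) (by norm_num),
    eLpNorm_eq_lintegral_rpow_enorm_toReal (by norm_num) (by norm_num),
    lintegral_prod _ (hG.enorm.pow_const _)]
  refine ENNReal.rpow_le_rpow (lintegral_mono_ae ?_) (by norm_num)
  filter_upwards [hG.prodMk_left] with x hx
  have h1 : ‖∫ y, G (x, y) ∂P‖ₑ ≤ eLpNorm (fun y => G (x, y)) 2 P := by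
    refine (enorm_integral_le_lintegral_enorm _).trans ?_
    rw [← eLpNorm_one_eq_lintegral_enorm]
    exact eLpNorm_le_eLpNorm_of_exponent_le (by norm_num) hx
  refine (ENNReal.rpow_le_rpow h1 (by norm_num)).trans (le_of_eq ?_)
  rw [eLpNorm_eq_lintegral_rpow_enorm_toReal (by norm_num) (by norm_num), ← ENNReal.rpow_mul]
  norm_num

/-- The average of `g` over the points `(1 - t) y + t x`, where `y` has law `P`. -/
noncomputable def avg (P : Measure Plane) (t : ℝ) (g : Plane → F) (x : Plane) : F :=
  ∫ y, g (mix t (x, y)) ∂P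

variable [CompleteSpace F] {D : Set Plane} {c : Plane} {r : ℝ} (P : Measure Plane)
  [IsProbabilityMeasure P]

theorem eLpNorm_avg_sub_le (h : IsStarShapedBall D c r)
    (hP : ∀ᵐ y ∂P, y ∈ Metric.ball c r) {t : ℝ} (ht0 : 1 / 2 ≤ t) (ht1 : t ≤ 1) {g : Plane → F}
    (hg : MemLp g 2 (volume.restrict D)) :
    eLpNorm (avg P t g - g) 2 (volume.restrict D) ≤
      eLpNorm (fun q => g (mix t q) - g q.1) 2 ((volume.restrict D).prod P) := by
  have : IsFiniteMeasure (volume.restrict D) := ⟨by simpa using h.isBounded.measure_lt_top⟩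
  have hm := aestronglyMeasurable_comp_mix P h hP (by linarith) ht1 hg.1
  have h1 : MemLp (fun q => g (mix t q)) 2 ((volume.restrict D).prod P) :=
    ⟨hm, (eLpNorm_comp_mix_le P h hP ht0 ht1 hg.1).trans_lt
      (ENNReal.mul_lt_top (by norm_num) hg.2)⟩
  have h2 : Integrable (fun q => g (mix t q)) ((volume.restrict D).prod P) :=
    h1.integrable (by norm_num)
  refine le_trans (le_of_eq (eLpNorm_congr_ae ?_)) (eLpNorm_integral_le (volume.restrict D) P
    (hm.sub hg.1.comp_fst))
  filter_upwards [h2.prod_right_ae] with x hx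
  simp only [Pi.sub_apply, avg]
  rw [integral_sub hx (integrable_const _)]
  simp

theorem dist_mix_left (t : ℝ) (ht : t ≤ 1) (x y : Plane) :
    dist (mix t (x, y)) x = (1 - t) * dist y x := by
  rw [dist_eq_norm, dist_eq_norm, show mix t (x, y) - x = (1 - t) • (y - x) by
    simp only [mix, smul_sub, sub_smul, one_smul]; abel, norm_smul,
    Real.norm_of_nonneg (by linarith)]

/-- The averages of an `L²` function converge to it as the dilations tend to the identity. -/
theorem tendsto_eLpNorm_avg_sub (h : IsStarShapedBall D c r)
    (hP : ∀ᵐ y ∂P, y ∈ Metric.ball c r) {t : ℕ → ℝ} (ht0 : ∀ j, 1 / 2 ≤ t j) (ht1 : ∀ j, t j ≤ 1)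
    (ht : Tendsto t atTop (𝓝 1)) {g : Plane → F} (hg : MemLp g 2 (volume.restrict D)) :
    Tendsto (fun j => eLpNorm (avg P (t j) g - g) 2 (volume.restrict D)) atTop (𝓝 0) := by
  have hfin : IsFiniteMeasure (volume.restrict D) := ⟨by simpa using h.isBounded.measure_lt_top⟩
  set ν := (volume.restrict D).prod P with hν
  have hνD : ∀ᵐ q ∂ν, q.1 ∈ D ∧ q.2 ∈ Metric.ball c r := by
    have a1 : ∀ᵐ q ∂ν, q.1 ∈ D :=
      Measure.quasiMeasurePreserving_fst.ae (ae_restrict_mem h.isOpen.measurableSet)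
    have a2 : ∀ᵐ q ∂ν, q.2 ∈ Metric.ball c r := Measure.quasiMeasurePreserving_snd.ae hP
    exact a1.and a2
  rw [ENNReal.tendsto_nhds_zero]
  intro ε hε
  obtain ⟨ε', hε', hε'ε⟩ : ∃ ε' : ENNReal, 0 < ε' ∧ 4 * ε' ≤ ε := by
    refine ⟨ε / 4, ENNReal.div_pos hε.ne' (by norm_num), ?_⟩
    rw [ENNReal.mul_div_cancel (by norm_num) (by norm_num)]
  -- `g` is replaced by a compactly supported continuous `k`, which is uniformly continuous
  obtain ⟨k, hk1, hk2, hk3, hk4⟩ := hg.exists_hasCompactSupport_eLpNorm_sub_le (by norm_num) hε'.ne'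
  have huc := hk1.uniformContinuous_of_continuous hk3
  -- `δ` is the accuracy in the sup norm that suffices for `ε'` in the `L²` norm
  obtain ⟨δ, hδ, hδε⟩ : ∃ δ : ℝ, 0 < δ ∧
      ν Set.univ ^ (2 : ENNReal).toReal⁻¹ * ENNReal.ofReal δ ≤ ε' := by
    rcases eq_or_ne ε' ⊤ with rfl | hε't
    · exact ⟨1, one_pos, le_top⟩
    have hfin2 : ν Set.univ ^ (2 : ENNReal).toReal⁻¹ ≠ ⊤ :=
      ENNReal.rpow_ne_top_of_nonneg (by norm_num) (measure_ne_top _ _)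
    set B := ν Set.univ ^ (2 : ENNReal).toReal⁻¹
    refine ⟨ε'.toReal / (B.toReal + 1),
      div_pos (ENNReal.toReal_pos hε'.ne' hε't) (by positivity), ?_⟩
    rw [← ENNReal.ofReal_toReal hfin2, ← ENNReal.ofReal_mul ENNReal.toReal_nonneg]
    refine ENNReal.ofReal_le_of_le_toReal ?_
    have : 0 ≤ B.toReal := ENNReal.toReal_nonneg
    have h0 : 0 ≤ ε'.toReal := ENNReal.toReal_nonneg
    rw [ENNReal.toReal_ofReal this, mul_div_assoc', div_le_iff₀ (by positivity)]
    nlinarith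
  obtain ⟨ρ, hρ, hρk⟩ := Metric.uniformContinuous_iff.1 huc δ hδ
  have hdiam : ∀ᶠ j in atTop, (1 - t j) * Metric.diam D < ρ := by
    have : Tendsto (fun j => (1 - t j) * Metric.diam D) atTop (𝓝 ((1 - 1) * Metric.diam D)) :=
      (tendsto_const_nhds.sub ht).mul_const _
    rw [sub_self, zero_mul] at this
    exact this.eventually_lt_const hρ
  filter_upwards [hdiam] with j hj
  refine (eLpNorm_avg_sub_le P h hP (ht0 j) (ht1 j) hg).trans ?_
  have hsub : AEStronglyMeasurable (g - k) (volume.restrict D) := hg.1.sub hk4.1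
  have e1 : eLpNorm (fun q => (g - k) (mix (t j) q)) 2 ν ≤ 2 * ε' :=
    (eLpNorm_comp_mix_le P h hP (ht0 j) (ht1 j) hsub).trans (by gcongr)
  have e2 : eLpNorm (fun q : Plane × Plane => k (mix (t j) q) - k q.1) 2 ν ≤ ε' := by
    refine (eLpNorm_le_of_ae_bound (C := δ) ?_).trans hδε
    filter_upwards [hνD] with q hq
    rw [← dist_eq_norm]
    refine (hρk ?_).le
    rw [dist_mix_left _ (ht1 j) q.1 q.2]
    refine lt_of_le_of_lt ?_ hj
    exact mul_le_mul_of_nonneg_left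
      (Metric.dist_le_diam_of_mem h.isBounded (h.ball_subset hq.2) hq.1) (by linarith [ht1 j])
  have e3 : eLpNorm (fun q : Plane × Plane => (g - k) q.1) 2 ν ≤ ε' := by
    have := eLpNorm_comp_measurePreserving (p := 2) (f := Prod.fst) (ν := volume.restrict D)
      (μ := ν) hsub measurePreserving_fst
    rw [show (fun q : Plane × Plane => (g - k) q.1) = (g - k) ∘ Prod.fst from rfl, this]
    exact hk2
  have m1 := aestronglyMeasurable_comp_mix P h hP (by linarith [ht0 j]) (ht1 j) hsub
  have m2 : AEStronglyMeasurable (fun q : Plane × Plane => k (mix (t j) q) - k q.1) ν :=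
    ((hk3.comp (continuous_mix _)).sub (hk3.comp continuous_fst)).aestronglyMeasurable
  have m3 : AEStronglyMeasurable (fun q : Plane × Plane => (g - k) q.1) ν := hsub.comp_fst
  have hsplit : (fun q : Plane × Plane => g (mix (t j) q) - g q.1) =
      (fun q => (g - k) (mix (t j) q)) + (fun q => k (mix (t j) q) - k q.1) -
        fun q => (g - k) q.1 := by
    ext1 q; simp only [Pi.sub_apply, Pi.add_apply]; abel
  rw [hsplit]
  refine (eLpNorm_sub_le (m1.add m2) m3 (by norm_num)).trans ?_
  refine (add_le_add_left (eLpNorm_add_le m1 m2 (by norm_num)) _).trans ?_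
  refine (add_le_add (add_le_add e1 e2) e3).trans (le_trans (le_of_eq ?_) hε'ε)
  ring

/-- The averages of a continuous function converge uniformly on the closure of `D`. -/
theorem eventually_norm_avg_sub_le (h : IsStarShapedBall D c r)
    (hP : ∀ᵐ y ∂P, y ∈ Metric.ball c r) {t : ℕ → ℝ} (ht0 : ∀ j, 1 / 2 ≤ t j) (ht1 : ∀ j, t j < 1)
    (ht : Tendsto t atTop (𝓝 1)) {g : Plane → F} (hg : Continuous g) {ε : ℝ} (hε : 0 < ε) :
    ∀ᶠ j in atTop, ∀ x ∈ closure D, ‖avg P (t j) g x - g x‖ ≤ ε := by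
  have hcomp := h.isBounded.isCompact_closure
  obtain ⟨ρ, hρ, hρk⟩ := Metric.uniformContinuousOn_iff.1
    (hcomp.uniformContinuousOn_of_continuous hg.continuousOn) ε hε
  have hdiam : ∀ᶠ j in atTop, (1 - t j) * Metric.diam D < ρ := by
    have : Tendsto (fun j => (1 - t j) * Metric.diam D) atTop (𝓝 ((1 - 1) * Metric.diam D)) :=
      (tendsto_const_nhds.sub ht).mul_const _
    rw [sub_self, zero_mul] at this
    exact this.eventually_lt_const hρ
  filter_upwards [hdiam] with j hj x hx
  have hb : ∀ᵐ y ∂P, ‖g (mix (t j) (x, y)) - g x‖ ≤ ε := by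
    filter_upwards [hP] with y hy
    rw [← dist_eq_norm]
    refine (hρk _ (subset_closure (h.mix_mem_of_closure (by linarith [ht0 j]) (ht1 j) hx hy)) _ hx
      ?_).le
    rw [dist_mix_left _ (ht1 j).le x y]
    refine lt_of_le_of_lt ?_ hj
    rw [← Metric.diam_closure]
    exact mul_le_mul_of_nonneg_left (Metric.dist_le_diam_of_mem h.isBounded.closure
      (subset_closure (h.ball_subset hy)) hx) (by linarith [ht1 j])
  have hint : Integrable (fun y => g (mix (t j) (x, y)) - g x) P := by
    refine Integrable.of_bound (C := ε) ?_ hb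
    exact ((hg.comp ((continuous_mix _).comp (by fun_prop))).sub
      continuous_const).aestronglyMeasurable
  have hint' : Integrable (fun y => g (mix (t j) (x, y))) P := by
    refine (hint.add (integrable_const (g x))).congr (ae_of_all _ fun y => ?_)
    simp
  have : avg P (t j) g x - g x = ∫ y, (g (mix (t j) (x, y)) - g x) ∂P := by
    rw [integral_sub hint' (integrable_const _)]; simp [avg]
  rw [this]
  simpa using norm_integral_le_of_norm_le_const hb

end Average

/-! ### Density of smooth functions in `H¹` of a star-shaped set -/

/-- A smooth probability density supported in the ball `B(c, r)`. -/
structure IsBallDensity (η : Plane → ℝ) (c : Plane) (r : ℝ) : Prop where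
  smooth : ContDiff ℝ ∞ η
  compact : HasCompactSupport η
  nonneg : ∀ y, 0 ≤ η y
  supp : tsupport η ⊆ Metric.ball c r
  integral : ∫ y, η y = 1

theorem exists_isBallDensity (c : Plane) {r : ℝ} (hr : 0 < r) : ∃ η, IsBallDensity η c r := by
  let b : ContDiffBump c := ⟨r / 4, r / 2, by linarith, by linarith⟩
  refine ⟨b.normed volume, b.contDiff_normed, b.hasCompactSupport_normed, b.nonneg_normed, ?_,
    b.integral_normed⟩
  rw [b.tsupport_normed_eq]
  exact Metric.closedBall_subset_ball (by change r / 2 < r; linarith)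

/-- The probability measure with density `η`. -/
noncomputable def densityMeasure (η : Plane → ℝ) : Measure Plane :=
  volume.withDensity fun y => ENNReal.ofReal (η y)

/-- The kernel that represents averaging over `y ∼ η` of the values at `(1 - t) y + t x` as a
convolution evaluated at `t x`. -/
noncomputable def dilKernel (η : Plane → ℝ) (t : ℝ) (w : Plane) : ℝ :=
  ((1 - t) ^ 2)⁻¹ * η (-(1 - t)⁻¹ • w)

namespace IsBallDensity

variable {η : Plane → ℝ} {c : Plane} {r : ℝ}

theorem isProbabilityMeasure (h : IsBallDensity η c r) :
    IsProbabilityMeasure (densityMeasure η) := by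
  constructor
  rw [densityMeasure, withDensity_apply _ MeasurableSet.univ, Measure.restrict_univ,
    ← ofReal_integral_eq_lintegral_ofReal
      (h.smooth.continuous.integrable_of_hasCompactSupport h.compact) (ae_of_all _ h.nonneg),
    h.integral, ENNReal.ofReal_one]

theorem measurable_ofReal (h : IsBallDensity η c r) :
    Measurable fun y => ENNReal.ofReal (η y) :=
  ENNReal.measurable_ofReal.comp h.smooth.continuous.measurable

theorem ae_mem_ball (h : IsBallDensity η c r) : ∀ᵐ y ∂densityMeasure η, y ∈ Metric.ball c r := by
  rw [densityMeasure,
    ae_withDensity_iff h.measurable_ofReal]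
  refine ae_of_all _ fun y hy => h.supp (subset_tsupport _ ?_)
  intro h0
  simp [h0] at hy

theorem contDiff_dilKernel (h : IsBallDensity η c r) (t : ℝ) : ContDiff ℝ ∞ (dilKernel η t) :=
  contDiff_const.mul (h.smooth.comp (contDiff_const_smul _))

theorem hasCompactSupport_dilKernel (h : IsBallDensity η c r) {t : ℝ} (ht : t < 1) :
    HasCompactSupport (dilKernel η t) := by
  refine HasCompactSupport.mul_left (HasCompactSupport.comp_smul h.compact ?_)
  exact neg_ne_zero.2 (inv_ne_zero (by linarith))

theorem dilKernel_sub (t : ℝ) (x z : Plane) :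
    dilKernel η t (t • x - z) = ((1 - t) ^ 2)⁻¹ * η ((1 - t)⁻¹ • (z - t • x)) := by
  rw [dilKernel, neg_smul, ← smul_neg, neg_sub]

/-- The support of `z ↦ κ (t x - z)` is a subset of `D` for `x` in the closure of `D`. -/
theorem tsupport_dilKernel_sub_subset (h : IsBallDensity η c r) {D : Set Plane}
    (hD : IsStarShapedBall D c r) {t : ℝ} (ht0 : 0 ≤ t) (ht1 : t < 1) {x : Plane}
    (hx : x ∈ closure D) : tsupport (fun z => dilKernel η t (t • x - z)) ⊆ D := by
  have h1 : (1 - t) ≠ 0 := by linarith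
  have hsub : tsupport (fun z => dilKernel η t (t • x - z)) ⊆
      (fun z => (1 - t)⁻¹ • (z - t • x)) ⁻¹' tsupport η := by
    refine closure_minimal ?_ ((isClosed_tsupport η).preimage (by fun_prop))
    intro z hz
    rw [Function.mem_support, dilKernel_sub] at hz
    exact subset_tsupport _ (right_ne_zero_of_mul hz)
  intro z hz
  have := hD.mix_mem_of_closure ht0 ht1 hx (h.supp (hsub hz))
  convert this using 1
  simp [mix, smul_smul, mul_inv_cancel₀ h1]

theorem hasCompactSupport_dilKernel_sub (h : IsBallDensity η c r) {t : ℝ} (ht1 : t < 1)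
    (x : Plane) : HasCompactSupport (fun z => dilKernel η t (t • x - z)) :=
  (h.hasCompactSupport_dilKernel ht1).comp_homeomorph (Homeomorph.subLeft (t • x))

theorem isTestFunction_dilKernel_sub (h : IsBallDensity η c r) {D : Set Plane}
    (hD : IsStarShapedBall D c r) {t : ℝ} (ht0 : 0 ≤ t) (ht1 : t < 1) {x : Plane}
    (hx : x ∈ closure D) : IsTestFunction D (fun z => dilKernel η t (t • x - z)) :=
  ⟨(h.contDiff_dilKernel t).comp (contDiff_const.sub contDiff_id),
    h.hasCompactSupport_dilKernel_sub ht1 x, h.tsupport_dilKernel_sub_subset hD ht0 ht1 hx⟩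

/-- The average over `y ∼ η` of the values at `(1 - t) y + t x` is an integral against the dilated
kernel, by the substitution `z = (1 - t) y + t x`. -/
theorem avg_eq_setIntegral {F : Type} [NormedAddCommGroup F] [NormedSpace ℝ F]
    (h : IsBallDensity η c r) {D : Set Plane}
    (hD : IsStarShapedBall D c r) {t : ℝ} (ht0 : 0 ≤ t) (ht1 : t < 1) {x : Plane}
    (hx : x ∈ closure D) (g : Plane → F) :
    avg (densityMeasure η) t g x = ∫ z in D, dilKernel η t (t • x - z) • g z := by
  have h1 : (1 - t) ≠ 0 := by linarith
  rw [setIntegral_eq_integral_of_forall_compl_eq_zero (fun z hz => by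
    rw [(h.isTestFunction_dilKernel_sub hD ht0 ht1 hx).eq_zero hz, zero_smul])]
  rw [avg, densityMeasure, integral_withDensity_eq_integral_toReal_smul
    h.measurable_ofReal
    (ae_of_all _ fun _ => ENNReal.ofReal_lt_top)]
  have e1 : ∀ y, (ENNReal.ofReal (η y)).toReal • g (mix t (x, y)) =
      (fun z => η ((1 - t)⁻¹ • z) • g (z + t • x)) ((1 - t) • y) := fun y => by
    rw [ENNReal.toReal_ofReal (h.nonneg y)]
    simp [mix, smul_smul, inv_mul_cancel₀ h1]
  rw [integral_congr_ae (ae_of_all _ e1),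
    Measure.integral_comp_smul volume (fun z => η ((1 - t)⁻¹ • z) • g (z + t • x)),
    ← integral_sub_right_eq_self (fun z => η ((1 - t)⁻¹ • z) • g (z + t • x)) (t • x),
    ← integral_smul]
  refine integral_congr_ae (ae_of_all _ fun z => ?_)
  simp only [dilKernel_sub, sub_add_cancel, smul_smul, finrank_euclideanSpace, Fintype.card_fin]
  rw [abs_of_nonneg (by positivity)]

end IsBallDensity

/-- The function `x ↦ ∫ v(z) κ(t x - z) dz`, smooth on the whole plane. On the closure of a
star-shaped set `D` it is the average of `v` over the points `(1 - t) y + t x`, `y ∼ η`. -/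
noncomputable def smoothing {D : Set Plane} (η : Plane → ℝ) (t : ℝ) (v : L2 D ℝ) (x : Plane) : ℝ :=
  ∫ z in D, dilKernel η t (t • x - z) • v z

theorem H1.weak_gradient {D : Set Plane} (v : H1 D) {φ : Plane → ℝ} (hφ : IsTestFunction D φ)
    (e : Plane) : ∫ x in D, H1.val v x * fderiv ℝ φ x e =
      -∫ x in D, inner ℝ (H1.grad v x) e * φ x := v.2 φ hφ e

section Smoothing

variable {η : Plane → ℝ} {c : Plane} {r : ℝ} {D : Set Plane}

theorem L2.integrable_indicator (hD : IsStarShapedBall D c r) {F : Type} [NormedAddCommGroup F]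
    (v : L2 D F) : LocallyIntegrable (D.indicator v) volume := by
  have : IsFiniteMeasure (volume.restrict D) := ⟨by simpa using hD.isBounded.measure_lt_top⟩
  exact ((integrable_indicator_iff hD.isOpen.measurableSet).2
    ((Lp.memLp v).integrable (by norm_num))).locallyIntegrable

theorem smoothing_eq_convolution (hD : IsStarShapedBall D c r) (t : ℝ) (v : L2 D ℝ) :
    smoothing η t v = (convolution (D.indicator v) (dilKernel η t)
      (ContinuousLinearMap.mul ℝ ℝ) volume) ∘ fun x => t • x := by
  ext x
  simp only [smoothing, Function.comp_apply, convolution_def, ContinuousLinearMap.mul_apply',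
    smul_eq_mul]
  rw [← integral_indicator hD.isOpen.measurableSet]
  refine integral_congr_ae (ae_of_all _ fun z => ?_)
  by_cases hz : z ∈ D <;> simp [hz, mul_comm]

theorem contDiff_smoothing (h : IsBallDensity η c r) (hD : IsStarShapedBall D c r) {t : ℝ}
    (ht1 : t < 1) (v : L2 D ℝ) : ContDiff ℝ ∞ (smoothing η t v) := by
  rw [smoothing_eq_convolution hD]
  have := (h.hasCompactSupport_dilKernel ht1).contDiff_convolution_right
    (ContinuousLinearMap.mul ℝ ℝ) (L2.integrable_indicator hD v) (n := ⊤) (h.contDiff_dilKernel t)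
  exact this.comp (contDiff_const_smul t)

/-- The derivative in `x` falls on the kernel, where it is `-t` times the derivative in `z`. -/
theorem fderiv_smoothing (h : IsBallDensity η c r) (hD : IsStarShapedBall D c r) {t : ℝ}
    (ht1 : t < 1) (v : L2 D ℝ) (x e : Plane) : fderiv ℝ (smoothing η t v) x e =
      -t * ∫ z in D, v z * fderiv ℝ (fun z => dilKernel η t (t • x - z)) z e := by
  have hk := h.contDiff_dilKernel t
  have hc := h.hasCompactSupport_dilKernel ht1
  have hi := L2.integrable_indicator hD v
  have h1 := hc.hasFDerivAt_convolution_right (ContinuousLinearMap.mul ℝ ℝ) hi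
    (hk.of_le (by simp)) (t • x)
  have h2 : HasFDerivAt (fun x : Plane => t • x) (t • ContinuousLinearMap.id ℝ Plane) x :=
    (hasFDerivAt_id x).const_smul t
  have h3 : fderiv ℝ (smoothing η t v) x e = t * (convolution (D.indicator v)
      (fderiv ℝ (dilKernel η t)) ((ContinuousLinearMap.mul ℝ ℝ).precompR Plane) volume)
        (t • x) e := by
    rw [smoothing_eq_convolution hD, (h1.comp x h2).fderiv]
    simp
  rw [h3, convolution_precompR_apply _ hi (hc.fderiv ℝ) (hk.continuous_fderiv (by simp)),
    convolution_def, neg_mul, ← mul_neg, ← integral_neg,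
    ← integral_indicator hD.isOpen.measurableSet]
  congr 1
  refine integral_congr_ae (ae_of_all _ fun z => ?_)
  have hd : HasFDerivAt (fun z => dilKernel η t (t • x - z))
      ((fderiv ℝ (dilKernel η t) (t • x - z)).comp (-ContinuousLinearMap.id ℝ Plane)) z :=
    ((hk.differentiable (by simp) _).hasFDerivAt).comp z ((hasFDerivAt_id z).const_sub (t • x))
  by_cases hz : z ∈ D <;> simp [hz, hd.fderiv]

theorem smoothing_eq_avg (h : IsBallDensity η c r) (hD : IsStarShapedBall D c r) {t : ℝ}
    (ht0 : 0 ≤ t) (ht1 : t < 1) (v : L2 D ℝ) {g : Plane → ℝ} (hg : v =ᵐ[volume.restrict D] g)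
    {x : Plane} (hx : x ∈ closure D) : smoothing η t v x = avg (densityMeasure η) t g x := by
  rw [h.avg_eq_setIntegral hD ht0 ht1 hx, smoothing]
  refine integral_congr_ae ?_
  filter_upwards [hg] with z hz
  rw [hz]

theorem setIntegral_inner_mul (g : Plane → Plane) (k : Plane → ℝ) (e : Plane)
    (hint : Integrable (fun z => k z • g z) (volume.restrict D)) :
    ∫ z in D, inner ℝ (g z) e * k z = inner ℝ (∫ z in D, k z • g z) e := by
  rw [real_inner_comm, ← integral_inner hint]
  refine integral_congr_ae (ae_of_all _ fun z => ?_)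
  simp only [real_inner_smul_right]
  rw [real_inner_comm, mul_comm]

/-- Weak differentiation commutes with averaging, up to the dilation factor. -/
theorem gradient_smoothing (h : IsBallDensity η c r) (hD : IsStarShapedBall D c r) {t : ℝ}
    (ht0 : 0 ≤ t) (ht1 : t < 1) (v : H1 D) {x : Plane} (hx : x ∈ D) :
    gradient (smoothing η t (H1.val v)) x =
      t • avg (densityMeasure η) t (H1.grad v : Plane → Plane) x := by
  have hx' := subset_closure hx
  have hT := h.isTestFunction_dilKernel_sub hD ht0 ht1 hx'
  refine ext_inner_right ℝ fun e => ?_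
  rw [gradient, InnerProductSpace.toDual_symm_apply, fderiv_smoothing h hD ht1,
    h.avg_eq_setIntegral hD ht0 ht1 hx', real_inner_smul_left]
  -- `z ↦ κ(t x - z)` is supported in `D`, hence admissible in the definition of the weak gradient
  rw [H1.weak_gradient v hT e, neg_mul_neg]
  refine congrArg (t * ·) (setIntegral_inner_mul (H1.grad v) _ e ?_)
  exact memLp_one_iff_integrable.1 ((Lp.memLp (H1.grad v)).smul (hT.memLp D))

theorem tendsto_of_ae_eq_smoothing (h : IsBallDensity η c r) (hD : IsStarShapedBall D c r)
    {t : ℕ → ℝ} (ht0 : ∀ j, 1 / 2 ≤ t j) (ht1 : ∀ j, t j < 1) (htl : Tendsto t atTop (𝓝 1))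
    {v : L2 D ℝ}
    {w : ℕ → L2 D ℝ} (hw : ∀ j, w j =ᵐ[volume.restrict D] smoothing η (t j) v) :
    Tendsto w atTop (𝓝 v) := by
  have hprob := h.isProbabilityMeasure
  rw [Lp.tendsto_Lp_iff_tendsto_eLpNorm']
  refine (tendsto_eLpNorm_avg_sub (densityMeasure η) hD h.ae_mem_ball ht0 (fun j => (ht1 j).le)
    htl (Lp.memLp v)).congr fun j => eLpNorm_congr_ae ?_
  filter_upwards [hw j, ae_restrict_mem hD.isOpen.measurableSet] with x hx hxD
  have := smoothing_eq_avg h hD (by linarith [ht0 j]) (ht1 j) v (ae_eq_refl v)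
    (subset_closure hxD)
  rw [Pi.sub_apply, Pi.sub_apply, hx, this]

theorem tendsto_of_ae_eq_smul_avg (h : IsBallDensity η c r) (hD : IsStarShapedBall D c r)
    {t : ℕ → ℝ} (ht0 : ∀ j, 1 / 2 ≤ t j) (ht1 : ∀ j, t j < 1) (htl : Tendsto t atTop (𝓝 1))
    {g : L2 D Plane}
    {w : ℕ → L2 D Plane}
    (hw : ∀ j, ∀ᵐ x ∂volume.restrict D, w j x = t j • avg (densityMeasure η) (t j) g x) :
    Tendsto w atTop (𝓝 g) := by
  have hprob := h.isProbabilityMeasure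
  have ht0' : ∀ j, 0 ≤ t j := fun j => by linarith [ht0 j]
  rw [Lp.tendsto_Lp_iff_tendsto_eLpNorm']
  have hA := tendsto_eLpNorm_avg_sub (densityMeasure η) hD h.ae_mem_ball ht0
    (fun j => (ht1 j).le) htl (Lp.memLp g)
  have hB : Tendsto (fun j => ENNReal.ofReal (1 - t j) * eLpNorm g 2 (volume.restrict D))
      atTop (𝓝 0) := by
    have h0 : Tendsto (fun j => ENNReal.ofReal (1 - t j)) atTop (𝓝 0) := by
      have := ENNReal.tendsto_ofReal (tendsto_const_nhds.sub htl : Tendsto (fun j => 1 - t j)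
        atTop (𝓝 (1 - 1)))
      simpa using this
    have := ENNReal.Tendsto.mul_const (b := eLpNorm g 2 (volume.restrict D)) h0
      (Or.inr (Lp.memLp g).2.ne)
    simpa using this
  have hAB := hA.add hB
  rw [add_zero] at hAB
  refine tendsto_of_tendsto_of_tendsto_of_le_of_le tendsto_const_nhds hAB (fun _ => zero_le)
    fun j => ?_
  have e : (w j : Plane → Plane) - (g : Plane → Plane) =ᵐ[volume.restrict D]
      t j • (avg (densityMeasure η) (t j) g - (g : Plane → Plane)) -
        (1 - t j) • (g : Plane → Plane) := by
    filter_upwards [hw j] with x hx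
    simp only [Pi.sub_apply, Pi.smul_apply]
    rw [hx, smul_sub, sub_smul, one_smul]
    abel
  have hgm : AEStronglyMeasurable g (volume.restrict D) := Lp.aestronglyMeasurable g
  have ham : AEStronglyMeasurable (t j • (avg (densityMeasure η) (t j) g - (g : Plane → Plane)))
      (volume.restrict D) := by
    have := (((Lp.aestronglyMeasurable (w j)).sub hgm).congr e).add (hgm.const_smul (1 - t j))
    simpa using this
  simp only
  rw [eLpNorm_congr_ae e]
  refine (eLpNorm_sub_le ham (hgm.const_smul _) (by norm_num)).trans (add_le_add ?_ ?_)
  · rw [eLpNorm_const_smul]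
    refine mul_le_of_le_one_left zero_le ?_
    rw [Real.enorm_eq_ofReal (ht0' j)]
    exact ENNReal.ofReal_le_one.2 (ht1 j).le
  · rw [eLpNorm_const_smul, Real.enorm_eq_ofReal (by linarith [ht1 j])]

end Smoothing

theorem H1.ofSmooth_represents {D : Set Plane} (hb : Bornology.IsBounded D) {φ : Plane → ℝ}
    (hφ : ContDiff ℝ ∞ φ) : H1.Represents (H1.ofSmooth hb hφ) φ :=
  ⟨(memLp_of_continuous hb hφ.continuous).coeFn_toLp,
    (memLp_of_continuous hb (continuous_gradient hφ)).coeFn_toLp⟩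

theorem H1.exists_represents {D : Set Plane} (hb : Bornology.IsBounded D) {φ : Plane → ℝ}
    (hφ : ContDiff ℝ ∞ φ) : ∃ w : H1 D, H1.Represents w φ :=
  ⟨_, H1.ofSmooth_represents hb hφ⟩

theorem H1.tendsto_iff {D : Set Plane} {w : ℕ → H1 D} {v : H1 D} :
    Tendsto w atTop (𝓝 v) ↔ Tendsto (fun j => H1.val (w j)) atTop (𝓝 (H1.val v)) ∧
      Tendsto (fun j => H1.grad (w j)) atTop (𝓝 (H1.grad v)) := by
  rw [tendsto_subtype_rng, Prod.tendsto_iff]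
  rfl

theorem exists_dilation_sequence : ∃ t : ℕ → ℝ, (∀ j, 1 / 2 ≤ t j) ∧ (∀ j, t j < 1) ∧
    Tendsto t atTop (𝓝 1) := by
  refine ⟨fun j => 1 - 1 / ((j : ℝ) + 2), fun j => ?_, fun j => ?_, ?_⟩
  · have : 1 / ((j : ℝ) + 2) ≤ 1 / 2 :=
      one_div_le_one_div_of_le (by norm_num) (by linarith [(Nat.cast_nonneg j : (0 : ℝ) ≤ j)])
    linarith
  · have : 0 < 1 / ((j : ℝ) + 2) := by positivity
    linarith
  · have : Tendsto (fun j : ℕ => 1 / ((j : ℝ) + 2)) atTop (𝓝 0) :=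
      tendsto_const_nhds.div_atTop
        (tendsto_atTop_add_const_right _ _ tendsto_natCast_atTop_atTop)
    simpa using tendsto_const_nhds.sub this

/-- Smooth functions are dense in `H¹(D)`; the approximations of a function that is continuous on
the closure of `D` converge uniformly there. -/
theorem IsStarShapedBall.exists_smooth_approx {D : Set Plane} {c : Plane} {r : ℝ}
    (hD : IsStarShapedBall D c r) (v : H1 D) :
    ∃ (φ : ℕ → Plane → ℝ) (w : ℕ → H1 D),
      (∀ j, ContDiff ℝ ∞ (φ j) ∧ H1.Represents (w j) (φ j)) ∧ Tendsto w atTop (𝓝 v) ∧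
      ∀ W : Plane → ℝ, Continuous W → H1.val v =ᵐ[volume.restrict D] W → ∀ ε > 0,
        ∀ᶠ j in atTop, ∀ x ∈ closure D, |φ j x - W x| ≤ ε := by
  obtain ⟨η, h⟩ := exists_isBallDensity c hD.pos
  have hprob := h.isProbabilityMeasure
  obtain ⟨t, ht0, ht1, htl⟩ := exists_dilation_sequence
  have ht0' : ∀ j, 0 ≤ t j := fun j => by linarith [ht0 j]
  have hsm := fun j => contDiff_smoothing h hD (ht1 j) (H1.val v)
  choose w hw using fun j => H1.exists_represents hD.isBounded (hsm j)
  refine ⟨fun j => smoothing η (t j) (H1.val v), w, fun j => ⟨hsm j, hw j⟩,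
    H1.tendsto_iff.2 ⟨tendsto_of_ae_eq_smoothing h hD ht0 ht1 htl fun j => (hw j).1,
      tendsto_of_ae_eq_smul_avg h hD ht0 ht1 htl fun j => ?_⟩, ?_⟩
  · filter_upwards [(hw j).2, ae_restrict_mem hD.isOpen.measurableSet] with x hx hxD
    rw [hx, gradient_smoothing h hD (ht0' j) (ht1 j) v hxD]
  · intro W hW hvW ε hε
    filter_upwards [eventually_norm_avg_sub_le (densityMeasure η) hD h.ae_mem_ball ht0 ht1 htl hW
      hε] with j hj x hx
    rw [smoothing_eq_avg h hD (ht0' j) (ht1 j) _ hvW hx]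
    exact hj x hx

/-! ### The Poincaré inequality on a star-shaped set -/

section Poincare

variable {D : Set Plane} {c : Plane} {r : ℝ}

theorem sub_eq_integral_mix {φ : Plane → ℝ} (hφ : ContDiff ℝ ∞ φ) (x y : Plane) :
    φ x - φ y = ∫ t in Set.Ioc (0 : ℝ) 1, fderiv ℝ φ (mix t (x, y)) (x - y) := by
  have hd : ∀ t : ℝ, HasDerivAt (fun t : ℝ => φ (mix t (x, y)))
      (fderiv ℝ φ (mix t (x, y)) (x - y)) t := fun t => by
    have h1 : HasDerivAt (fun t : ℝ => mix t (x, y)) (x - y) t := by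
      have := (((hasDerivAt_id t).const_sub 1).smul_const y).add ((hasDerivAt_id t).smul_const x)
      refine this.congr_deriv ?_
      simp only [neg_smul, one_smul]
      abel
    exact ((hφ.differentiable (by simp) _).hasFDerivAt).comp_hasDerivAt t h1
  have hc : Continuous fun t : ℝ => fderiv ℝ φ (mix t (x, y)) (x - y) :=
    ((hφ.continuous_fderiv (by simp)).comp (by unfold mix; fun_prop)).clm_apply continuous_const
  rw [← intervalIntegral.integral_of_le zero_le_one,
    intervalIntegral.integral_eq_sub_of_hasDerivAt (fun t _ => hd t)
      (hc.intervalIntegrable _ _)]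
  simp [mix]

/-- The uniform probability measure on the ball `B(c, r)`. -/
noncomputable def uniformBall (c : Plane) (r : ℝ) : Measure Plane :=
  (volume (Metric.ball c r))⁻¹ • volume.restrict (Metric.ball c r)

theorem volume_ball_pos (c : Plane) (hr : 0 < r) : volume (Metric.ball c r) ≠ 0 :=
  (Metric.measure_ball_pos volume c hr).ne'

theorem volume_ball_ne_top (c : Plane) (r : ℝ) : volume (Metric.ball c r) ≠ ⊤ :=
  measure_ball_lt_top.ne

theorem isProbabilityMeasure_uniformBall (c : Plane) (hr : 0 < r) :
    IsProbabilityMeasure (uniformBall c r) := by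
  constructor
  rw [uniformBall, Measure.smul_apply, Measure.restrict_apply_univ, smul_eq_mul,
    ENNReal.inv_mul_cancel (volume_ball_pos c hr) (volume_ball_ne_top c r)]

theorem ae_uniformBall_mem (c : Plane) (r : ℝ) : ∀ᵐ y ∂uniformBall c r, y ∈ Metric.ball c r :=
  Measure.smul_absolutelyContinuous.ae_le (ae_restrict_mem measurableSet_ball)

/-- The law of `(1 - t) y + t x`, for `t`, `x`, `y` uniform on `[0, 1]`, on `D` and on the ball, has
a bounded density. For `t ≥ 1/2` the density is controlled by that of `x`, for `t ≤ 1/2` by that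
of `y`. -/
theorem map_mix_uniform_le (h : IsStarShapedBall D c r) :
    (((volume.restrict D).prod (uniformBall c r)).prod
      (volume.restrict (Set.Ioc (0 : ℝ) 1))).map (fun q => mix q.2 q.1) ≤
      (4 * (volume D / volume (Metric.ball c r))) • volume.restrict D := by
  have hprob := isProbabilityMeasure_uniformBall c h.pos
  have hfin : IsFiniteMeasure (volume.restrict D) := ⟨by simpa using h.isBounded.measure_lt_top⟩
  have hB0 := volume_ball_pos c h.pos
  have hBt := volume_ball_ne_top c r
  have hBD : 1 ≤ volume D / volume (Metric.ball c r) := by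
    rw [ENNReal.le_div_iff_mul_le (Or.inl hB0) (Or.inl hBt), one_mul]
    exact measure_mono h.ball_subset
  have hm : Measurable fun q : (Plane × Plane) × ℝ => mix q.2 q.1 := by unfold mix; fun_prop
  have h4 : ∀ s : ℝ, 1 / 2 ≤ s → ENNReal.ofReal ((s ^ 2)⁻¹) ≤ 4 := fun s hs => by
    refine ENNReal.ofReal_le_of_le_toReal ?_
    rw [ENNReal.toReal_ofNat]
    exact inv_le_of_inv_le₀ (by norm_num) (by nlinarith)
  have hD := h.isOpen.measurableSet
  refine Measure.le_iff.2 fun S hS => ?_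
  rw [Measure.map_apply hm hS, Measure.prod_apply_symm (hm hS)]
  have hlam : ∫⁻ _ : ℝ in Set.Ioc 0 1, ((4 * (volume D / volume (Metric.ball c r))) •
      volume.restrict D) S = ((4 * (volume D / volume (Metric.ball c r))) •
      volume.restrict D) S := by simp
  rw [← hlam]
  refine lintegral_mono_ae ?_
  filter_upwards [ae_restrict_mem measurableSet_Ioc] with t ht
  rw [Measure.smul_apply, smul_eq_mul]
  change ((volume.restrict D).prod (uniformBall c r)) (mix t ⁻¹' S) ≤ _
  have hmt : Measurable (mix t) := (continuous_mix t).measurable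
  rcases le_total (1 / 2) t with h2 | h2
  · have := map_mix_le (A := D) (D := D) (uniformBall c r) ht.1.ne'
      ((ae_uniformBall_mem c r).mono fun y hy x hx => h.mix_mem ht.1.le ht.2 hx hy) S
    rw [Measure.map_apply hmt hS, Measure.smul_apply, smul_eq_mul] at this
    refine this.trans ?_
    gcongr
    exact (h4 t h2).trans (le_mul_of_one_le_right zero_le hBD)
  · rw [Measure.prod_apply (hmt hS)]
    have hx : ∀ x ∈ D, uniformBall c r (Prod.mk x ⁻¹' (mix t ⁻¹' S)) ≤
        (volume (Metric.ball c r))⁻¹ * (4 * volume.restrict D S) := fun x hx => by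
      rw [uniformBall, Measure.smul_apply, smul_eq_mul]
      gcongr
      have hm' : Measurable fun y : Plane => t • x + (1 - t) • y := by fun_prop
      have := map_affine_restrict_le (A := Metric.ball c r) (D := D) (t • x) (t := 1 - t)
        (by linarith) (fun y hy => by
          have := h.mix_mem ht.1.le ht.2 hx hy
          rwa [mix, add_comm] at this) S
      rw [Measure.map_apply hm' hS, Measure.smul_apply, smul_eq_mul] at this
      have e : Prod.mk x ⁻¹' (mix t ⁻¹' S) = (fun y : Plane => t • x + (1 - t) • y) ⁻¹' S := by
        ext y; simp [mix, add_comm]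
      rw [e]
      refine this.trans ?_
      gcongr
      exact h4 _ (by linarith)
    refine (setLIntegral_mono measurable_const hx).trans (le_of_eq ?_)
    rw [lintegral_const, Measure.restrict_apply_univ, div_eq_mul_inv]
    ring

theorem volume_le_sq_mul_volume_ball (h : IsStarShapedBall D c r) :
    volume D / volume (Metric.ball c r) ≤ ENNReal.ofReal ((Metric.diam D / r) ^ 2) := by
  have hr := h.pos
  rw [ENNReal.div_le_iff (volume_ball_pos c hr) (volume_ball_ne_top c r)]
  have hsub : D ⊆ Metric.closedBall c (Metric.diam D) := fun x hx =>
    Metric.dist_le_diam_of_mem h.isBounded hx (h.ball_subset (Metric.mem_ball_self hr))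
  refine (measure_mono hsub).trans (le_of_eq ?_)
  rw [Measure.addHaar_closedBall _ _ Metric.diam_nonneg, Measure.addHaar_ball _ _ hr.le,
    ← mul_assoc, ← ENNReal.ofReal_mul (by positivity)]
  congr 2
  simp only [finrank_euclideanSpace, Fintype.card_fin]
  field_simp

/-- The Poincaré inequality for smooth functions: the distance to the constants is controlled by the
gradient. The constant is a value of the function at a suitable point. -/
theorem exists_eLpNorm_sub_const_le (h : IsStarShapedBall D c r) {φ : Plane → ℝ}
    (hφ : ContDiff ℝ ∞ φ) :
    ∃ m : ℝ, eLpNorm (fun x => φ x - m) 2 (volume.restrict D) ≤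
      ENNReal.ofReal (2 * (Metric.diam D / r) * Metric.diam D) *
        eLpNorm (gradient φ) 2 (volume.restrict D) := by
  have hr := h.pos
  have hprob := isProbabilityMeasure_uniformBall c hr
  have hfin : IsFiniteMeasure (volume.restrict D) := ⟨by simpa using h.isBounded.measure_lt_top⟩
  have hprob1 : IsProbabilityMeasure (volume.restrict (Set.Ioc (0 : ℝ) 1)) := ⟨by simp⟩
  set ν := (volume.restrict D).prod (uniformBall c r) with hν
  set lam := volume.restrict (Set.Ioc (0 : ℝ) 1) with hlam
  have hνD : ∀ᵐ q ∂ν, q.1 ∈ D ∧ q.2 ∈ Metric.ball c r := by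
    have a1 : ∀ᵐ q ∂ν, q.1 ∈ D :=
      Measure.quasiMeasurePreserving_fst.ae (ae_restrict_mem h.isOpen.measurableSet)
    have a2 : ∀ᵐ q ∂ν, q.2 ∈ Metric.ball c r :=
      Measure.quasiMeasurePreserving_snd.ae (ae_uniformBall_mem c r)
    exact a1.and a2
  have hcm : Continuous fun q : (Plane × Plane) × ℝ => mix q.2 q.1 := by unfold mix; fun_prop
  have hcf : Continuous fun q : (Plane × Plane) × ℝ =>
      fderiv ℝ φ (mix q.2 q.1) (q.1.1 - q.1.2) :=
    ((hφ.continuous_fderiv (by simp)).comp hcm).clm_apply (by fun_prop)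
  have hcg := continuous_gradient hφ
  -- the mean value formula on the segment from `y` to `x`, and Jensen's inequality in `t`
  have s1 : eLpNorm (fun q : Plane × Plane => φ q.1 - φ q.2) 2 ν ≤
      eLpNorm (fun q : (Plane × Plane) × ℝ => fderiv ℝ φ (mix q.2 q.1) (q.1.1 - q.1.2)) 2
        (ν.prod lam) := by
    refine le_trans (le_of_eq (congrArg (fun f => eLpNorm f 2 ν) ?_))
      (eLpNorm_integral_le ν lam hcf.aestronglyMeasurable)
    ext q
    exact sub_eq_integral_mix hφ q.1 q.2
  -- the segment has length at most `diam D`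
  have s2 : eLpNorm (fun q : (Plane × Plane) × ℝ => fderiv ℝ φ (mix q.2 q.1) (q.1.1 - q.1.2)) 2
        (ν.prod lam) ≤ ENNReal.ofReal (Metric.diam D) *
      eLpNorm (fun q : (Plane × Plane) × ℝ => gradient φ (mix q.2 q.1)) 2 (ν.prod lam) := by
    refine eLpNorm_le_mul_eLpNorm_of_ae_le_mul ?_ 2
    filter_upwards [Measure.quasiMeasurePreserving_fst.ae hνD] with q hq
    rw [← InnerProductSpace.toDual_symm_apply, mul_comm]
    refine (norm_inner_le_norm _ _).trans (mul_le_mul_of_nonneg_left ?_ (norm_nonneg _))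
    rw [← dist_eq_norm]
    exact Metric.dist_le_diam_of_mem h.isBounded hq.1 (h.ball_subset hq.2)
  -- the density of `(1 - t) y + t x` is at most `4 |D| / |B| ≤ (2 diam D / r)²`
  have s3 : eLpNorm (fun q : (Plane × Plane) × ℝ => gradient φ (mix q.2 q.1)) 2 (ν.prod lam) ≤
      ENNReal.ofReal (2 * (Metric.diam D / r)) * eLpNorm (gradient φ) 2 (volume.restrict D) := by
    have := eLpNorm_map_measure (p := 2) (μ := ν.prod lam) (f := fun q => mix q.2 q.1)
      (g := gradient φ) hcg.aestronglyMeasurable hcm.measurable.aemeasurable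
    rw [show (fun q : (Plane × Plane) × ℝ => gradient φ (mix q.2 q.1)) =
      gradient φ ∘ fun q : (Plane × Plane) × ℝ => mix q.2 q.1 from rfl, ← this]
    have hle : ((ν.prod lam).map fun q => mix q.2 q.1) ≤
        (ENNReal.ofReal ((2 * (Metric.diam D / r)) ^ 2)) • volume.restrict D := by
      refine (map_mix_uniform_le h).trans (Measure.le_iff'.2 fun S => ?_)
      simp only [Measure.smul_apply, smul_eq_mul]
      gcongr
      rw [mul_pow, ENNReal.ofReal_mul (by norm_num)]
      refine mul_le_mul' (by norm_num) (volume_le_sq_mul_volume_ball h)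
    refine (eLpNorm_mono_measure _ hle).trans (le_of_eq ?_)
    rw [eLpNorm_smul_measure_of_ne_top (by norm_num), smul_eq_mul]
    congr 1
    have : 0 ≤ 2 * (Metric.diam D / r) := by positivity
    rw [ENNReal.ofReal_rpow_of_nonneg (by positivity) (by positivity)]
    congr 1
    rw [show (1 / (2 : ENNReal)).toReal = 1 / 2 by simp, ← Real.sqrt_eq_rpow, Real.sqrt_sq this]
  -- some `y` does at least as well as the average over the ball
  have s4 : ∃ y, eLpNorm (fun x => φ x - φ y) 2 (volume.restrict D) ≤
      eLpNorm (fun q : Plane × Plane => φ q.1 - φ q.2) 2 ν := by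
    have hc : Continuous fun q : Plane × Plane => ‖φ q.1 - φ q.2‖ₑ ^ (2 : ENNReal).toReal := by
      have := hφ.continuous
      fun_prop
    obtain ⟨y, hy⟩ := exists_le_lintegral (μ := uniformBall c r)
      (f := fun y => ∫⁻ x in D, ‖φ x - φ y‖ₑ ^ (2 : ENNReal).toReal)
      (hc.measurable.lintegral_prod_left').aemeasurable
    refine ⟨y, ?_⟩
    rw [eLpNorm_eq_lintegral_rpow_enorm_toReal (by norm_num) (by norm_num),
      eLpNorm_eq_lintegral_rpow_enorm_toReal (by norm_num) (by norm_num),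
      lintegral_prod_symm' _ hc.measurable]
    exact ENNReal.rpow_le_rpow hy (by norm_num)
  obtain ⟨y, hy⟩ := s4
  refine ⟨φ y, hy.trans (s1.trans (s2.trans ((mul_le_mul_right s3 _).trans (le_of_eq ?_))))⟩
  rw [← mul_assoc, ← ENNReal.ofReal_mul Metric.diam_nonneg, mul_comm (Metric.diam D)]

theorem norm_sub_starProjection_le_of_smooth (h : IsStarShapedBall D c r)
    (U : Submodule ℝ (L2 D ℝ)) [U.HasOrthogonalProjection]
    (hU : ∀ (m : ℝ) (g : L2 D ℝ), g =ᵐ[volume.restrict D] (fun _ => m) → g ∈ U)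
    {φ : Plane → ℝ} (hφ : ContDiff ℝ ∞ φ) {v : L2 D ℝ} {g : L2 D Plane}
    (hv : v =ᵐ[volume.restrict D] φ) (hg : g =ᵐ[volume.restrict D] gradient φ) :
    ‖v - U.starProjection v‖ ≤ 2 * (Metric.diam D / r) * Metric.diam D * ‖g‖ := by
  have hr := h.pos
  have hfin : IsFiniteMeasure (volume.restrict D) := ⟨by simpa using h.isBounded.measure_lt_top⟩
  obtain ⟨m, hm⟩ := exists_eLpNorm_sub_const_le h hφ
  set mL : L2 D ℝ := (memLp_const m).toLp _ with hmL
  have hmU : mL ∈ U := hU m mL (memLp_const m).coeFn_toLp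
  have hbest : ‖v - U.starProjection v‖ ≤ ‖v - mL‖ := by
    rw [Submodule.starProjection_minimal]
    exact ciInf_le ⟨0, by rintro _ ⟨x, rfl⟩; exact norm_nonneg _⟩ (⟨mL, hmU⟩ : U)
  refine hbest.trans ?_
  have hC : 0 ≤ 2 * (Metric.diam D / r) * Metric.diam D := by
    have := Metric.diam_nonneg (s := D); positivity
  rw [Lp.norm_def, Lp.norm_def, ← ENNReal.toReal_ofReal hC, ← ENNReal.toReal_mul]
  refine ENNReal.toReal_mono (ENNReal.mul_ne_top ENNReal.ofReal_ne_top (Lp.memLp _).2.ne) ?_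
  rw [eLpNorm_congr_ae hg]
  refine le_trans (le_of_eq (eLpNorm_congr_ae ?_)) hm
  filter_upwards [Lp.coeFn_sub v mL, hv,
    (memLp_const m : MemLp (fun _ => m) 2 (volume.restrict D)).coeFn_toLp] with x e1 e2 e3
  rw [e1, Pi.sub_apply, e2, hmL, e3]

/-- The Poincaré inequality on `H¹(D)`: the orthogonal projection onto a space of functions that
contains the constants is accurate to first order. -/
theorem norm_sub_starProjection_le (h : IsStarShapedBall D c r) (U : Submodule ℝ (L2 D ℝ))
    [U.HasOrthogonalProjection] (hU : ∀ (m : ℝ) (g : L2 D ℝ), g =ᵐ[volume.restrict D] (fun _ => m) →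
      g ∈ U) (v : H1 D) :
    ‖H1.val v - U.starProjection (H1.val v)‖ ≤
      2 * (Metric.diam D / r) * Metric.diam D * ‖H1.grad v‖ := by
  obtain ⟨φ, w, hw, hwv, -⟩ := h.exists_smooth_approx v
  obtain ⟨h1, h2⟩ := H1.tendsto_iff.1 hwv
  exact le_of_tendsto_of_tendsto
    ((h1.sub ((U.starProjection.continuous.tendsto _).comp h1)).norm) (h2.norm.const_mul _)
    (Eventually.of_forall fun j =>
      norm_sub_starProjection_le_of_smooth h U hU (hw j).1 (hw j).2.1 (hw j).2.2)

end Poincare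

/-! ### The Poincaré inequality on `H¹₀(Ω)` -/

theorem H1.tendsto_seq_of_mem_H10 {D : Set Plane} {v : H1 D} (hv : v ∈ H10 D) :
    ∃ w : ℕ → H1 D, (∀ j, ∃ φ, IsTestFunction D φ ∧ H1.Represents (w j) φ) ∧
      Tendsto w atTop (𝓝 v) := by
  obtain ⟨w, hw, h⟩ := mem_closure_iff_seq_limit.1 hv
  exact ⟨w, hw, h⟩

theorem gradient_sub_apply {φ ψ : Plane → ℝ} (hφ : ContDiff ℝ ∞ φ) (hψ : ContDiff ℝ ∞ ψ)
    (x : Plane) : gradient (φ - ψ) x = gradient φ x - gradient ψ x := by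
  simp only [gradient]
  rw [fderiv_sub (hφ.differentiable (by simp) x) (hψ.differentiable (by simp) x), map_sub]

theorem H1.Represents.sub {D : Set Plane} {v w : H1 D} {φ ψ : Plane → ℝ} (hφ : ContDiff ℝ ∞ φ)
    (hψ : ContDiff ℝ ∞ ψ) (hv : H1.Represents v φ) (hw : H1.Represents w ψ) :
    H1.Represents (v - w) (φ - ψ) := by
  constructor
  · rw [map_sub]
    filter_upwards [Lp.coeFn_sub (H1.val v) (H1.val w), hv.1, hw.1] with x e1 e2 e3
    rw [e1, Pi.sub_apply, Pi.sub_apply, e2, e3]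
  · rw [map_sub]
    filter_upwards [Lp.coeFn_sub (H1.grad v) (H1.grad w), hv.2, hw.2] with x e1 e2 e3
    rw [e1, Pi.sub_apply, gradient_sub_apply hφ hψ, e2, e3]

theorem sub_mem_H10 {D : Set Plane} {v w : H1 D} (hv : v ∈ H10 D) (hw : w ∈ H10 D) :
    v - w ∈ H10 D := by
  refine map_mem_closure₂ continuous_sub hv hw ?_
  rintro v ⟨φ, hφ, hv⟩ w ⟨ψ, hψ, hw⟩
  refine ⟨φ - ψ, ⟨hφ.smooth.sub hψ.smooth, hφ.compact.sub hψ.compact, ?_⟩,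
    hv.sub hφ.smooth hψ.smooth hw⟩
  exact (tsupport_sub φ ψ).trans (Set.union_subset hφ.supp hψ.supp)

/-- In the plane, `‖φ‖_{L²} ≤ C ‖∇φ‖_{L¹}` by the Gagliardo–Nirenberg–Sobolev inequality, and
`‖∇φ‖_{L¹} ≤ |D|^{1/2} ‖∇φ‖_{L²}`. -/
theorem norm_le_of_testFunction {D : Set Plane} (hb : Bornology.IsBounded D) {φ : Plane → ℝ}
    (hφ : IsTestFunction D φ) (hD : MeasurableSet D) {v : L2 D ℝ} {g : L2 D Plane}
    (hv : v =ᵐ[volume.restrict D] φ) (hg : g =ᵐ[volume.restrict D] gradient φ) :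
    ‖v‖ ≤ eLpNormLESNormFDerivOneConst (volume : Measure Plane) 2 *
      (volume D ^ (1 / 2 : ℝ)).toReal * ‖g‖ := by
  have hsob := eLpNorm_le_eLpNorm_fderiv_one (volume : Measure Plane) (p := 2)
    (hφ.smooth.of_le (by simp)) hφ.compact (by simpa using NNReal.HolderConjugate.two_two)
  have hsupp : Function.support (fderiv ℝ φ) ⊆ D :=
    (subset_tsupport _).trans ((tsupport_fderiv_subset ℝ).trans hφ.supp)
  have e1 : eLpNorm (fderiv ℝ φ) 1 volume ≤
      volume D ^ (1 / 2 : ℝ) * eLpNorm (gradient φ) 2 (volume.restrict D) := by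
    have : eLpNorm (fderiv ℝ φ) 1 volume = eLpNorm (gradient φ) 1 (volume.restrict D) := by
      rw [← eLpNorm_indicator_eq_eLpNorm_restrict hD]
      refine eLpNorm_congr_norm_ae (ae_of_all _ fun x => ?_)
      by_cases hx : x ∈ D
      · simp [hx, gradient]
      · have : fderiv ℝ φ x = 0 := by_contra fun h => hx (hsupp h)
        simp [hx, this]
    rw [this, mul_comm]
    have := eLpNorm_le_eLpNorm_mul_rpow_measure_univ (μ := volume.restrict D) (p := 1) (q := 2)
      (by norm_num) (continuous_gradient hφ.smooth).aestronglyMeasurable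
    refine this.trans (le_of_eq ?_)
    rw [Measure.restrict_apply_univ]
    norm_num
  have e2 : eLpNorm v 2 (volume.restrict D) ≤ eLpNorm φ 2 volume := by
    rw [eLpNorm_congr_ae hv]
    exact eLpNorm_mono_measure _ Measure.restrict_le_self
  have hvol : volume D ^ (1 / 2 : ℝ) ≠ ⊤ :=
    ENNReal.rpow_ne_top_of_nonneg (by norm_num) hb.measure_lt_top.ne
  rw [Lp.norm_def, Lp.norm_def, ← ENNReal.coe_toReal, ← ENNReal.toReal_mul, ← ENNReal.toReal_mul]
  refine ENNReal.toReal_mono (ENNReal.mul_ne_top (ENNReal.mul_ne_top ENNReal.coe_ne_top hvol)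
    (Lp.memLp _).2.ne) (e2.trans (hsob.trans ?_))
  rw [eLpNorm_congr_ae hg, mul_assoc]
  exact mul_le_mul_right e1 _

/-- The Poincaré inequality on `H¹₀` of a bounded open set. -/
theorem exists_poincare_H10 {D : Set Plane} (hb : Bornology.IsBounded D) (hD : IsOpen D) :
    ∃ C : ℝ, 0 ≤ C ∧ ∀ v ∈ H10 D, ‖H1.val v‖ ≤ C * ‖H1.grad v‖ := by
  refine ⟨eLpNormLESNormFDerivOneConst (volume : Measure Plane) 2 *
    (volume D ^ (1 / 2 : ℝ)).toReal, by positivity, fun v hv => ?_⟩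
  obtain ⟨w, hw, hwv⟩ := H1.tendsto_seq_of_mem_H10 hv
  obtain ⟨h1, h2⟩ := H1.tendsto_iff.1 hwv
  refine le_of_tendsto_of_tendsto h1.norm (h2.norm.const_mul _) (Eventually.of_forall fun j => ?_)
  obtain ⟨φ, hφ, h⟩ := hw j
  exact norm_le_of_testFunction hb hφ hD.measurableSet h.1 h.2

/-! ### A trace inequality on the edges of a star-shaped polygon -/

section Edge

variable {D : Set Plane} {c : Plane} {r : ℝ}

/-- The affine map `(s, b) ↦ c + s (A - c) + b (B - A)`, which sends the triangle `0 < b < s < 1` to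
the triangle `c A B`, with the side `s = 1` on the segment `A B`. -/
def coneMap (c A B : Plane) (q : ℝ × ℝ) : Plane := c + (q.1 • (A - c) + q.2 • (B - A))

theorem continuous_coneMap (c A B : Plane) : Continuous (coneMap c A B) := by
  unfold coneMap; fun_prop

/-- The end points of a segment of the boundary are not collinear with the centre. -/
theorem IsStarShapedBall.not_collinear (h : IsStarShapedBall D c r) {A B : Plane} (hAB : A ≠ B)
    (hseg : segment ℝ A B ⊆ frontier D) (a : ℝ) : a • (A - c) ≠ B - c := by
  intro ha
  have hc : c ∈ Metric.ball c r := Metric.mem_ball_self h.pos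
  have hnot : ∀ x ∈ segment ℝ A B, x ∉ D := fun x hx hxD =>
    (h.isOpen.frontier_eq.subset (hseg hx)).2 hxD
  have hcl : ∀ x ∈ segment ℝ A B, x ∈ closure D := fun x hx => frontier_subset_closure (hseg hx)
  have hA := left_mem_segment ℝ A B
  have hB := right_mem_segment ℝ A B
  have hBeq : B = c + a • (A - c) := by rw [ha]; abel
  rcases lt_trichotomy a 1 with h1 | rfl | h1
  · rcases le_or_gt 0 a with h0 | h0
    · have := h.mix_mem_of_closure h0 h1 (hcl A hA) hc
      refine hnot B hB ?_
      convert this using 1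
      rw [hBeq, mix]; module
    · refine hnot c ?_ (h.ball_subset hc)
      have hpos : 0 < 1 - a := by linarith
      refine ⟨-a / (1 - a), 1 / (1 - a), div_nonneg (by linarith) hpos.le, by positivity, ?_, ?_⟩
      · field_simp; ring
      · rw [hBeq]
        match_scalars <;> field_simp <;> ring
  · exact hAB (by rw [hBeq]; simp)
  · have ha0 : a ≠ 0 := by linarith
    have := h.mix_mem_of_closure (t := a⁻¹) (by positivity) (inv_lt_one_of_one_lt₀ h1) (hcl B hB) hc
    refine hnot A hA ?_
    convert this using 1
    rw [hBeq, mix, smul_add, smul_smul, inv_mul_cancel₀ ha0]; module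

theorem IsStarShapedBall.coneMap_mem (h : IsStarShapedBall D c r) {A B : Plane}
    (hseg : segment ℝ A B ⊆ frontier D) {s b : ℝ} (hb : 0 < b) (hbs : b < s) (hs : s < 1) :
    coneMap c A B (s, b) ∈ D := by
  have hs0 : 0 < s := hb.trans hbs
  have hx : AffineMap.lineMap A B (b / s) ∈ segment ℝ A B := by
    rw [segment_eq_image_lineMap]
    exact ⟨b / s, ⟨by positivity, (div_le_one hs0).2 hbs.le⟩, rfl⟩
  have := h.mix_mem_of_closure hs0.le hs (frontier_subset_closure (hseg hx))
    (Metric.mem_ball_self h.pos)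
  convert this using 1
  rw [coneMap, mix, AffineMap.lineMap_apply_module', smul_add, smul_smul, mul_div_cancel₀ _ hs0.ne']
  module

/-- Integrals over the triangle are controlled by integrals over its image. -/
theorem exists_lintegral_coneMap_eq (c A B : Plane) (hA : A ≠ c)
    (hcol : ∀ a : ℝ, a • (A - c) ≠ B - c) :
    ∃ κ : ENNReal, κ ≠ ⊤ ∧ ∀ G : Plane → ENNReal, Measurable G →
      ∫⁻ q : ℝ × ℝ, G (coneMap c A B q) = κ * ∫⁻ x, G x := by
  let L : ℝ × ℝ →ₗ[ℝ] Plane := (LinearMap.fst ℝ ℝ ℝ).smulRight (A - c) +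
    (LinearMap.snd ℝ ℝ ℝ).smulRight (B - A)
  have hL : ∀ q, L q = q.1 • (A - c) + q.2 • (B - A) := fun q => rfl
  have hinj : Function.Injective L := by
    rw [← LinearMap.ker_eq_bot, LinearMap.ker_eq_bot']
    rintro ⟨s, b⟩ hq
    have hli := (LinearIndependent.pair_iff' (sub_ne_zero.2 hA)).2 hcol
    rw [LinearIndependent.pair_iff] at hli
    have := hli (s - b) b (by rw [← hq, hL]; simp only; module)
    ext
    · simp only [Prod.fst_zero]; linarith [this.1, this.2]
    · exact this.2
  let e : (ℝ × ℝ) ≃L[ℝ] Plane :=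
    (LinearEquiv.ofInjectiveOfFinrankEq L hinj (by simp)).toContinuousLinearEquiv
  have he : ∀ q, e q = L q := fun q => rfl
  have hH : (Measure.map e (volume : Measure (ℝ × ℝ))).IsAddHaarMeasure :=
    e.isAddHaarMeasure_map volume
  obtain ⟨κ, hκ⟩ : ∃ κ : NNReal, Measure.map e (volume : Measure (ℝ × ℝ)) = κ • volume :=
    ⟨_, Measure.isAddLeftInvariant_eq_smul _ _⟩
  refine ⟨κ, ENNReal.coe_ne_top, fun G hG => ?_⟩
  have h1 : ∫⁻ q : ℝ × ℝ, G (coneMap c A B q) =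
      ∫⁻ x, G (c + x) ∂(Measure.map e (volume : Measure (ℝ × ℝ))) := by
    rw [lintegral_map (by fun_prop) e.continuous.measurable]
    rfl
  rw [h1, hκ, lintegral_smul_measure, lintegral_add_left_eq_self G c]
  rfl

/-- The boundary value of `φ` at the point of the edge with parameter `b`, weighted by `1 - b`, as
an integral along the line through this point that is parallel to `A - c`: the weight `s - b`
vanishes where the line meets the side `c B`. -/
theorem weighted_eq_integral {φ : Plane → ℝ} (hφ : ContDiff ℝ ∞ φ) (c A B : Plane) {b : ℝ}
    (hb : b ≤ 1) : (1 - b) * φ (AffineMap.lineMap A B b) =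
      ∫ s in Set.Ioo b 1, (φ (coneMap c A B (s, b)) +
        (s - b) * fderiv ℝ φ (coneMap c A B (s, b)) (A - c)) := by
  have hd : ∀ s : ℝ, HasDerivAt (fun s : ℝ => (s - b) * φ (coneMap c A B (s, b)))
      (φ (coneMap c A B (s, b)) + (s - b) * fderiv ℝ φ (coneMap c A B (s, b)) (A - c)) s :=
    fun s => by
      have h1 : HasDerivAt (fun s : ℝ => coneMap c A B (s, b)) (A - c) s := by
        have := (((hasDerivAt_id s).smul_const (A - c)).add_const (b • (B - A))).const_add c
        refine this.congr_deriv ?_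
        simp
      have h2 := ((hφ.differentiable (by simp) _).hasFDerivAt).comp_hasDerivAt s h1
      have h3 := ((hasDerivAt_id s).sub_const b).mul h2
      refine h3.congr_deriv ?_
      simp
  have hcc : Continuous fun s : ℝ => coneMap c A B (s, b) :=
    (continuous_coneMap c A B).comp (by fun_prop)
  have hc : Continuous fun s : ℝ => φ (coneMap c A B (s, b)) +
      (s - b) * fderiv ℝ φ (coneMap c A B (s, b)) (A - c) :=
    (hφ.continuous.comp hcc).add ((continuous_id.sub continuous_const).mul
      (((hφ.continuous_fderiv (by simp)).comp hcc).clm_apply continuous_const))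
  rw [← integral_Ioc_eq_integral_Ioo, ← intervalIntegral.integral_of_le hb,
    intervalIntegral.integral_eq_sub_of_hasDerivAt (fun s _ => hd s) (hc.intervalIntegrable _ _)]
  rw [sub_self, zero_mul, sub_zero, coneMap, AffineMap.lineMap_apply_module']
  congr 2
  module

/-- The trace inequality on an edge, with a weight that vanishes at one of the end points. -/
theorem exists_enorm_weighted_edge_integral_le (h : IsStarShapedBall D c r) {A B : Plane}
    (hAB : A ≠ B) (hseg : segment ℝ A B ⊆ frontier D) :
    ∃ C : ENNReal, C ≠ ⊤ ∧ ∀ φ : Plane → ℝ, ContDiff ℝ ∞ φ →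
      ‖∫ b in Set.Ioo (0 : ℝ) 1, (1 - b) * φ (AffineMap.lineMap A B b)‖ₑ ≤
        C * ∫⁻ x in D, (‖φ x‖ₑ + ‖gradient φ x‖ₑ) := by
  have hA : A ≠ c := by
    rintro rfl
    exact (h.isOpen.frontier_eq.subset (hseg (left_mem_segment ℝ A B))).2
      (h.ball_subset (Metric.mem_ball_self h.pos))
  obtain ⟨κ, hκ, hκG⟩ := exists_lintegral_coneMap_eq c A B hA (h.not_collinear hAB hseg)
  set M : ENNReal := 1 + ‖A - c‖ₑ with hM
  refine ⟨M * κ, ENNReal.mul_ne_top (by simp [hM]) hκ, fun φ hφ => ?_⟩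
  set H : Plane → ENNReal := fun x => ‖φ x‖ₑ + ‖gradient φ x‖ₑ with hH
  have hHm : Measurable H :=
    (hφ.continuous.enorm.add (continuous_gradient hφ).enorm).measurable
  have hHD : Measurable (D.indicator H) := hHm.indicator h.isOpen.measurableSet
  have hpt : ∀ b ∈ Set.Ioo (0 : ℝ) 1, ‖(1 - b) * φ (AffineMap.lineMap A B b)‖ₑ ≤
      ∫⁻ s, M * D.indicator H (coneMap c A B (s, b)) := fun b hb => by
    rw [weighted_eq_integral hφ c A B hb.2.le]
    refine (enorm_integral_le_lintegral_enorm _).trans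
      (le_trans ?_ (setLIntegral_le_lintegral (Set.Ioo b 1) _))
    refine setLIntegral_mono (by
      refine Measurable.const_mul (hHD.comp ?_) _
      exact ((continuous_coneMap c A B).comp (by fun_prop)).measurable) fun s hs => ?_
    rw [Set.indicator_of_mem (h.coneMap_mem hseg hb.1 hs.1 hs.2)]
    set x := coneMap c A B (s, b)
    have e1 : ‖(s - b) * fderiv ℝ φ x (A - c)‖ₑ ≤ ‖A - c‖ₑ * ‖gradient φ x‖ₑ := by
      rw [enorm_mul, mul_comm ‖A - c‖ₑ]
      have a1 : ‖s - b‖ₑ ≤ 1 := by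
        rw [Real.enorm_eq_ofReal (by linarith [hs.1])]
        exact ENNReal.ofReal_le_one.2 (by linarith [hs.2, hb.1])
      have a2 : ‖fderiv ℝ φ x (A - c)‖ₑ ≤ ‖gradient φ x‖ₑ * ‖A - c‖ₑ := by
        have := (fderiv ℝ φ x).le_opENorm (A - c)
        rwa [show ‖fderiv ℝ φ x‖ₑ = ‖gradient φ x‖ₑ by simp [gradient]] at this
      calc _ ≤ 1 * (‖gradient φ x‖ₑ * ‖A - c‖ₑ) := mul_le_mul' a1 a2
        _ = _ := one_mul _
    calc _ ≤ ‖φ x‖ₑ + ‖A - c‖ₑ * ‖gradient φ x‖ₑ := (enorm_add_le _ _).trans (by gcongr)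
      _ ≤ ‖φ x‖ₑ + ‖A - c‖ₑ * ‖gradient φ x‖ₑ + (‖gradient φ x‖ₑ + ‖A - c‖ₑ * ‖φ x‖ₑ) :=
        le_self_add
      _ = M * H x := by rw [hM, hH]; ring
  calc _ ≤ ∫⁻ b in Set.Ioo (0 : ℝ) 1, ‖(1 - b) * φ (AffineMap.lineMap A B b)‖ₑ :=
        enorm_integral_le_lintegral_enorm _
    _ ≤ ∫⁻ b in Set.Ioo (0 : ℝ) 1, ∫⁻ s, M * D.indicator H (coneMap c A B (s, b)) := by
        refine setLIntegral_mono' measurableSet_Ioo hpt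
    _ ≤ ∫⁻ b, ∫⁻ s, M * D.indicator H (coneMap c A B (s, b)) := setLIntegral_le_lintegral _ _
    _ = ∫⁻ q : ℝ × ℝ, M * D.indicator H (coneMap c A B q) := by
        have hmm : Measurable fun q : ℝ × ℝ => M * D.indicator H (coneMap c A B q) :=
          (hHD.comp (continuous_coneMap c A B).measurable).const_mul _
        rw [Measure.volume_eq_prod, lintegral_prod_symm' _ hmm]
    _ = M * κ * ∫⁻ x in D, H x := by
        have hmm : Measurable fun q : ℝ × ℝ => D.indicator H (coneMap c A B q) :=
          hHD.comp (continuous_coneMap c A B).measurable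
        rw [lintegral_const_mul _ hmm, hκG _ hHD,
          lintegral_indicator h.isOpen.measurableSet, mul_assoc]

/-- The trace inequality on an edge, for the integral of the boundary values. -/
theorem exists_enorm_edge_integral_le (h : IsStarShapedBall D c r) {A B : Plane}
    (hAB : A ≠ B) (hseg : segment ℝ A B ⊆ frontier D) :
    ∃ C : ENNReal, C ≠ ⊤ ∧ ∀ φ : Plane → ℝ, ContDiff ℝ ∞ φ →
      ‖∫ b in Set.Icc (0 : ℝ) 1, φ (AffineMap.lineMap A B b)‖ₑ ≤
        C * ∫⁻ x in D, (‖φ x‖ₑ + ‖gradient φ x‖ₑ) := by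
  obtain ⟨C₁, hC₁, h₁⟩ := exists_enorm_weighted_edge_integral_le h hAB hseg
  obtain ⟨C₂, hC₂, h₂⟩ := exists_enorm_weighted_edge_integral_le h hAB.symm
    (by rwa [segment_symm])
  refine ⟨C₁ + C₂, ENNReal.add_ne_top.2 ⟨hC₁, hC₂⟩, fun φ hφ => ?_⟩
  have hcl : Continuous fun b : ℝ => φ (AffineMap.lineMap A B b) :=
    hφ.continuous.comp AffineMap.lineMap_continuous
  -- the weights `1 - b` and `b` of the two triangles add up to one
  have e1 : ∫ b in Set.Ioo (0 : ℝ) 1, (1 - b) * φ (AffineMap.lineMap B A b) =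
      ∫ b in Set.Ioo (0 : ℝ) 1, b * φ (AffineMap.lineMap A B b) := by
    simp only [← integral_Ioc_eq_integral_Ioo,
      ← intervalIntegral.integral_of_le (zero_le_one' ℝ)]
    have := intervalIntegral.integral_comp_sub_left (a := 0) (b := 1)
      (fun b : ℝ => b * φ (AffineMap.lineMap A B b)) 1
    rw [sub_self, sub_zero] at this
    rw [← this]
    refine intervalIntegral.integral_congr fun b _ => ?_
    simp only [AffineMap.lineMap_apply_one_sub]
  have e2 : ∫ b in Set.Icc (0 : ℝ) 1, φ (AffineMap.lineMap A B b) =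
      (∫ b in Set.Ioo (0 : ℝ) 1, (1 - b) * φ (AffineMap.lineMap A B b)) +
        ∫ b in Set.Ioo (0 : ℝ) 1, (1 - b) * φ (AffineMap.lineMap B A b) := by
    rw [e1, integral_Icc_eq_integral_Ioo, ← integral_add]
    · exact integral_congr_ae (ae_of_all _ fun b => by ring)
    · exact (((continuous_const.sub continuous_id).mul hcl).integrableOn_Icc).mono_set
        Set.Ioo_subset_Icc_self
    · exact ((continuous_id.mul hcl).integrableOn_Icc).mono_set Set.Ioo_subset_Icc_self
  rw [e2, add_mul]
  exact (enorm_add_le _ _).trans (add_le_add (h₁ φ hφ) (h₂ φ hφ))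

end Edge

namespace Polygon

/-! ### Traces on the boundary of a polygon -/

variable (K : Polygon)

theorem continuous_edgePoint (i : Fin K.n) : Continuous (K.edgePoint i) :=
  AffineMap.lineMap_continuous

theorem vertex_ne_next (i : Fin K.n) : K.vertex i ≠ K.vertex (finRotate K.n i) := by
  intro h
  have h1 := K.vertex_injective h
  have h3 := K.three_le
  obtain ⟨m, hm⟩ : ∃ m, K.n = m + 2 := ⟨K.n - 2, by omega⟩
  have : ∀ {n : ℕ} (i : Fin n), n = m + 2 → finRotate n i ≠ i := by
    rintro n i rfl
    rw [finRotate_apply]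
    simp
  exact this i hm h1.symm

theorem edgeLength_pos (i : Fin K.n) : 0 < K.edgeLength i := dist_pos.2 (K.vertex_ne_next i)

theorem segment_subset_frontier (i : Fin K.n) :
    segment ℝ (K.vertex i) (K.vertex (finRotate K.n i)) ⊆ frontier K.carrier := by
  rw [K.frontier_eq]
  exact Set.subset_iUnion (fun i => segment ℝ (K.vertex i) (K.vertex (finRotate K.n i))) i

theorem edgePoint_mem_frontier (i : Fin K.n) {t : ℝ} (ht : t ∈ Set.Icc (0 : ℝ) 1) :
    K.edgePoint i t ∈ frontier K.carrier := by
  refine K.segment_subset_frontier i ?_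
  rw [segment_eq_image_lineMap]
  exact ⟨t, ht, rfl⟩

instance : IsFiniteMeasure K.boundaryMeasure := by
  constructor
  rw [boundaryMeasure, Measure.coe_finsetSum, Finset.sum_apply, ENNReal.sum_lt_top]
  intro i _
  rw [Measure.smul_apply, smul_eq_mul]
  exact ENNReal.mul_lt_top ENNReal.ofReal_lt_top (measure_lt_top _ _)

theorem ae_boundaryMeasure {P : Plane → Prop} (hP : ∀ x ∈ frontier K.carrier, P x) :
    ∀ᵐ x ∂K.boundaryMeasure, P x := by
  have h0 : K.boundaryMeasure (frontier K.carrier)ᶜ = 0 := by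
    rw [boundaryMeasure, Measure.coe_finsetSum, Finset.sum_apply]
    refine Finset.sum_eq_zero fun i _ => ?_
    have hm := (K.continuous_edgePoint i).measurable
    rw [Measure.smul_apply, Measure.map_apply hm isClosed_frontier.measurableSet.compl,
      Measure.restrict_apply (hm isClosed_frontier.measurableSet.compl)]
    have : K.edgePoint i ⁻¹' (frontier K.carrier)ᶜ ∩ Set.Icc 0 1 = ∅ := by
      ext t
      simp only [Set.mem_inter_iff, Set.mem_preimage, Set.mem_compl_iff, Set.mem_empty_iff_false,
        iff_false, not_and]
      exact fun h1 h2 => h1 (K.edgePoint_mem_frontier i h2)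
    rw [this, measure_empty, smul_zero]
  filter_upwards [compl_mem_ae_iff.2 h0] with x hx
  exact hP x (by simpa using hx)

theorem memLp_boundary {φ : Plane → ℝ} (hφ : Continuous φ) (q : ENNReal) :
    MemLp φ q K.boundaryMeasure := by
  have hc : IsCompact (frontier K.carrier) :=
    K.isBounded.isCompact_closure.of_isClosed_subset isClosed_frontier frontier_subset_closure
  obtain ⟨C, hC⟩ := hc.exists_bound_of_continuousOn hφ.continuousOn
  exact MemLp.of_bound hφ.aestronglyMeasurable C (K.ae_boundaryMeasure hC)

theorem integral_boundary {φ : Plane → ℝ} (hφ : Continuous φ) :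
    ∫ x, φ x ∂K.boundaryMeasure =
      ∑ i, K.edgeLength i * ∫ t in Set.Icc (0 : ℝ) 1, φ (K.edgePoint i t) := by
  have hint : ∀ i ∈ Finset.univ, Integrable φ (ENNReal.ofReal (K.edgeLength i) •
      Measure.map (K.edgePoint i) (volume.restrict (Set.Icc (0 : ℝ) 1))) := fun i _ => by
    refine Integrable.smul_measure ?_ ENNReal.ofReal_ne_top
    rw [integrable_map_measure hφ.aestronglyMeasurable (K.continuous_edgePoint i).aemeasurable]
    exact (hφ.comp (K.continuous_edgePoint i)).integrableOn_Icc
  rw [boundaryMeasure, integral_finsetSum_measure hint]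
  refine Finset.sum_congr rfl fun i _ => ?_
  rw [integral_smul_measure, integral_map (K.continuous_edgePoint i).aemeasurable
    hφ.aestronglyMeasurable, ENNReal.toReal_ofReal (K.edgeLength_pos i).le, smul_eq_mul]

theorem integral_boundary_const_ne_zero {m : ℝ} (hm : m ≠ 0) :
    ∫ _, m ∂K.boundaryMeasure ≠ 0 := by
  rw [K.integral_boundary continuous_const]
  simp only [integral_const, MeasurableSet.univ, measureReal_restrict_apply, Set.univ_inter,
    Real.volume_real_Icc, sub_zero, smul_eq_mul]
  rw [← Finset.sum_mul]
  have : 0 < ∑ i, K.edgeLength i := by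
    have : Nonempty (Fin K.n) := ⟨⟨0, by have := K.three_le; omega⟩⟩
    exact Finset.sum_pos (fun i _ => K.edgeLength_pos i) Finset.univ_nonempty
  simp [this.ne', hm]

section StarShaped

variable {K} {c : Plane} {r : ℝ}

/-- The trace inequality, for the integral over the boundary. -/
theorem exists_enorm_integral_boundary_le (h : IsStarShapedBall K.carrier c r) :
    ∃ C : ENNReal, C ≠ ⊤ ∧ ∀ φ : Plane → ℝ, ContDiff ℝ ∞ φ →
      ‖∫ x, φ x ∂K.boundaryMeasure‖ₑ ≤
        C * ∫⁻ x in K.carrier, (‖φ x‖ₑ + ‖gradient φ x‖ₑ) := by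
  choose C hC hCφ using fun i =>
    exists_enorm_edge_integral_le h (K.vertex_ne_next i) (K.segment_subset_frontier i)
  refine ⟨∑ i, ENNReal.ofReal (K.edgeLength i) * C i, ?_, fun φ hφ => ?_⟩
  · exact ENNReal.sum_ne_top.2 fun i _ => ENNReal.mul_ne_top ENNReal.ofReal_ne_top (hC i)
  · rw [K.integral_boundary hφ.continuous, Finset.sum_mul]
    refine (enorm_sum_le _ _).trans (Finset.sum_le_sum fun i _ => ?_)
    rw [enorm_mul, Real.enorm_eq_ofReal (K.edgeLength_pos i).le, mul_assoc]
    exact mul_le_mul_right (hCφ i φ hφ) _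

/-- On a bounded set, convergence to zero in `L²` implies convergence to zero in `L¹`. -/
theorem tendsto_lintegral_enorm_of_tendsto_zero {D : Set Plane} (hb : Bornology.IsBounded D)
    {F : Type} [NormedAddCommGroup F] {f : ℕ → L2 D F} {φ : ℕ → Plane → F}
    (hf : Tendsto f atTop (𝓝 0)) (hφ : ∀ j, f j =ᵐ[volume.restrict D] φ j) :
    Tendsto (fun j => ∫⁻ x in D, ‖φ j x‖ₑ) atTop (𝓝 0) := by
  have hfin : IsFiniteMeasure (volume.restrict D) := ⟨by simpa using hb.measure_lt_top⟩
  have h1 : Tendsto (fun j => eLpNorm (f j) 2 (volume.restrict D)) atTop (𝓝 0) := by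
    have := (Lp.tendsto_Lp_iff_tendsto_eLpNorm' f 0).1 hf
    refine this.congr fun j => eLpNorm_congr_ae ?_
    filter_upwards [Lp.coeFn_zero F 2 (volume.restrict D)] with x hx
    rw [Pi.sub_apply, hx, Pi.zero_apply, sub_zero]
  set κ := volume.restrict D Set.univ ^ (1 / (1 : ENNReal).toReal - 1 / (2 : ENNReal).toReal)
  have hκ : κ ≠ ⊤ := ENNReal.rpow_ne_top_of_nonneg (by norm_num) (measure_ne_top _ _)
  have h2 := ENNReal.Tendsto.mul_const (b := κ) h1 (Or.inr hκ)
  rw [zero_mul] at h2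
  refine tendsto_of_tendsto_of_tendsto_of_le_of_le tendsto_const_nhds h2 (fun _ => zero_le)
    fun j => ?_
  have := eLpNorm_le_eLpNorm_mul_rpow_measure_univ (p := 1) (q := 2) (by norm_num)
    (Lp.aestronglyMeasurable (f j))
  refine le_trans (le_of_eq ?_) this
  rw [eLpNorm_one_eq_lintegral_enorm]
  refine lintegral_congr_ae ?_
  filter_upwards [hφ j] with x hx
  rw [hx]

/-- A trace of zero has integral zero; this much uniqueness of the trace suffices for the uniqueness
of `Π^∇`. -/
theorem HasTrace.integral_eq_zero (h : IsStarShapedBall K.carrier c r) {g : Plane → ℝ}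
    (hg : K.HasTrace 0 g) : ∫ x, g x ∂K.boundaryMeasure = 0 := by
  obtain ⟨hgm, φ, w, hφ, hw, hlim⟩ := hg
  obtain ⟨C, hC, hCφ⟩ := exists_enorm_integral_boundary_le h
  obtain ⟨h1, h2⟩ := H1.tendsto_iff.1 hw
  rw [map_zero] at h1 h2
  have t1 := tendsto_lintegral_enorm_of_tendsto_zero K.isBounded h1 fun j => (hφ j).2.1
  have t2 := tendsto_lintegral_enorm_of_tendsto_zero K.isBounded h2 fun j => (hφ j).2.2
  have t3 : Tendsto (fun j => ∫ x, φ j x ∂K.boundaryMeasure) atTop (𝓝 0) := by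
    rw [tendsto_zero_iff_enorm_tendsto_zero]
    have := ENNReal.Tendsto.const_mul (a := C) (t1.add t2) (Or.inr hC)
    rw [add_zero, mul_zero] at this
    refine tendsto_of_tendsto_of_tendsto_of_le_of_le tendsto_const_nhds this (fun _ => zero_le)
      fun j => ?_
    refine (hCφ (φ j) (hφ j).1).trans (mul_le_mul_right (le_of_eq ?_) _)
    exact lintegral_add_left (hφ j).1.continuous.enorm.measurable _
  have t4 : Tendsto (fun j => ∫ x, φ j x ∂K.boundaryMeasure) atTop
      (𝓝 (∫ x, g x ∂K.boundaryMeasure)) := by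
    have hL1 : Tendsto (fun j => eLpNorm (φ j - g) 1 K.boundaryMeasure) atTop (𝓝 0) := by
      set κ := K.boundaryMeasure Set.univ ^ (1 / (1 : ENNReal).toReal - 1 / (2 : ENNReal).toReal)
      have hκ : κ ≠ ⊤ := ENNReal.rpow_ne_top_of_nonneg (by norm_num) (measure_ne_top _ _)
      have h2 := ENNReal.Tendsto.mul_const (b := κ) hlim (Or.inr hκ)
      rw [zero_mul] at h2
      refine tendsto_of_tendsto_of_tendsto_of_le_of_le tendsto_const_nhds h2 (fun _ => zero_le)
        fun j => eLpNorm_le_eLpNorm_mul_rpow_measure_univ (by norm_num)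
          ((hφ j).1.continuous.aestronglyMeasurable.sub hgm.1)
    exact tendsto_integral_of_L1' g hgm.1
      (Eventually.of_forall fun j => (K.memLp_boundary (hφ j).1.continuous 1).integrable le_rfl) hL1
  exact tendsto_nhds_unique t4 t3

theorem HasTrace.sub {v w : H1 K.carrier} {g k : Plane → ℝ} (hv : K.HasTrace v g)
    (hw : K.HasTrace w k) : K.HasTrace (v - w) (g - k) := by
  obtain ⟨hg, φ, a, hφ, ha, hla⟩ := hv
  obtain ⟨hk, ψ, b, hψ, hb, hlb⟩ := hw
  refine ⟨hg.sub hk, fun j => φ j - ψ j, fun j => a j - b j, fun j =>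
    ⟨(hφ j).1.sub (hψ j).1, (hφ j).2.sub (hφ j).1 (hψ j).1 (hψ j).2⟩, ha.sub hb, ?_⟩
  have := hla.add hlb
  rw [add_zero] at this
  refine tendsto_of_tendsto_of_tendsto_of_le_of_le tendsto_const_nhds this (fun _ => zero_le)
    fun j => ?_
  simp only
  rw [show φ j - ψ j - (g - k) = (φ j - g) - (ψ j - k) by abel]
  exact eLpNorm_sub_le ((hφ j).1.continuous.aestronglyMeasurable.sub hg.1)
    ((hψ j).1.continuous.aestronglyMeasurable.sub hk.1) (by norm_num)

theorem hasTrace_of_represents {v : H1 K.carrier} {φ : Plane → ℝ} (hφ : ContDiff ℝ ∞ φ)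
    (hv : H1.Represents v φ) : K.HasTrace v φ :=
  ⟨K.memLp_boundary hφ.continuous 2, fun _ => φ, fun _ => v, fun _ => ⟨hφ, hv⟩,
    tendsto_const_nhds, by simp⟩

/-- A function of `H¹(K)` that is continuous up to the boundary has its boundary values as trace. -/
theorem hasTrace_of_continuous (h : IsStarShapedBall K.carrier c r) {v : H1 K.carrier}
    {W : Plane → ℝ} (hW : Continuous W) (hv : H1.val v =ᵐ[volume.restrict K.carrier] W) :
    K.HasTrace v W := by
  obtain ⟨φ, w, hφ, hw, hunif⟩ := h.exists_smooth_approx v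
  refine ⟨K.memLp_boundary hW 2, φ, w, hφ, hw, ?_⟩
  set κ := K.boundaryMeasure Set.univ ^ (2 : ENNReal).toReal⁻¹ with hκdef
  have hκ : κ ≠ ⊤ := ENNReal.rpow_ne_top_of_nonneg (by norm_num) (measure_ne_top _ _)
  rw [ENNReal.tendsto_nhds_zero]
  intro ε hε
  obtain ⟨δ, hδ, hδε⟩ : ∃ δ : ℝ, 0 < δ ∧ κ * ENNReal.ofReal δ ≤ ε := by
    have hlim : Tendsto (fun δ : ℝ => κ * ENNReal.ofReal δ) (𝓝[>] 0) (𝓝 0) := by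
      have h0 : Tendsto (fun δ : ℝ => ENNReal.ofReal δ) (𝓝[>] 0) (𝓝 0) := by
        have := (ENNReal.continuous_ofReal.tendsto 0).mono_left
          (nhdsWithin_le_nhds (s := Set.Ioi (0 : ℝ)))
        simpa using this
      have := ENNReal.Tendsto.const_mul (a := κ) h0 (Or.inr hκ)
      simpa using this
    obtain ⟨δ, h1, h2⟩ := ((ENNReal.tendsto_nhds_zero.1 hlim ε hε).and
      self_mem_nhdsWithin).exists
    exact ⟨δ, h2, h1⟩
  filter_upwards [hunif W hW hv δ hδ] with j hj
  refine (eLpNorm_le_of_ae_bound (C := δ) (K.ae_boundaryMeasure fun x hx => ?_)).trans hδε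
  exact hj x (frontier_subset_closure hx)

end StarShaped

end Polygon

/-! ### Polynomials as elements of `H¹(K)` -/

theorem totalDegree_pderiv_le (i : Fin 2) (q : MvPolynomial (Fin 2) ℝ) :
    (MvPolynomial.pderiv i q).totalDegree ≤ q.totalDegree - 1 := by
  refine Finset.sup_le fun m hm => ?_
  rw [MvPolynomial.mem_support_iff, MvPolynomial.coeff_pderiv] at hm
  have := MvPolynomial.le_totalDegree (MvPolynomial.mem_support_iff.2 (left_ne_zero_of_mul hm))
  rw [Finsupp.sum_add_index' (fun _ => rfl) (fun _ _ _ => rfl),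
    Finsupp.sum_single_index rfl] at this
  omega

theorem fderiv_eval (q : MvPolynomial (Fin 2) ℝ) (x e : Plane) :
    fderiv ℝ (fun x : Plane => MvPolynomial.eval x q) x e =
      ∑ i, MvPolynomial.eval x (MvPolynomial.pderiv i q) * e i := by
  have hd : ∀ q, Differentiable ℝ (fun x : Plane => MvPolynomial.eval x q) := fun q =>
    (Polygon.contDiff_eval q).differentiable (by simp)
  induction q using MvPolynomial.induction_on with
  | C a => simp
  | add p q hp hq =>
    simp only [map_add, add_mul, Finset.sum_add_distrib]
    rw [fderiv_fun_add (hd p x) (hd q x), _root_.add_apply, hp, hq]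
  | mul_X p j hp =>
    have hj : HasFDerivAt (fun x : Plane => x j) (EuclideanSpace.proj (𝕜 := ℝ) j) x :=
      (EuclideanSpace.proj (𝕜 := ℝ) j).hasFDerivAt
    simp only [map_mul, MvPolynomial.eval_X]
    rw [fderiv_fun_mul (hd p x) hj.differentiableAt, hj.fderiv]
    simp only [_root_.add_apply, FunLike.coe_smul, Pi.smul_apply, hp, smul_eq_mul,
      MvPolynomial.pderiv_mul, MvPolynomial.pderiv_X, map_add, map_mul, MvPolynomial.eval_X,
      add_mul, Finset.sum_add_distrib]
    rw [add_comm, Finset.mul_sum]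
    congr 1
    · exact Finset.sum_congr rfl fun i _ => by ring
    · rw [Finset.sum_eq_single j]
      · simp
      · intro i _ hij
        simp [hij.symm]
      · simp

theorem H1.val_sub {D : Set Plane} (v w : H1 D) : H1.val (v - w) = H1.val v - H1.val w :=
  map_sub _ _ _

theorem H1.grad_sub {D : Set Plane} (v w : H1 D) : H1.grad (v - w) = H1.grad v - H1.grad w :=
  map_sub _ _ _

theorem H1.val_add {D : Set Plane} (v w : H1 D) : H1.val (v + w) = H1.val v + H1.val w :=
  map_add _ _ _

theorem H1.grad_add {D : Set Plane} (v w : H1 D) : H1.grad (v + w) = H1.grad v + H1.grad w :=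
  map_add _ _ _

theorem H1.val_zero {D : Set Plane} : H1.val (0 : H1 D) = 0 := map_zero _

theorem H1.grad_zero {D : Set Plane} : H1.grad (0 : H1 D) = 0 := map_zero _

section L2

variable {D : Set Plane} {F : Type} [NormedAddCommGroup F] {f g : L2 D F} {a b : Plane → F}

theorem L2.add_ae_eq (hf : f =ᵐ[volume.restrict D] a) (hg : g =ᵐ[volume.restrict D] b) :
    (f + g : L2 D F) =ᵐ[volume.restrict D] a + b :=
  (Lp.coeFn_add f g).trans (hf.add hg)

theorem L2.sub_ae_eq (hf : f =ᵐ[volume.restrict D] a) (hg : g =ᵐ[volume.restrict D] b) :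
    (f - g : L2 D F) =ᵐ[volume.restrict D] a - b :=
  (Lp.coeFn_sub f g).trans (hf.sub hg)

theorem L2.zero_ae_eq : ((0 : L2 D F) : Plane → F) =ᵐ[volume.restrict D] fun _ => 0 :=
  Lp.coeFn_zero F 2 (volume.restrict D)

end L2

section InnerProductSpace

variable {E : Type} [NormedAddCommGroup E] [InnerProductSpace ℝ E]

theorem norm_sub_le_of_inner_eq_zero {v q s : E} (h : inner ℝ (q - v) (q - s) = 0) :
    ‖v - q‖ ≤ ‖v - s‖ := by
  have h2 : ‖v - s‖ ^ 2 = ‖v - q‖ ^ 2 + ‖q - s‖ ^ 2 := by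
    rw [show v - s = (v - q) + (q - s) by abel, norm_add_sq_real, ← neg_sub q v, inner_neg_left, h]
    simp
  exact le_of_sq_le_sq (by nlinarith [sq_nonneg ‖q - s‖]) (norm_nonneg _)

theorem sub_eq_zero_of_inner_eq_zero {v a b : E} (ha : inner ℝ (a - v) (a - b) = 0)
    (hb : inner ℝ (b - v) (a - b) = 0) : a - b = 0 := by
  rw [← inner_self_eq_zero (𝕜 := ℝ)]
  nth_rewrite 1 [← sub_sub_sub_cancel_right a b v]
  rw [inner_sub_left, ha, hb, sub_zero]

theorem inner_sub_sub_eq_zero {a b c d e : E} (h₁ : inner ℝ (a - b) e = 0)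
    (h₂ : inner ℝ (c - d) e = 0) : inner ℝ ((a - c) - (b - d)) e = 0 := by
  rw [sub_sub_sub_comm, inner_sub_left, h₁, h₂, sub_zero]

theorem inner_zero_sub_sub {a b e : E} (h : inner ℝ (a - b) e = 0) :
    inner ℝ (0 - (b - a)) e = 0 := by
  rwa [zero_sub, neg_sub]

theorem inner_starProjection_sub_eq_zero (G : Submodule ℝ E) [G.HasOrthogonalProjection] (v : E)
    {r : E} (hr : r ∈ G) : inner ℝ (G.starProjection v - v) r = 0 := by
  have := G.starProjection_inner_eq_zero v r hr
  rw [← neg_sub, inner_neg_left, this, neg_zero]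

/-- Least squares over the image of a finite-dimensional space. -/
theorem exists_inner_map_sub_eq_zero {M : Type} [AddCommGroup M] [Module ℝ M] (f : M →ₗ[ℝ] E)
    (U : Submodule ℝ M) [FiniteDimensional ℝ U] (x : E) :
    ∃ q ∈ U, ∀ r ∈ U, inner ℝ (f q - x) (f r) = 0 := by
  obtain ⟨q, hq, hqx⟩ := Submodule.mem_map.1 ((U.map f).starProjection_apply_mem x)
  refine ⟨q, hq, fun r hr => ?_⟩
  rw [hqx]
  exact inner_starProjection_sub_eq_zero _ _ (Submodule.mem_map_of_mem hr)

end InnerProductSpace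

theorem H1.Represents.unique {D : Set Plane} {v w : H1 D} {φ : Plane → ℝ}
    (hv : H1.Represents v φ) (hw : H1.Represents w φ) : v = w :=
  Subtype.ext (Prod.ext (Lp.ext (hv.1.trans hw.1.symm)) (Lp.ext (hv.2.trans hw.2.symm)))

namespace Polygon

variable (K : Polygon)

theorem mem_polyH1_iff {ℓ : ℕ} {v : H1 K.carrier} :
    v ∈ K.polyH1 ℓ ↔ ∃ q : MvPolynomial (Fin 2) ℝ, q.totalDegree ≤ ℓ ∧
      H1.Represents v fun x => MvPolynomial.eval x q := by
  constructor
  · rintro ⟨q, rfl⟩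
    exact ⟨q.1, (MvPolynomial.mem_restrictTotalDegree _ _ _).1 q.2,
      H1.ofSmooth_represents K.isBounded (contDiff_eval q.1)⟩
  · rintro ⟨q, hq, h⟩
    exact ⟨⟨q, (MvPolynomial.mem_restrictTotalDegree _ _ _).2 hq⟩,
      (H1.ofSmooth_represents K.isBounded (contDiff_eval q)).unique h⟩

theorem exists_polyH1 {ℓ : ℕ} {q : MvPolynomial (Fin 2) ℝ} (hq : q.totalDegree ≤ ℓ) :
    ∃ v ∈ K.polyH1 ℓ, H1.Represents v fun x => MvPolynomial.eval x q := by
  have h := H1.ofSmooth_represents K.isBounded (contDiff_eval q)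
  exact ⟨_, K.mem_polyH1_iff.2 ⟨q, hq, h⟩, h⟩

theorem mem_polyL2_of_ae_eq {ℓ : ℕ} {q : MvPolynomial (Fin 2) ℝ} (hq : q.totalDegree ≤ ℓ)
    {g : L2 K.carrier ℝ} (hg : g =ᵐ[volume.restrict K.carrier] fun x => MvPolynomial.eval x q) :
    g ∈ K.polyL2 ℓ := by
  obtain ⟨v, hv, h⟩ := K.exists_polyH1 hq
  exact ⟨v, hv, Lp.ext (h.1.trans hg.symm)⟩

theorem mem_polyL2_of_const (ℓ : ℕ) (m : ℝ) (g : L2 K.carrier ℝ)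
    (hg : g =ᵐ[volume.restrict K.carrier] fun _ => m) : g ∈ K.polyL2 ℓ :=
  K.mem_polyL2_of_ae_eq (q := MvPolynomial.C m) (by simp) (by simpa using hg)

theorem gradient_eval (q : MvPolynomial (Fin 2) ℝ) (x : Plane) :
    gradient (fun x : Plane => MvPolynomial.eval x q) x =
      ∑ i, MvPolynomial.eval x (MvPolynomial.pderiv i q) • EuclideanSpace.single i (1 : ℝ) := by
  refine ext_inner_right ℝ fun e => ?_
  rw [gradient, InnerProductSpace.toDual_symm_apply, fderiv_eval, sum_inner]
  refine Finset.sum_congr rfl fun i _ => ?_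
  rw [real_inner_smul_left, EuclideanSpace.inner_single_left]
  simp

/-- The map `g ↦ g e_i` from `L²` to `L²` vector fields. -/
noncomputable def axisMap (D : Set Plane) (i : Fin 2) : L2 D ℝ →L[ℝ] L2 D Plane :=
  ContinuousLinearMap.compLpL 2 (volume.restrict D)
    (ContinuousLinearMap.toSpanSingleton ℝ (EuclideanSpace.single i (1 : ℝ)))

theorem coeFn_axisMap {D : Set Plane} (i : Fin 2) {g : L2 D ℝ} {φ : Plane → ℝ}
    (hg : g =ᵐ[volume.restrict D] φ) : axisMap D i g =ᵐ[volume.restrict D]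
      fun x => φ x • EuclideanSpace.single i (1 : ℝ) := by
  filter_upwards [ContinuousLinearMap.coeFn_compLpL (p := 2) (μ := volume.restrict D)
    (ContinuousLinearMap.toSpanSingleton ℝ (EuclideanSpace.single i (1 : ℝ))) g, hg] with x h1 h2
  rw [axisMap, h1, h2, ContinuousLinearMap.toSpanSingleton_apply]

theorem grad_mem_polyL2Vec {ℓ : ℕ} {v : H1 K.carrier} (hv : v ∈ K.polyH1 ℓ) :
    H1.grad v ∈ K.polyL2Vec (ℓ - 1) := by
  obtain ⟨q, hq, h⟩ := K.mem_polyH1_iff.1 hv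
  choose w hw hwr using fun i : Fin 2 =>
    K.exists_polyH1 (ℓ := ℓ - 1) (q := MvPolynomial.pderiv i q)
      ((totalDegree_pderiv_le i q).trans (by omega))
  have key : H1.grad v = axisMap K.carrier 0 (H1.val (w 0)) + axisMap K.carrier 1 (H1.val (w 1)) :=
    Lp.ext (h.2.trans (EventuallyEq.trans (ae_of_all _ fun x => by
      rw [gradient_eval, Fin.sum_univ_two]; rfl)
      (L2.add_ae_eq (coeFn_axisMap 0 (hwr 0).1) (coeFn_axisMap 1 (hwr 1).1)).symm))
  rw [key]
  exact Submodule.add_mem _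
    (Submodule.mem_iSup_of_mem 0 (Submodule.mem_map_of_mem (Submodule.mem_map_of_mem (hw 0))))
    (Submodule.mem_iSup_of_mem 1 (Submodule.mem_map_of_mem (Submodule.mem_map_of_mem (hw 1))))

theorem integrable_inner_gradient {D : Set Plane} (g : L2 D Plane) {φ : Plane → ℝ}
    (hφ : IsTestFunction D φ) :
    Integrable (fun x => inner ℝ (g x) (gradient φ x)) (volume.restrict D) := by
  have hm : MemLp (gradient φ) 2 (volume.restrict D) := by
    have := ((continuous_gradient hφ.smooth).memLp_of_hasCompactSupport (p := 2)
      (μ := (volume : Measure Plane)) ?_).restrict D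
    · exact this
    · exact (hφ.compact.fderiv ℝ).comp_left (by simp)
  refine (L2.integrable_inner (𝕜 := ℝ) g (hm.toLp _)).congr ?_
  filter_upwards [hm.coeFn_toLp] with x hx
  rw [hx]

theorem integrable_mul_test {D : Set Plane} (g : L2 D ℝ) {φ : Plane → ℝ}
    (hφ : IsTestFunction D φ) : Integrable (fun x => g x * φ x) (volume.restrict D) :=
  (Lp.memLp g).integrable_mul (hφ.memLp D)

/-- The weak divergence form `∫ g · ∇φ` of a vector field given by its components. -/
theorem integral_inner_gradient_eq {D : Set Plane} {g : L2 D Plane} {w : Fin 2 → L2 D ℝ}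
    {ψ : Fin 2 → Plane → ℝ} (hg : ∀ᵐ x ∂volume.restrict D, g x =
      ∑ i, ψ i x • EuclideanSpace.single i (1 : ℝ)) (hw : ∀ i, w i =ᵐ[volume.restrict D] ψ i)
    {φ : Plane → ℝ} (hφ : IsTestFunction D φ) :
    ∫ x in D, inner ℝ (g x) (gradient φ x) =
      ∑ i, ∫ x in D, w i x * fderiv ℝ φ x (EuclideanSpace.single i (1 : ℝ)) := by
  have hi : ∀ i ∈ Finset.univ, Integrable (fun x => w i x *
      fderiv ℝ φ x (EuclideanSpace.single i (1 : ℝ))) (volume.restrict D) := fun i _ =>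
    (Lp.memLp (w i)).integrable_mul (hφ.memLp_fderiv D _)
  rw [← integral_finsetSum _ hi]
  refine integral_congr_ae ?_
  filter_upwards [hg, hw 0, hw 1] with x h1 h2 h3
  rw [h1, sum_inner, Fin.sum_univ_two, Fin.sum_univ_two, h2, h3, real_inner_smul_left,
    real_inner_smul_left, real_inner_comm, real_inner_comm (gradient φ x)]
  simp only [gradient, InnerProductSpace.toDual_symm_apply]

theorem weak_derivative_eval {D : Set Plane} {w : H1 D} {q : MvPolynomial (Fin 2) ℝ}
    (hw : H1.Represents w fun x => MvPolynomial.eval x q) (i : Fin 2) {z : L2 D ℝ}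
    (hz : z =ᵐ[volume.restrict D] fun x => MvPolynomial.eval x (MvPolynomial.pderiv i q))
    {φ : Plane → ℝ} (hφ : IsTestFunction D φ) :
    ∫ x in D, H1.val w x * fderiv ℝ φ x (EuclideanSpace.single i (1 : ℝ)) =
      -∫ x in D, z x * φ x := by
  rw [H1.weak_gradient w hφ]
  congr 1
  refine integral_congr_ae ?_
  filter_upwards [hw.2, hz] with x h1 h2
  rw [h1, h2, gradient, InnerProductSpace.toDual_symm_apply, fderiv_eval]
  congr 1
  rw [Finset.sum_eq_single i]
  · simp
  · intro j _ hj
    simp [hj]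
  · simp

theorem integral_add_mul_test {D : Set Plane} (f g : L2 D ℝ) {φ : Plane → ℝ}
    (hφ : IsTestFunction D φ) : ∫ x in D, (f + g : L2 D ℝ) x * φ x =
      (∫ x in D, f x * φ x) + ∫ x in D, g x * φ x := by
  rw [← integral_add (integrable_mul_test f hφ) (integrable_mul_test g hφ)]
  refine integral_congr_ae ?_
  filter_upwards [Lp.coeFn_add f g] with x hx
  rw [hx, Pi.add_apply, add_mul]

theorem integral_sub_mul_test {D : Set Plane} (f g : L2 D ℝ) {φ : Plane → ℝ}
    (hφ : IsTestFunction D φ) : ∫ x in D, (f - g : L2 D ℝ) x * φ x =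
      (∫ x in D, f x * φ x) - ∫ x in D, g x * φ x := by
  rw [← integral_sub (integrable_mul_test f hφ) (integrable_mul_test g hφ)]
  refine integral_congr_ae ?_
  filter_upwards [Lp.coeFn_sub f g] with x hx
  rw [hx, Pi.sub_apply, sub_mul]

theorem integral_inner_sub_gradient {D : Set Plane} (f g : L2 D Plane) {φ : Plane → ℝ}
    (hφ : IsTestFunction D φ) : ∫ x in D, inner ℝ ((f - g : L2 D Plane) x) (gradient φ x) =
      (∫ x in D, inner ℝ (f x) (gradient φ x)) - ∫ x in D, inner ℝ (g x) (gradient φ x) := by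
  rw [← integral_sub (integrable_inner_gradient f hφ) (integrable_inner_gradient g hφ)]
  refine integral_congr_ae ?_
  filter_upwards [Lp.coeFn_sub f g] with x hx
  rw [hx, Pi.sub_apply, inner_sub_left]

/-- Green's formula for a polynomial and a test function. -/
theorem exists_laplacian_of_mem_polyH1 {ℓ : ℕ} {v : H1 K.carrier} (hv : v ∈ K.polyH1 ℓ) :
    ∃ q ∈ K.polyL2 (ℓ - 1), ∀ φ, IsTestFunction K.carrier φ →
      ∫ x in K.carrier, inner ℝ (H1.grad v x) (gradient φ x) =
        - ∫ x in K.carrier, q x * φ x := by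
  obtain ⟨q, hq, h⟩ := K.mem_polyH1_iff.1 hv
  have hdeg : ∀ i, (MvPolynomial.pderiv i q).totalDegree ≤ ℓ - 1 := fun i =>
    (totalDegree_pderiv_le i q).trans (by omega)
  choose w hw hwr using fun i : Fin 2 => K.exists_polyH1 (hdeg i)
  choose z hz hzr using fun i : Fin 2 => K.exists_polyH1 (ℓ := ℓ - 1)
    (q := MvPolynomial.pderiv i (MvPolynomial.pderiv i q))
    ((totalDegree_pderiv_le i _).trans ((Nat.sub_le _ _).trans (hdeg i)))
  refine ⟨H1.val (z 0) + H1.val (z 1), Submodule.add_mem _ (Submodule.mem_map_of_mem (hz 0))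
    (Submodule.mem_map_of_mem (hz 1)), fun φ hφ => ?_⟩
  have hg : ∀ᵐ x ∂volume.restrict K.carrier, H1.grad v x =
      ∑ i, MvPolynomial.eval x (MvPolynomial.pderiv i q) • EuclideanSpace.single i (1 : ℝ) :=
    h.2.trans (ae_of_all _ fun x => gradient_eval q x)
  have e0 := weak_derivative_eval (hwr 0) 0 (hzr 0).1 hφ
  have e1 := weak_derivative_eval (hwr 1) 1 (hzr 1).1 hφ
  have e2 := integral_inner_gradient_eq hg (fun i => (hwr i).1) hφ
  have e3 := integral_add_mul_test (H1.val (z 0)) (H1.val (z 1)) hφ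
  rw [Fin.sum_univ_two] at e2
  linarith

/-! ### The local virtual element space is a vector space that contains the polynomials -/

/-- The restriction of a polynomial to an edge is the composition with the affine parametrization,
and its Laplacian is a polynomial of lower degree. -/
theorem isAuxVirtual_of_mem_polyH1 {p : ℕ} {v : H1 K.carrier} (hv : v ∈ K.polyH1 p) :
    K.IsAuxVirtual p v := by
  refine ⟨?_, K.exists_laplacian_of_mem_polyH1 hv⟩
  obtain ⟨q, hq, h⟩ := K.mem_polyH1_iff.1 hv
  refine ⟨_, (contDiff_eval q).continuous.continuousOn, h.1, fun i => ?_⟩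
  set A := K.vertex i
  set B := K.vertex (finRotate K.n i)
  let f : Fin 2 → Polynomial ℝ := fun j => Polynomial.C (B j - A j) * Polynomial.X +
    Polynomial.C (A j)
  refine ⟨MvPolynomial.aeval f q, ?_, fun t _ => ?_⟩
  · have := MvPolynomial.aeval_natDegree_le q hq f (n := 1) fun j =>
      Polynomial.natDegree_linear_le
    simpa using this
  · have h1 : Polynomial.eval t (MvPolynomial.aeval f q) =
        MvPolynomial.eval (fun j => Polynomial.eval t (f j)) q := by
      rw [MvPolynomial.aeval_def, ← Polynomial.coe_evalRingHom, MvPolynomial.hom_eval₂]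
      rw [MvPolynomial.eval, MvPolynomial.coe_eval₂Hom]
      congr 1
      ext a
      simp
    rw [h1]
    congr 2
    ext j
    simp [f, edgePoint, AffineMap.lineMap_apply_module', A, B]
    ring

theorem IsAuxVirtual.sub {K : Polygon} {p : ℕ} {v w : H1 K.carrier} (hv : K.IsAuxVirtual p v)
    (hw : K.IsAuxVirtual p w) : K.IsAuxVirtual p (v - w) := by
  obtain ⟨⟨a, ha, hva, ra⟩, qa, hqa, la⟩ := hv
  obtain ⟨⟨b, hb, hwb, rb⟩, qb, hqb, lb⟩ := hw
  refine ⟨⟨a - b, ha.sub hb, ?_, fun i => ?_⟩, qa - qb, Submodule.sub_mem _ hqa hqb,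
    fun φ hφ => ?_⟩
  · rw [H1.val_sub v w]
    exact L2.sub_ae_eq hva hwb
  · obtain ⟨r, hr, hra⟩ := ra i
    obtain ⟨s, hs, hsb⟩ := rb i
    refine ⟨r - s, (Polynomial.natDegree_sub_le _ _).trans (max_le hr hs), fun t ht => ?_⟩
    rw [Pi.sub_apply, hra t ht, hsb t ht, Polynomial.eval_sub]
  · rw [H1.grad_sub v w, integral_inner_sub_gradient _ _ hφ, integral_sub_mul_test _ _ hφ, la φ hφ,
      lb φ hφ]
    ring

/-! ### The projection `Π^∇` on the virtual element space -/

theorem exists_polyH1_grad_orthogonal (ℓ : ℕ) (v : H1 K.carrier) : ∃ q ∈ K.polyH1 ℓ,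
    ∀ r ∈ K.polyH1 ℓ, inner ℝ (H1.grad q - H1.grad v) (H1.grad r) = 0 :=
  exists_inner_map_sub_eq_zero H1.grad (K.polyH1 ℓ) (H1.grad v)

section StarShaped

variable {K} {c : Plane} {r : ℝ}

/-- `Π^∇_ℓ v` exists for `v` in the auxiliary space, because a function that is continuous up to the
boundary has a trace. -/
theorem exists_isProjGrad (h : IsStarShapedBall K.carrier c r) {p : ℕ} (ℓ : ℕ) {v : H1 K.carrier}
    (hv : K.IsAuxVirtual p v) : ∃ q, K.IsProjGrad ℓ v q := by
  obtain ⟨⟨w, hw, hvw, -⟩, -⟩ := hv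
  -- a continuous extension of the boundary values to the plane
  obtain ⟨W, hW⟩ := ContinuousMap.exists_restrict_eq (isClosed_closure (s := K.carrier))
    (⟨Set.domRestrict (closure K.carrier) w, continuousOn_iff_continuous_domRestrict.1 hw⟩)
  have hvW : H1.val v =ᵐ[volume.restrict K.carrier] W := by
    filter_upwards [hvw, ae_restrict_mem K.isOpen.measurableSet] with x hx hxK
    rw [hx]
    exact (DFunLike.congr_fun hW ⟨x, subset_closure hxK⟩).symm
  obtain ⟨q, hq, horth⟩ := K.exists_polyH1_grad_orthogonal ℓ v
  obtain ⟨Q, hQ, hqQ⟩ := K.mem_polyH1_iff.1 hq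
  -- the gradient conditions determine `q` up to the constant `m / L` that fixes the boundary mean
  obtain ⟨m, hm⟩ : ∃ m, m = ∫ x, (W x - MvPolynomial.eval x Q) ∂K.boundaryMeasure := ⟨_, rfl⟩
  obtain ⟨L, hLdef⟩ : ∃ L, L = ∫ _, (1 : ℝ) ∂K.boundaryMeasure := ⟨_, rfl⟩
  have hL : L ≠ 0 := hLdef ▸ K.integral_boundary_const_ne_zero one_ne_zero
  obtain ⟨z, hz, hzr⟩ := K.exists_polyH1 (ℓ := ℓ) (q := MvPolynomial.C (m / L)) (by simp)
  have hzg : H1.grad z = 0 := by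
    refine Lp.ext (hzr.2.trans (EventuallyEq.trans (ae_of_all _ fun x => ?_) L2.zero_ae_eq.symm))
    rw [gradient_eval]
    simp
  refine ⟨q + z, Submodule.add_mem _ hq hz, fun r hr => ?_, (W : Plane → ℝ) -
    ((fun x : Plane => MvPolynomial.eval x Q) + fun x : Plane =>
      MvPolynomial.eval x (MvPolynomial.C (m / L))), ?_, ?_⟩
  · rw [H1.grad_add q z, hzg, add_zero]
    exact horth r hr
  · refine hasTrace_of_continuous h (W.continuous.sub ((contDiff_eval Q).continuous.add
      (contDiff_eval _).continuous)) ?_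
    rw [H1.val_sub v (q + z), H1.val_add q z]
    exact L2.sub_ae_eq hvW (L2.add_ae_eq hqQ.1 hzr.1)
  · have hi : Integrable (fun x : Plane => W x - MvPolynomial.eval x Q) K.boundaryMeasure :=
      (K.memLp_boundary (W.continuous.sub (contDiff_eval Q).continuous) 1).integrable le_rfl
    simp only [Pi.sub_apply, Pi.add_apply, MvPolynomial.eval_C, ← sub_sub]
    rw [integral_sub hi (integrable_const _)]
    have : ∫ _, m / L ∂K.boundaryMeasure = m / L * L := by
      rw [hLdef, ← integral_const_mul, mul_one]
    rw [← hm, this, div_mul_cancel₀ _ hL, sub_self]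

theorem represents_zero (D : Set Plane) : H1.Represents (0 : H1 D) fun _ => 0 := by
  constructor
  · rw [H1.val_zero]
    exact L2.zero_ae_eq
  · rw [H1.grad_zero]
    refine L2.zero_ae_eq.trans (ae_of_all _ fun x => ?_)
    simp [gradient]

/-- By the Poincaré inequality, a function with vanishing weak gradient equals its projection onto
the constants. -/
theorem eq_const_of_grad_eq_zero (h : IsStarShapedBall K.carrier c r) {z : H1 K.carrier}
    (hz : H1.grad z = 0) : ∃ m : ℝ, H1.Represents z fun _ => m := by
  have hP := norm_sub_starProjection_le h (K.polyL2 0) (K.mem_polyL2_of_const 0) z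
  rw [hz, norm_zero, mul_zero, norm_le_zero_iff, sub_eq_zero] at hP
  have hmem := (K.polyL2 0).starProjection_apply_mem (H1.val z)
  rw [← hP] at hmem
  obtain ⟨w, hw, hwz⟩ := Submodule.mem_map.1 hmem
  obtain ⟨q, hq, hqr⟩ := K.mem_polyH1_iff.1 hw
  obtain ⟨m, hm⟩ : ∃ m, q = MvPolynomial.C m :=
    ⟨_, MvPolynomial.totalDegree_eq_zero_iff_eq_C.1 (Nat.le_zero.1 hq)⟩
  refine ⟨m, ?_, ?_⟩
  · rw [← hwz]
    refine hqr.1.trans (ae_of_all _ fun x => ?_)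
    simp only [hm, MvPolynomial.eval_C]
  · rw [hz]
    refine L2.zero_ae_eq.trans (ae_of_all _ fun x => ?_)
    simp [gradient]

theorem IsProjGrad.unique (h : IsStarShapedBall K.carrier c r) {ℓ : ℕ} {v q q' : H1 K.carrier}
    (hq : K.IsProjGrad ℓ v q) (hq' : K.IsProjGrad ℓ v q') : q = q' := by
  obtain ⟨a1, a2, g, a3, a4⟩ := hq
  obtain ⟨b1, b2, g', b3, b4⟩ := hq'
  have hgrad : H1.grad (q - q') = 0 := by
    have h1 := a2 _ (Submodule.sub_mem _ a1 b1)
    have h2 := b2 _ (Submodule.sub_mem _ a1 b1)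
    rw [H1.grad_sub q q'] at h1 h2 ⊢
    exact sub_eq_zero_of_inner_eq_zero h1 h2
  obtain ⟨m, hm⟩ := eq_const_of_grad_eq_zero h hgrad
  -- `q - q'` is a constant `m`, and `0 = (v - q') - (v - q) - (q - q')` has the trace `g' - g - m`
  have hT := (b3.sub a3).sub (hasTrace_of_represents contDiff_const hm)
  rw [show v - q' - (v - q) - (q - q') = 0 by abel] at hT
  have hI := HasTrace.integral_eq_zero h hT
  have i1 : Integrable g K.boundaryMeasure := a3.1.integrable (by norm_num)
  have i2 : Integrable g' K.boundaryMeasure := b3.1.integrable (by norm_num)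
  have : ∫ x, (g' - g - (fun _ => m : Plane → ℝ)) x ∂K.boundaryMeasure =
      -∫ _, m ∂K.boundaryMeasure := by
    simp only [Pi.sub_apply]
    have i3 : Integrable (fun x => g' x - g x) K.boundaryMeasure := i2.sub i1
    rw [integral_sub i3 (integrable_const m), integral_sub i2 i1, a4, b4]
    ring
  rw [this, neg_eq_zero] at hI
  have hm0 : m = 0 := by_contra fun hne => K.integral_boundary_const_ne_zero hne hI
  exact sub_eq_zero.1 (hm.unique (by rw [hm0]; exact represents_zero K.carrier))

theorem IsProjGrad.sub {ℓ : ℕ} {v w q s : H1 K.carrier} (hv : K.IsProjGrad ℓ v q)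
    (hw : K.IsProjGrad ℓ w s) : K.IsProjGrad ℓ (v - w) (q - s) := by
  obtain ⟨a1, a2, g, a3, a4⟩ := hv
  obtain ⟨b1, b2, g', b3, b4⟩ := hw
  refine ⟨Submodule.sub_mem _ a1 b1, fun r hr => ?_, g - g', ?_, ?_⟩
  · rw [H1.grad_sub q s, H1.grad_sub v w]
    exact inner_sub_sub_eq_zero (a2 r hr) (b2 r hr)
  · rw [sub_sub_sub_comm]
    exact a3.sub b3
  · simp only [Pi.sub_apply]
    rw [integral_sub (a3.1.integrable (by norm_num)) (b3.1.integrable (by norm_num)), a4, b4,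
      sub_zero]

theorem IsProjGrad.self_sub {ℓ : ℕ} {v q : H1 K.carrier} (hv : K.IsProjGrad ℓ v q) :
    K.IsProjGrad ℓ (v - q) 0 := by
  obtain ⟨-, a2, g, a3, a4⟩ := hv
  refine ⟨Submodule.zero_mem _, fun r hr => ?_, g, by rwa [sub_zero], a4⟩
  rw [H1.grad_zero, H1.grad_sub v q]
  exact inner_zero_sub_sub (a2 r hr)

theorem IsProjGrad.projGrad_eq (h : IsStarShapedBall K.carrier c r) {ℓ : ℕ} {v q : H1 K.carrier}
    (hq : K.IsProjGrad ℓ v q) : K.projGrad ℓ v = q := by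
  have hex : ∃ q, K.IsProjGrad ℓ v q := ⟨q, hq⟩
  rw [projGrad, dif_pos hex]
  exact IsProjGrad.unique h hex.choose_spec hq

theorem isProjGrad_projGrad (h : IsStarShapedBall K.carrier c r) {p : ℕ} (ℓ : ℕ)
    {v : H1 K.carrier} (hv : K.IsAuxVirtual p v) : K.IsProjGrad ℓ v (K.projGrad ℓ v) := by
  obtain ⟨q, hq⟩ := exists_isProjGrad h ℓ hv
  rwa [hq.projGrad_eq h]

theorem projGrad_sub (h : IsStarShapedBall K.carrier c r) {p : ℕ} (ℓ : ℕ) {v w : H1 K.carrier}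
    (hv : K.IsAuxVirtual p v) (hw : K.IsAuxVirtual p w) :
    K.projGrad ℓ (v - w) = K.projGrad ℓ v - K.projGrad ℓ w :=
  ((isProjGrad_projGrad h ℓ hv).sub (isProjGrad_projGrad h ℓ hw)).projGrad_eq h

theorem sub_mem_localSpace (h : IsStarShapedBall K.carrier c r) {p : ℕ} {v w : H1 K.carrier}
    (hv : v ∈ K.localSpace p) (hw : w ∈ K.localSpace p) : v - w ∈ K.localSpace p := by
  refine ⟨hv.1.sub hw.1, fun m hm horth => ?_⟩
  have h1 := hv.2 m hm horth
  have h2 := hw.2 m hm horth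
  rw [H1.val_sub] at h1 h2
  rw [projGrad_sub h p hv.1 hw.1, H1.val_sub (v - w), H1.val_sub v w, H1.val_sub (K.projGrad p v)]
  exact inner_sub_sub_eq_zero h1 h2

theorem sub_projGrad_mem_localSpace (h : IsStarShapedBall K.carrier c r) {p : ℕ}
    {v : H1 K.carrier} (hv : v ∈ K.localSpace p) : v - K.projGrad p v ∈ K.localSpace p := by
  have hP := isProjGrad_projGrad h p hv.1
  refine ⟨hv.1.sub (K.isAuxVirtual_of_mem_polyH1 hP.1), fun m hm horth => ?_⟩
  rw [hP.self_sub.projGrad_eq h, sub_zero]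
  exact hv.2 m hm horth

end StarShaped

/-- Whether or not the defining equations of `Π^∇_ℓ v` are solvable, `Π^∇_ℓ v` is a polynomial. -/
theorem projGrad_mem (ℓ : ℕ) (v : H1 K.carrier) : K.projGrad ℓ v ∈ K.polyH1 ℓ := by
  unfold projGrad
  split_ifs with h
  · exact h.choose_spec.1
  · exact Submodule.zero_mem _

/-- This holds also where `Π^∇_ℓ v` takes its default value `0`. -/
theorem norm_grad_sub_projGrad_le (ℓ : ℕ) (v : H1 K.carrier) :
    ‖H1.grad (v - K.projGrad ℓ v)‖ ≤ ‖H1.grad v‖ := by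
  unfold projGrad
  split_ifs with h
  · have h1 := h.choose_spec.2.1 _ h.choose_spec.1
    rw [H1.grad_sub v h.choose]
    have := norm_sub_le_of_inner_eq_zero (v := H1.grad v) (q := H1.grad h.choose) (s := 0)
      (by rwa [sub_zero])
    rwa [sub_zero] at this
  · rw [sub_zero]

/-- `Π^∇_ℓ v` is a best approximation of `v` in the `H¹` seminorm. -/
theorem IsProjGrad.norm_grad_sub_le {K : Polygon} {ℓ : ℕ} {v q : H1 K.carrier}
    (hq : K.IsProjGrad ℓ v q) {s : H1 K.carrier} (hs : s ∈ K.polyH1 ℓ) :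
    ‖H1.grad (v - q)‖ ≤ ‖H1.grad (v - s)‖ := by
  have h1 := hq.2.1 _ (Submodule.sub_mem _ hq.1 hs)
  rw [H1.grad_sub q s] at h1
  rw [H1.grad_sub v q, H1.grad_sub v s]
  exact norm_sub_le_of_inner_eq_zero h1

end Polygon

/-! ### Integration over a mesh -/

/-- A segment lies in a line. -/
theorem volume_segment (a b : Plane) : volume (segment ℝ a b) = 0 := by
  have hne : affineSpan ℝ ({a, b} : Set Plane) ≠ ⊤ := by
    intro h
    have h1 : vectorSpan ℝ ({a, b} : Set Plane) = ⊤ := by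
      rw [← direction_affineSpan, h, AffineSubspace.direction_top]
    have h2 := collinear_iff_finrank_le_one.1 (collinear_pair ℝ a b)
    rw [h1, finrank_top, finrank_euclideanSpace_fin] at h2
    omega
  refine measure_mono_null ?_ (Measure.addHaar_affineSubspace volume _ hne)
  rw [segment_eq_image_lineMap]
  rintro _ ⟨t, -, rfl⟩
  exact AffineMap.lineMap_mem_affineSpan_pair t a b

theorem Polygon.volume_frontier (K : Polygon) : volume (frontier K.carrier) = 0 := by
  rw [K.frontier_eq]
  exact measure_iUnion_null fun i => volume_segment _ _

namespace Mesh

variable {Ω : Set Plane} (T : Mesh Ω)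

/-- The elements cover `Ω` up to their boundaries, which are null sets. -/
theorem ae_eq_iUnion : (⋃ i, (T.elem i).carrier) =ᵐ[volume] Ω := by
  refine (Set.iUnion_subset T.subset).eventuallyLE.antisymm ?_
  have hnull : volume (⋃ i, frontier (T.elem i).carrier) = 0 :=
    measure_iUnion_null fun i => (T.elem i).volume_frontier
  filter_upwards [compl_mem_ae_iff.2 hnull] with x hx hxΩ
  have h1 : x ∈ ⋃ i, closure (T.elem i).carrier := T.cover ▸ subset_closure hxΩ
  obtain ⟨i, hi⟩ := Set.mem_iUnion.1 h1
  refine Set.mem_iUnion.2 ⟨i, by_contra fun hxi => hx (Set.mem_iUnion.2 ⟨i, hi, ?_⟩)⟩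
  rwa [(T.elem i).isOpen.interior_eq]

/-- `L²` inner products are sums of their contributions from the elements. -/
theorem sum_inner_restrict {F : Type} [NormedAddCommGroup F] [InnerProductSpace ℝ F]
    (a b : L2 Ω F) :
    ∑ i, inner ℝ (restrictL2 (T.subset i) a) (restrictL2 (T.subset i) b) = inner ℝ a b := by
  have hi : IntegrableOn (fun x => inner ℝ (a x) (b x)) Ω := L2.integrable_inner (𝕜 := ℝ) a b
  rw [L2.inner_def, ← setIntegral_congr_set T.ae_eq_iUnion,
    integral_iUnion_fintype (fun i => (T.elem i).isOpen.measurableSet)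
      (fun i j hij => T.disjoint i j hij) fun i => hi.mono_set (T.subset i)]
  refine Finset.sum_congr rfl fun i _ => ?_
  rw [L2.inner_def]
  refine integral_congr_ae ?_
  filter_upwards [coeFn_restrictL2 (T.subset i) a, coeFn_restrictL2 (T.subset i) b] with x h1 h2
  rw [h1, h2]

theorem sum_norm_restrict_sq {F : Type} [NormedAddCommGroup F] [InnerProductSpace ℝ F]
    (a : L2 Ω F) : ∑ i, ‖restrictL2 (T.subset i) a‖ ^ 2 = ‖a‖ ^ 2 := by
  rw [← real_inner_self_eq_norm_sq, ← T.sum_inner_restrict a a]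
  exact Finset.sum_congr rfl fun i _ => (real_inner_self_eq_norm_sq _).symm

theorem sqrt_sum_norm_restrict_sq {F : Type} [NormedAddCommGroup F] [InnerProductSpace ℝ F]
    (a : L2 Ω F) : √(∑ i, ‖restrictL2 (T.subset i) a‖ ^ 2) = ‖a‖ := by
  rw [T.sum_norm_restrict_sq a, Real.sqrt_sq (norm_nonneg a)]

end Mesh

/-! ### Multiplication by the coefficients -/

section Coefficients

variable {Ω A : Set Plane} {kLo kHi νLo νHi : ℝ}

theorem DiffusionTensor.coeFn_mul (k : DiffusionTensor Ω kLo kHi) (h : A ⊆ Ω) (g : L2 A Plane) :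
    k.mul h g =ᵐ[volume.restrict A] fun x => Matrix.toEuclideanLin (k.toFun x) (g x) :=
  (k.memLp h g).coeFn_toLp

theorem Potential.coeFn_mul (V : Potential Ω νLo νHi) (h : A ⊆ Ω) (v : L2 A ℝ) :
    V.mul h v =ᵐ[volume.restrict A] fun x => V.toFun x * v x :=
  (V.memLp h v).coeFn_toLp

theorem DiffusionTensor.mul_sub (k : DiffusionTensor Ω kLo kHi) (h : A ⊆ Ω) (g g' : L2 A Plane) :
    k.mul h (g - g') = k.mul h g - k.mul h g' := by
  refine Lp.ext ?_
  filter_upwards [k.coeFn_mul h (g - g'), Lp.coeFn_sub g g', Lp.coeFn_sub (k.mul h g) (k.mul h g'),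
    k.coeFn_mul h g, k.coeFn_mul h g'] with x h1 h2 h3 h4 h5
  rw [h1, h2, h3, Pi.sub_apply, Pi.sub_apply, h4, h5]
  exact map_sub (Matrix.toEuclideanLin (k.toFun x)) _ _

theorem Potential.mul_sub (V : Potential Ω νLo νHi) (h : A ⊆ Ω) (v v' : L2 A ℝ) :
    V.mul h (v - v') = V.mul h v - V.mul h v' := by
  refine Lp.ext ?_
  filter_upwards [V.coeFn_mul h (v - v'), Lp.coeFn_sub v v', Lp.coeFn_sub (V.mul h v) (V.mul h v'),
    V.coeFn_mul h v, V.coeFn_mul h v'] with x h1 h2 h3 h4 h5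
  rw [h1, h2, h3, Pi.sub_apply, Pi.sub_apply, h4, h5, _root_.mul_sub]

theorem DiffusionTensor.mul_restrict (k : DiffusionTensor Ω kLo kHi) (h : A ⊆ Ω)
    (g : L2 Ω Plane) : k.mul h (restrictL2 h g) = restrictL2 h (k.mul subset_rfl g) := by
  refine Lp.ext ?_
  filter_upwards [k.coeFn_mul h (restrictL2 h g), coeFn_restrictL2 h g,
    coeFn_restrictL2 h (k.mul subset_rfl g),
    ae_mono (Measure.restrict_mono h le_rfl) (k.coeFn_mul subset_rfl g)] with x h1 h2 h3 h4
  rw [h1, h2, h3, h4]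

theorem Potential.mul_restrict (V : Potential Ω νLo νHi) (h : A ⊆ Ω) (v : L2 Ω ℝ) :
    V.mul h (restrictL2 h v) = restrictL2 h (V.mul subset_rfl v) := by
  refine Lp.ext ?_
  filter_upwards [V.coeFn_mul h (restrictL2 h v), coeFn_restrictL2 h v,
    coeFn_restrictL2 h (V.mul subset_rfl v),
    ae_mono (Measure.restrict_mono h le_rfl) (V.coeFn_mul subset_rfl v)] with x h1 h2 h3 h4
  rw [h1, h2, h3, h4]

theorem DiffusionTensor.norm_mul_le (k : DiffusionTensor Ω kLo kHi) (hk : 0 ≤ kLo) (h : A ⊆ Ω)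
    (g : L2 A Plane) : ‖k.mul h g‖ ≤ kHi * ‖g‖ := by
  have hle := Measure.restrict_mono (μ := volume) h le_rfl
  refine Lp.norm_le_mul_norm_of_ae_le_mul ?_
  filter_upwards [k.coeFn_mul h g, ae_mono hle k.symm, ae_mono hle k.lower,
    ae_mono hle k.upper] with x h1 h2 h3 h4
  rw [h1]
  refine norm_toEuclideanLin_le h2 (fun ξ => ?_) _
  rw [abs_of_nonneg ((by positivity : 0 ≤ kLo * ‖ξ‖ ^ 2).trans (h3 ξ))]
  exact h4 ξ

theorem Potential.norm_mul_le (V : Potential Ω νLo νHi) (hν : 0 ≤ νLo) (h : A ⊆ Ω)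
    (v : L2 A ℝ) : ‖V.mul h v‖ ≤ νHi * ‖v‖ := by
  have hle := Measure.restrict_mono (μ := volume) h le_rfl
  refine Lp.norm_le_mul_norm_of_ae_le_mul ?_
  filter_upwards [V.coeFn_mul h v, ae_mono hle V.lower, ae_mono hle V.upper] with x h1 h2 h3
  rw [h1, norm_mul, Real.norm_of_nonneg (hν.trans h2)]
  exact mul_le_mul_of_nonneg_right h3 (norm_nonneg _)

theorem DiffusionTensor.le_inner_mul (k : DiffusionTensor Ω kLo kHi) (h : A ⊆ Ω)
    (g : L2 A Plane) : kLo * ‖g‖ ^ 2 ≤ inner ℝ (k.mul h g) g := by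
  have hle := Measure.restrict_mono (μ := volume) h le_rfl
  rw [← real_inner_self_eq_norm_sq, L2.inner_def, L2.inner_def, ← integral_const_mul]
  refine integral_mono_ae ((L2.integrable_inner (𝕜 := ℝ) g g).const_mul kLo)
    (L2.integrable_inner (𝕜 := ℝ) (k.mul h g) g) ?_
  filter_upwards [k.coeFn_mul h g, ae_mono hle k.lower] with x h1 h2
  rw [h1, real_inner_self_eq_norm_sq]
  exact h2 _

theorem Potential.inner_mul_nonneg (V : Potential Ω νLo νHi) (hν : 0 ≤ νLo) (h : A ⊆ Ω)
    (v : L2 A ℝ) : 0 ≤ inner ℝ (V.mul h v) v := by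
  have hle := Measure.restrict_mono (μ := volume) h le_rfl
  rw [L2.inner_def]
  refine integral_nonneg_of_ae ?_
  filter_upwards [V.coeFn_mul h v, ae_mono hle V.lower] with x h1 h2
  rw [h1]
  have : inner ℝ (V.toFun x * v x) (v x) = V.toFun x * (v x) ^ 2 := by
    simp only [RCLike.inner_apply, conj_trivial]
    ring
  rw [this]
  have := hν.trans h2
  positivity

/-- On a nonempty open set, the bounds on the potential are consistent. -/
theorem Potential.upper_nonneg (V : Potential Ω νLo νHi) (hν : 0 ≤ νLo) (hΩ : IsOpen Ω)
    (hne : Ω.Nonempty) : 0 ≤ νHi := by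
  have hpos : volume.restrict Ω ≠ 0 := by
    rw [Ne, Measure.restrict_eq_zero]
    exact (hΩ.measure_pos volume hne).ne'
  have := ae_neBot.2 hpos
  obtain ⟨x, h1, h2⟩ := (V.lower.and V.upper).exists
  exact hν.trans (h1.trans h2)

end Coefficients

/-! ### Stabilization forms -/

/-- The Cauchy–Schwarz inequality for a form that is symmetric and nonnegative on a subspace. -/
theorem sq_apply_le_of_subspace {M : Type} [AddCommGroup M] [Module ℝ M]
    (S : LinearMap.BilinForm ℝ M) (N : Submodule ℝ M)
    (hsymm : ∀ v ∈ N, ∀ w ∈ N, S v w = S w v) (hnonneg : ∀ v ∈ N, 0 ≤ S v v) {v w : M}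
    (hv : v ∈ N) (hw : w ∈ N) : S v w ^ 2 ≤ S v v * S w w :=
  LinearMap.BilinForm.apply_sq_le_of_symm (S.restrict N) (fun x => hnonneg x x.2)
    ⟨fun x y => hsymm x x.2 y y.2⟩ ⟨v, hv⟩ ⟨w, hw⟩

/-- The form in which the Cauchy–Schwarz inequality is applied to the stabilizations. -/
theorem abs_apply_le_of_subspace {M : Type} [AddCommGroup M] [Module ℝ M]
    (S : LinearMap.BilinForm ℝ M) (N : Submodule ℝ M)
    (hsymm : ∀ v ∈ N, ∀ w ∈ N, S v w = S w v) (hnonneg : ∀ v ∈ N, 0 ≤ S v v) {v w : M}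
    (hv : v ∈ N) (hw : w ∈ N) {C a b : ℝ} (hC : 0 ≤ C) (ha : 0 ≤ a) (hb : 0 ≤ b)
    (hva : S v v ≤ C * a ^ 2) (hwb : S w w ≤ C * b ^ 2) : |S v w| ≤ C * a * b := by
  refine abs_le_of_sq_le_sq ?_ (by positivity)
  calc S v w ^ 2 ≤ S v v * S w w := sq_apply_le_of_subspace S N hsymm hnonneg hv hw
    _ ≤ (C * a ^ 2) * (C * b ^ 2) := mul_le_mul hva hwb (hnonneg w hw) (by positivity)
    _ = (C * a * b) ^ 2 := by ring

theorem H1.Represents.const_smul {D : Set Plane} {v : H1 D} {φ : Plane → ℝ} (c : ℝ)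
    (hφ : ContDiff ℝ ∞ φ) (hv : H1.Represents v φ) : H1.Represents (c • v) (c • φ) := by
  constructor
  · exact (Lp.coeFn_smul c (H1.val v)).trans (hv.1.const_smul c)
  · refine ((Lp.coeFn_smul c (H1.grad v)).trans (hv.2.const_smul c)).trans (ae_of_all _ fun x => ?_)
    simp only [Pi.smul_apply, gradient]
    rw [fderiv_const_smul (hφ.differentiable (by simp) x), map_smul]

namespace Polygon

variable (K : Polygon)

theorem HasTrace.const_smul {K : Polygon} {v : H1 K.carrier} {g : Plane → ℝ} (c : ℝ)
    (hv : K.HasTrace v g) : K.HasTrace (c • v) (c • g) := by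
  obtain ⟨hg, φ, a, hφ, ha, hla⟩ := hv
  refine ⟨hg.const_smul c, fun j => c • φ j, fun j => c • a j, fun j =>
    ⟨(hφ j).1.const_smul c, (hφ j).2.const_smul c (hφ j).1⟩, ha.const_smul c, ?_⟩
  simp only [← smul_sub, eLpNorm_const_smul]
  have := ENNReal.Tendsto.const_mul (a := ‖c‖ₑ) hla (Or.inr (by simp))
  rwa [mul_zero] at this

theorem inner_sub_add_eq_zero {E : Type} [NormedAddCommGroup E] [InnerProductSpace ℝ E]
    {z a b e : E} (hz : z = 0) (ha : inner ℝ (z - a) e = 0) (hb : inner ℝ (z - b) e = 0) :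
    inner ℝ (z - (a + b)) e = 0 := by
  subst hz
  rw [show (0 : E) - (a + b) = (0 - a) + (0 - b) by abel, inner_add_left, ha, hb, add_zero]

theorem inner_sub_smul_eq_zero {E : Type} [NormedAddCommGroup E] [InnerProductSpace ℝ E]
    {z a e : E} (hz : z = 0) (c : ℝ) (ha : inner ℝ (z - a) e = 0) :
    inner ℝ (z - c • a) e = 0 := by
  subst hz
  rw [show (0 : E) - c • a = c • (0 - a) by simp, real_inner_smul_left, ha, mul_zero]

theorem HasTrace.add {K : Polygon} {v w : H1 K.carrier} {g k : Plane → ℝ} (hv : K.HasTrace v g)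
    (hw : K.HasTrace w k) : K.HasTrace (v + w) (g + k) := by
  have h := hv.sub (hw.const_smul (-1))
  have e1 : v - (-1 : ℝ) • w = v + w := by module
  have e2 : g - (-1 : ℝ) • k = g + k := by module
  rwa [e1, e2] at h

theorem isProjGrad_zero_zero (ℓ : ℕ) : K.IsProjGrad ℓ 0 0 := by
  refine ⟨Submodule.zero_mem _, fun r _ => ?_, fun _ => 0, ?_, by simp⟩
  · rw [sub_self (H1.grad (0 : H1 K.carrier)), inner_zero_left]
  · rw [sub_self (0 : H1 K.carrier)]
    exact hasTrace_of_represents contDiff_const (represents_zero K.carrier)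

theorem IsProjGrad.add_zero {K : Polygon} {ℓ : ℕ} {v w : H1 K.carrier} (hv : K.IsProjGrad ℓ v 0)
    (hw : K.IsProjGrad ℓ w 0) : K.IsProjGrad ℓ (v + w) 0 := by
  obtain ⟨h1, h2, g, h3, h4⟩ := hv
  obtain ⟨-, h5, k, h6, h7⟩ := hw
  refine ⟨h1, fun r hr => ?_, g + k, ?_, ?_⟩
  · rw [H1.grad_add v w]
    exact inner_sub_add_eq_zero H1.grad_zero (h2 r hr) (h5 r hr)
  · rw [sub_zero v] at h3
    rw [sub_zero w] at h6
    rw [sub_zero (v + w)]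
    exact h3.add h6
  · simp only [Pi.add_apply]
    rw [integral_add (h3.1.integrable (by norm_num)) (h6.1.integrable (by norm_num)), h4, h7,
      _root_.add_zero]

theorem IsProjGrad.smul_zero {K : Polygon} {ℓ : ℕ} {v : H1 K.carrier} (c : ℝ)
    (hv : K.IsProjGrad ℓ v 0) : K.IsProjGrad ℓ (c • v) 0 := by
  obtain ⟨h1, h2, g, h3, h4⟩ := hv
  refine ⟨h1, fun r hr => ?_, c • g, ?_, ?_⟩
  · have e : H1.grad (c • v) = c • H1.grad v := map_smul _ _ _
    rw [e]
    exact inner_sub_smul_eq_zero H1.grad_zero c (h2 r hr)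
  · rw [sub_zero v] at h3
    rw [sub_zero (c • v)]
    exact h3.const_smul c
  · simp only [Pi.smul_apply, smul_eq_mul]
    rw [integral_const_mul, h4, mul_zero]

/-- The kernel of `Π^∇_ℓ`, a subspace of `H¹(K)`. -/
def kerProjGrad (ℓ : ℕ) : Submodule ℝ (H1 K.carrier) where
  carrier := {v | K.IsProjGrad ℓ v 0}
  zero_mem' := K.isProjGrad_zero_zero ℓ
  add_mem' hv hw := IsProjGrad.add_zero hv hw
  smul_mem' c _ hv := IsProjGrad.smul_zero c hv

/-- The kernel of `Π⁰_ℓ` in `H¹(K)`. -/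
noncomputable def kerProj0 (ℓ : ℕ) : Submodule ℝ (H1 K.carrier) :=
  LinearMap.ker ((K.polyL2 ℓ).starProjection.toLinearMap ∘ₗ H1.val)

theorem mem_kerProj0 {ℓ : ℕ} {v : H1 K.carrier} :
    v ∈ K.kerProj0 ℓ ↔ K.proj0 ℓ (H1.val v) = 0 := Iff.rfl

theorem val_proj0H1 (ℓ : ℕ) (v : H1 K.carrier) :
    H1.val (K.proj0H1 ℓ v) = K.proj0 ℓ (H1.val v) := (K.exists_proj0 ℓ v).choose_spec.2

theorem starProjection_sub_starProjection {E : Type} [NormedAddCommGroup E]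
    [InnerProductSpace ℝ E] (U : Submodule ℝ E) [U.HasOrthogonalProjection] (x : E) :
    U.starProjection (x - U.starProjection x) = 0 := by
  rw [map_sub, Submodule.starProjection_eq_self_iff.2 (U.starProjection_apply_mem x), sub_self]

theorem sub_proj0H1_mem_ker (ℓ : ℕ) (v : H1 K.carrier) : v - K.proj0H1 ℓ v ∈ K.kerProj0 ℓ := by
  rw [mem_kerProj0, H1.val_sub v (K.proj0H1 ℓ v), val_proj0H1]
  exact starProjection_sub_starProjection (K.polyL2 ℓ) (H1.val v)

theorem IsStab1.abs_le {K : Polygon} {p : ℕ} {αLo αHi : ℝ}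
    {S : LinearMap.BilinForm ℝ (H1 K.carrier)} (hS : K.IsStab1 p αLo αHi S) (hα : 0 ≤ αHi)
    {v w : H1 K.carrier} (hv : K.IsProjGrad p v 0) (hw : K.IsProjGrad p w 0) :
    |S v w| ≤ αHi * ‖H1.grad v‖ * ‖H1.grad w‖ :=
  abs_apply_le_of_subspace S (K.kerProjGrad p) (fun v hv w hw => hS.symm v w hv hw)
    (fun v hv => hS.nonneg v hv) hv hw hα (norm_nonneg _) (norm_nonneg _) (hS.upper v hv)
    (hS.upper w hw)

theorem IsStab0.abs_le {K : Polygon} {p : ℕ} {βLo βHi : ℝ}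
    {S : LinearMap.BilinForm ℝ (H1 K.carrier)} (hS : K.IsStab0 p βLo βHi S) (hβ : 0 ≤ βHi)
    (v w : H1 K.carrier) :
    |S (v - K.proj0H1 (p - 1) v) (w - K.proj0H1 (p - 1) w)| ≤ K.h ^ 2 * βHi *
      ‖H1.grad (v - K.projGrad (p - 1) v)‖ * ‖H1.grad (w - K.projGrad (p - 1) w)‖ :=
  abs_apply_le_of_subspace S (K.kerProj0 (p - 1)) (fun v hv w hw => hS.symm v w hv hw)
    (fun v hv => hS.nonneg v hv) (K.sub_proj0H1_mem_ker (p - 1) v)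
    (K.sub_proj0H1_mem_ker (p - 1) w) (by positivity) (norm_nonneg _) (norm_nonneg _) (hS.upper v)
    (hS.upper w)

end Polygon

/-! ### Consistency and coercivity in an abstract Hilbert space -/

theorem norm_sub_le_norm_sub_add_norm_sub_left {E : Type} [SeminormedAddCommGroup E] (u w q : E) :
    ‖w - q‖ ≤ ‖u - q‖ + ‖u - w‖ := by
  rw [norm_sub_rev u w, add_comm]
  exact norm_sub_le_norm_sub_add_norm_sub w u q

section InnerProductSpace

variable {E : Type} [NormedAddCommGroup E] [InnerProductSpace ℝ E] (U : Submodule ℝ E)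
  [U.HasOrthogonalProjection]

theorem norm_sub_starProjection_le_of_mem (v : E) {s : E} (hs : s ∈ U) :
    ‖v - U.starProjection v‖ ≤ ‖v - s‖ :=
  norm_sub_le_of_inner_eq_zero
    (inner_starProjection_sub_eq_zero U v (U.sub_mem (U.starProjection_apply_mem v) hs))

theorem norm_sub_starProjection_sub (v : E) {s : E} (hs : s ∈ U) :
    (v - s) - U.starProjection (v - s) = v - U.starProjection v := by
  rw [map_sub, Submodule.starProjection_eq_self_iff.2 hs]
  abel

theorem norm_sq_eq_starProjection (v : E) :
    ‖v‖ ^ 2 = ‖U.starProjection v‖ ^ 2 + ‖v - U.starProjection v‖ ^ 2 := by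
  have h := inner_starProjection_sub_eq_zero U v (U.starProjection_apply_mem v)
  nth_rewrite 1 [show v = U.starProjection v - (U.starProjection v - v) by abel]
  rw [norm_sub_sq_real, real_inner_comm, h, norm_sub_rev (U.starProjection v) v]
  ring

/-- Coercivity of a projected form that is stabilized on the complement of the projection. -/
theorem min_mul_norm_sq_le {a k α σ : ℝ} {v s : E} (hs : s ∈ U) (hα : 0 ≤ α)
    (ha : k * ‖U.starProjection v‖ ^ 2 ≤ a) (hσ : α * ‖v - s‖ ^ 2 ≤ σ) :
    min k α * ‖v‖ ^ 2 ≤ a + σ := by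
  have h1 : ‖v - U.starProjection v‖ ^ 2 ≤ ‖v - s‖ ^ 2 :=
    pow_le_pow_left₀ (norm_nonneg _) (norm_sub_starProjection_le_of_mem U v hs) 2
  rw [norm_sq_eq_starProjection U v]
  have h2 := mul_le_mul_of_nonneg_right (min_le_left k α) (sq_nonneg ‖U.starProjection v‖)
  have h3 := mul_le_mul_of_nonneg_right (min_le_right k α)
    (sq_nonneg ‖v - U.starProjection v‖)
  have h4 := mul_le_mul_of_nonneg_left h1 hα
  linarith

/-- The consistency error of the projected form `(A P w, P d)`. -/
theorem inner_sub_inner_starProjection_le {A : E → E} {M : ℝ} (hM : 0 ≤ M)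
    (hsub : ∀ x y, A (x - y) = A x - A y) (hA : ∀ x, ‖A x‖ ≤ M * ‖x‖) (u w d : E) :
    inner ℝ (A u) d - inner ℝ (A (U.starProjection w)) (U.starProjection d) ≤
      (‖A u - U.starProjection (A u)‖ + M * (‖u - U.starProjection u‖ + ‖u - w‖)) * ‖d‖ := by
  have h1 : inner ℝ (A u) d - inner ℝ (A (U.starProjection w)) (U.starProjection d) =
      inner ℝ (A u - U.starProjection (A u)) d +
        inner ℝ (A (u - U.starProjection w)) (U.starProjection d) := by
    rw [hsub, inner_sub_left, inner_sub_left, U.inner_starProjection_left_eq_right]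
    ring
  have h2 : ‖u - U.starProjection w‖ ≤ ‖u - U.starProjection u‖ + ‖u - w‖ := by
    have e : u - U.starProjection w = (u - U.starProjection u) + U.starProjection (u - w) := by
      rw [map_sub]
      abel
    rw [e]
    exact (norm_add_le _ _).trans (add_le_add_right (U.norm_starProjection_apply_le _) _)
  have h3 : inner ℝ (A (u - U.starProjection w)) (U.starProjection d) ≤
      M * (‖u - U.starProjection u‖ + ‖u - w‖) * ‖d‖ :=
    (real_inner_le_norm _ _).trans (mul_le_mul
      ((hA _).trans (mul_le_mul_of_nonneg_left h2 hM)) (U.norm_starProjection_apply_le d)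
      (norm_nonneg _) (by positivity))
  rw [h1, add_mul]
  exact add_le_add (real_inner_le_norm _ _) h3

/-- The error of the projected inner product is of second order: it is the inner product of the two
projection errors. -/
theorem inner_starProjection_sub_inner_le (f d : E) :
    inner ℝ (U.starProjection f) (U.starProjection d) - inner ℝ f d ≤
      ‖f - U.starProjection f‖ * ‖d - U.starProjection d‖ := by
  have h1 : inner ℝ (U.starProjection f) (U.starProjection d) - inner ℝ f d =
      -inner ℝ (f - U.starProjection f) (d - U.starProjection d) := by
    have h2 := U.starProjection_inner_eq_zero f _ (U.starProjection_apply_mem d)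
    have h3 := U.starProjection_inner_eq_zero d _ (U.starProjection_apply_mem f)
    rw [inner_sub_left] at h2 h3
    rw [inner_sub_left, inner_sub_right, inner_sub_right]
    have h4 := real_inner_comm (U.starProjection d) (U.starProjection f)
    have h5 := real_inner_comm d (U.starProjection f)
    linarith
  rw [h1]
  exact (neg_le_abs _).trans (abs_real_inner_le_norm _ _)

theorem inner_starProjection_sub_eq {A : E → E} (hsub : ∀ x y, A (x - y) = A x - A y)
    (v w d : E) : inner ℝ (A (U.starProjection (v - w))) d =
      inner ℝ (A (U.starProjection v)) d - inner ℝ (A (U.starProjection w)) d := by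
  rw [map_sub, hsub, inner_sub_left]

/-- The consistency error `X - (Y + σ)` of a form with projected part `Y` and stabilization `σ`: `e`
is the error of the projection, `c` and `c'` are the seminorms of the arguments of the
stabilization. -/
theorem sub_add_le_of_bounds {X Y σ R k α e a b₀ b c c' D : ℝ} (hk : 0 ≤ k) (hα : 0 ≤ α)
    (hD : 0 ≤ D) (hc : 0 ≤ c) (h1 : X - Y ≤ (R + k * (e + b₀)) * D) (h2 : e ≤ a)
    (hb : b₀ ≤ b) (h3 : -σ ≤ α * c * c') (h4 : c ≤ a + b) (h5 : c' ≤ D) :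
    X - (Y + σ) ≤ (R + (k + α) * (a + b)) * D := by
  have h6 : α * c * c' ≤ α * (a + b) * D :=
    (mul_le_mul_of_nonneg_left h5 (by positivity)).trans (by gcongr)
  have h7 : k * (e + b₀) * D ≤ k * (a + b) * D := by gcongr
  linarith

/-- The error `X + σ - Y` of the discrete right-hand side: `a` and `b` are the projection errors of
the two factors, each of first order in `h`. -/
theorem add_sub_le_of_bounds {X Y σ γ β h F D a b c : ℝ} (hγ : 0 < γ) (hβ : 0 ≤ β) (hh : 0 ≤ h)
    (hF : 0 ≤ F) (hD : 0 ≤ D) (hb : 0 ≤ b) (h1 : X - Y ≤ a * b)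
    (h2 : σ ≤ h ^ 2 * β * F * c) (h3 : c ≤ D) (h4 : a ≤ 2 / γ * h * F) (h5 : b ≤ 2 / γ * h * D) :
    X + σ - Y ≤ (4 / γ ^ 2 + 1) * max 1 β * (h ^ 2 * F) * D := by
  have h6 := mul_le_mul h4 h5 hb (by positivity)
  have hm := le_max_right 1 β
  have hm' := le_max_left 1 β
  have h7 : h ^ 2 * β * F * c ≤ h ^ 2 * max 1 β * F * D :=
    (mul_le_mul_of_nonneg_left h3 (by positivity)).trans (by gcongr)
  have h8 : 4 / γ ^ 2 * 1 * (h ^ 2 * F) * D ≤ 4 / γ ^ 2 * max 1 β * (h ^ 2 * F) * D := by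
    gcongr
  have h9 : 2 / γ * h * F * (2 / γ * h * D) = 4 / γ ^ 2 * 1 * (h ^ 2 * F) * D := by
    field_simp
    ring
  linarith

theorem bilin_sub_sub {M : Type} [AddCommGroup M] [Module ℝ M] (S : LinearMap.BilinForm ℝ M)
    (v w a b d : M) : S ((v - w) - (a - b)) d = S (v - a) d - S (w - b) d := by
  rw [sub_sub_sub_comm, map_sub, LinearMap.sub_apply]

end InnerProductSpace

/-! ### Local estimates -/

namespace Mesh

variable {Ω : Set Plane} {T : Mesh Ω} {γ : ℝ}

theorem h_pos (i : Fin T.N) : 0 < (T.elem i).h := by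
  obtain ⟨x, hx⟩ := (T.elem i).nonempty
  obtain ⟨ε, hε, hball⟩ := Metric.isOpen_iff.1 (T.elem i).isOpen x hx
  have h1 := Metric.diam_mono hball (T.elem i).isBounded
  obtain ⟨v, hv⟩ := exists_norm_eq Plane (half_pos hε).le
  have h2 : x + v ∈ Metric.ball x ε := by
    rw [Metric.mem_ball, dist_self_add_left, hv]
    exact half_lt_self hε
  have h3 := Metric.dist_le_diam_of_mem Metric.isBounded_ball h2 (Metric.mem_ball_self hε)
  rw [dist_self_add_left, hv] at h3
  exact (half_pos hε).trans_le (h3.trans h1)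

theorem IsRegular.exists_isStarShapedBall (hT : T.IsRegular γ) (hγ : 0 < γ) (i : Fin T.N) :
    ∃ c r, γ * (T.elem i).h ≤ r ∧ IsStarShapedBall (T.elem i).carrier c r := by
  obtain ⟨c, r, hr, hb, hs⟩ := hT.starShaped i
  exact ⟨c, r, hr, (T.elem i).isOpen, (T.elem i).isBounded,
    (mul_pos hγ (h_pos i)).trans_le hr, hb, hs⟩

/-- The Poincaré inequality on an element, with a constant that depends only on the shape
regularity. -/
theorem IsRegular.norm_sub_proj0_le (hT : T.IsRegular γ) (hγ : 0 < γ) (i : Fin T.N) (ℓ : ℕ)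
    (v : H1 (T.elem i).carrier) : ‖H1.val v - (T.elem i).proj0 ℓ (H1.val v)‖ ≤
      2 / γ * (T.elem i).h * ‖H1.grad v‖ := by
  obtain ⟨c, r, hr, hs⟩ := hT.exists_isStarShapedBall hγ i
  have hh := h_pos i
  refine (norm_sub_starProjection_le hs ((T.elem i).polyL2 ℓ)
    ((T.elem i).mem_polyL2_of_const ℓ) v).trans ?_
  refine mul_le_mul_of_nonneg_right ?_ (norm_nonneg _)
  change 2 * ((T.elem i).h / r) * (T.elem i).h ≤ _
  refine mul_le_mul_of_nonneg_right ?_ hh.le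
  rw [← mul_div_assoc, div_le_div_iff₀ hs.pos hγ]
  nlinarith

/-- The error of `Π⁰_ℓ` is bounded by the gradient of the error of `Π^∇_ℓ`, because both
projections take values in `ℙ_ℓ`. -/
theorem IsRegular.norm_sub_proj0_le_projGrad (hT : T.IsRegular γ) (hγ : 0 < γ) (i : Fin T.N)
    (ℓ : ℕ) (v : H1 (T.elem i).carrier) : ‖H1.val v - (T.elem i).proj0 ℓ (H1.val v)‖ ≤
      2 / γ * (T.elem i).h * ‖H1.grad (v - (T.elem i).projGrad ℓ v)‖ := by
  have h1 := hT.norm_sub_proj0_le hγ i ℓ (v - (T.elem i).projGrad ℓ v)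
  have h4 := H1.val_sub v ((T.elem i).projGrad ℓ v)
  have h2 : H1.val ((T.elem i).projGrad ℓ v) ∈ (T.elem i).polyL2 ℓ :=
    Submodule.mem_map_of_mem ((T.elem i).projGrad_mem ℓ v)
  have h3 := norm_sub_starProjection_sub ((T.elem i).polyL2 ℓ) (H1.val v) h2
  exact (congrArg norm h3).ge.trans
    ((congrArg (fun z => ‖z - (T.elem i).proj0 ℓ z‖) h4).ge.trans h1)

section Forms

variable {kLo kHi νLo νHi αLo αHi βLo βHi : ℝ} {p : ℕ}
  {S : ∀ i, LinearMap.BilinForm ℝ (H1 (T.elem i).carrier)} {i : Fin T.N}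

/-- Local coercivity. The stabilization controls `∇(v - Π^∇ v)`, and `∇Π^∇ v` is one competitor for
the projection of `∇v`. -/
theorem aLoc_coercive {c : Plane} {r : ℝ} (hs : IsStarShapedBall (T.elem i).carrier c r)
    (k : DiffusionTensor Ω kLo kHi) (hα : 0 ≤ αLo) (hS : (T.elem i).IsStab1 p αLo αHi (S i))
    {v : H1 (T.elem i).carrier} (hv : v ∈ (T.elem i).localSpace p) :
    min kLo αLo * ‖H1.grad v‖ ^ 2 ≤ T.aLoc k p S i v v := by
  have hP := Polygon.isProjGrad_projGrad hs p hv.1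
  have hσ := hS.lower _ (Polygon.sub_projGrad_mem_localSpace hs hv) hP.self_sub
  have hσ' := (congrArg (fun z => αLo * ‖z‖ ^ 2) (H1.grad_sub v ((T.elem i).projGrad p v))).ge.trans
    hσ
  exact min_mul_norm_sq_le ((T.elem i).polyL2Vec (p - 1))
    ((T.elem i).grad_mem_polyL2Vec ((T.elem i).projGrad_mem p v)) hα
    (k.le_inner_mul (T.subset i) _) hσ'

theorem aLoc_sub {c : Plane} {r : ℝ} (hs : IsStarShapedBall (T.elem i).carrier c r)
    (k : DiffusionTensor Ω kLo kHi) {v w : H1 (T.elem i).carrier}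
    (hv : v ∈ (T.elem i).localSpace p) (hw : w ∈ (T.elem i).localSpace p)
    (d : H1 (T.elem i).carrier) :
    T.aLoc k p S i (v - w) d = T.aLoc k p S i v d - T.aLoc k p S i w d := by
  have h1 : inner ℝ (k.mul (T.subset i) ((T.elem i).proj0Vec (p - 1) (H1.grad (v - w))))
      ((T.elem i).proj0Vec (p - 1) (H1.grad d)) =
      inner ℝ (k.mul (T.subset i) ((T.elem i).proj0Vec (p - 1) (H1.grad v)))
        ((T.elem i).proj0Vec (p - 1) (H1.grad d)) -
      inner ℝ (k.mul (T.subset i) ((T.elem i).proj0Vec (p - 1) (H1.grad w)))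
        ((T.elem i).proj0Vec (p - 1) (H1.grad d)) := by
    exact (congrArg (fun z => inner ℝ (k.mul (T.subset i) ((T.elem i).proj0Vec (p - 1) z))
      ((T.elem i).proj0Vec (p - 1) (H1.grad d))) (H1.grad_sub v w)).trans
      (inner_starProjection_sub_eq ((T.elem i).polyL2Vec (p - 1))
        (A := k.mul (T.subset i)) (k.mul_sub (T.subset i)) (H1.grad v) (H1.grad w) _)
  have h2 : S i ((v - w) - (T.elem i).projGrad p (v - w)) (d - (T.elem i).projGrad p d) =
      S i (v - (T.elem i).projGrad p v) (d - (T.elem i).projGrad p d) -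
        S i (w - (T.elem i).projGrad p w) (d - (T.elem i).projGrad p d) := by
    have e := Polygon.projGrad_sub hs p hv.1 hw.1
    exact (congrArg (fun z => S i ((v - w) - z) (d - (T.elem i).projGrad p d)) e).trans
      (bilin_sub_sub (S i) v w _ _ _)
  exact (congrArg₂ (fun x y : ℝ => x + y) h1 h2).trans (add_sub_add_comm _ _ _ _).symm

theorem bLoc_sub (V : Potential Ω νLo νHi) (v w d : H1 (T.elem i).carrier) :
    T.bLoc V p i (v - w) d = T.bLoc V p i v d - T.bLoc V p i w d := by
  exact (congrArg (fun z => inner ℝ (V.mul (T.subset i) ((T.elem i).proj0 (p - 1) z))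
    ((T.elem i).proj0 (p - 1) (H1.val d))) (H1.val_sub v w)).trans
    (inner_starProjection_sub_eq ((T.elem i).polyL2 (p - 1))
      (A := V.mul (T.subset i)) (V.mul_sub (T.subset i)) (H1.val v) (H1.val w) _)

theorem bLoc_nonneg (V : Potential Ω νLo νHi) (hν : 0 ≤ νLo) (v : H1 (T.elem i).carrier) :
    0 ≤ T.bLoc V p i v v := V.inner_mul_nonneg hν (T.subset i) _

/-- The consistency error of the diffusion form at `w ∈ V_n(K)`, which stands for an interpolant of
`u`, relative to the exact form at `u`; `q` is any polynomial of degree `p`. -/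
theorem inner_sub_aLoc_le {c : Plane} {r : ℝ} (hs : IsStarShapedBall (T.elem i).carrier c r)
    (k : DiffusionTensor Ω kLo kHi) (hk : 0 ≤ kLo) (hk' : 0 ≤ kHi) (hα : 0 ≤ αHi)
    (hS : (T.elem i).IsStab1 p αLo αHi (S i)) (u : H1 (T.elem i).carrier)
    {w d q : H1 (T.elem i).carrier} (hw : w ∈ (T.elem i).localSpace p)
    (hd : d ∈ (T.elem i).localSpace p) (hq : q ∈ (T.elem i).polyH1 p) :
    inner ℝ (k.mul (T.subset i) (H1.grad u)) (H1.grad d) - T.aLoc k p S i w d ≤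
      (‖k.mul (T.subset i) (H1.grad u) -
          (T.elem i).proj0Vec (p - 1) (k.mul (T.subset i) (H1.grad u))‖ +
        (kHi + αHi) * (‖H1.grad (u - q)‖ + ‖H1.grad (u - w)‖)) * ‖H1.grad d‖ := by
  have hPw := Polygon.isProjGrad_projGrad hs p hw.1
  have hPd := Polygon.isProjGrad_projGrad hs p hd.1
  have h1 := inner_sub_inner_starProjection_le ((T.elem i).polyL2Vec (p - 1)) hk'
    (A := k.mul (T.subset i)) (k.mul_sub (T.subset i)) (k.norm_mul_le hk (T.subset i))
    (H1.grad u) (H1.grad w) (H1.grad d)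
  have h2 := norm_sub_starProjection_le_of_mem ((T.elem i).polyL2Vec (p - 1)) (H1.grad u)
    ((T.elem i).grad_mem_polyL2Vec hq)
  have h3 := (neg_le_abs _).trans (hS.abs_le hα hPw.self_sub hPd.self_sub)
  have h4 : ‖H1.grad (w - (T.elem i).projGrad p w)‖ ≤
      ‖H1.grad (u - q)‖ + ‖H1.grad (u - w)‖ :=
    (hPw.norm_grad_sub_le hq).trans ((congrArg norm (H1.grad_sub w q)).le.trans
      ((norm_sub_le_norm_sub_add_norm_sub_left (H1.grad u) (H1.grad w) (H1.grad q)).trans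
        (add_le_add (congrArg norm (H1.grad_sub u q)).ge (congrArg norm (H1.grad_sub u w)).ge)))
  exact sub_add_le_of_bounds hk' hα (norm_nonneg _) (norm_nonneg _) h1
    (h2.trans (congrArg norm (H1.grad_sub u q)).ge) (congrArg norm (H1.grad_sub u w)).ge h3 h4
    ((T.elem i).norm_grad_sub_projGrad_le p d)

/-- The consistency error of the reaction form. -/
theorem inner_sub_bLoc_le (V : Potential Ω νLo νHi) (hν : 0 ≤ νLo) (hν' : 0 ≤ νHi)
    (u w d : H1 (T.elem i).carrier) :
    inner ℝ (V.mul (T.subset i) (H1.val u)) (H1.val d) - T.bLoc V p i w d ≤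
      (‖V.mul (T.subset i) (H1.val u) -
          (T.elem i).proj0 (p - 1) (V.mul (T.subset i) (H1.val u))‖ +
        νHi * (‖H1.val u - (T.elem i).proj0 (p - 1) (H1.val u)‖ + ‖H1.val (u - w)‖)) *
          ‖H1.val d‖ := by
  refine (inner_sub_inner_starProjection_le ((T.elem i).polyL2 (p - 1)) hν'
    (A := V.mul (T.subset i)) (V.mul_sub (T.subset i)) (V.norm_mul_le hν (T.subset i))
    (H1.val u) (H1.val w) (H1.val d)).trans ?_
  exact (congrArg (fun z => (‖V.mul (T.subset i) (H1.val u) -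
    (T.elem i).proj0 (p - 1) (V.mul (T.subset i) (H1.val u))‖ + νHi * (‖H1.val u -
      (T.elem i).proj0 (p - 1) (H1.val u)‖ + ‖z‖)) * ‖H1.val d‖) (H1.val_sub u w)).ge

/-- The consistency error of the right-hand side is of order `h²`, one power from each factor. -/
theorem IsRegular.cLoc_sub_inner_le (hT : T.IsRegular γ) (hγ : 0 < γ) (hβ : 0 ≤ βHi)
    (hS : (T.elem i).IsStab0 p βLo βHi (S i)) (f d : H1 (T.elem i).carrier) :
    T.cLoc p S i f d - inner ℝ (H1.val f) (H1.val d) ≤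
      (4 / γ ^ 2 + 1) * max 1 βHi *
        ((T.elem i).h ^ 2 * ‖H1.grad (f - (T.elem i).projGrad (p - 1) f)‖) * ‖H1.grad d‖ := by
  have hh := h_pos i
  have h1 := inner_starProjection_sub_inner_le ((T.elem i).polyL2 (p - 1)) (H1.val f) (H1.val d)
  have h2 := (le_abs_self _).trans (hS.abs_le hβ f d)
  have h3 := (T.elem i).norm_grad_sub_projGrad_le (p - 1) d
  have h4 := hT.norm_sub_proj0_le_projGrad hγ i (p - 1) f
  have h5 := hT.norm_sub_proj0_le hγ i (p - 1) d
  exact add_sub_le_of_bounds hγ hβ hh.le (norm_nonneg _) (norm_nonneg _) (norm_nonneg _) h1 h2 h3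
    h4 h5

end Forms

end Mesh

/-! ### The global error estimate -/

theorem sum_mul_le_sqrt {N : ℕ} (x y : Fin N → ℝ) :
    ∑ i, x i * y i ≤ √(∑ i, x i ^ 2) * √(∑ i, y i ^ 2) :=
  Real.sum_mul_le_sqrt_mul_sqrt _ _ _

/-- Summation of local consistency estimates. -/
theorem sum_le_add_mul_sqrt {N : ℕ} {X x a b y : Fin N → ℝ} {κ B Y : ℝ} (hκ : 0 ≤ κ)
    (h : ∀ i, X i ≤ (x i + κ * (a i + b i)) * y i) (hB : √(∑ i, b i ^ 2) = B)
    (hY : √(∑ i, y i ^ 2) = Y) :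
    ∑ i, X i ≤ (√(∑ i, x i ^ 2) + κ * (√(∑ i, a i ^ 2) + B)) * Y := by
  subst hB hY
  refine (Finset.sum_le_sum fun i _ => h i).trans ?_
  have h1 := sum_mul_le_sqrt x y
  have h2 := mul_le_mul_of_nonneg_left (sum_mul_le_sqrt a y) hκ
  have h3 := mul_le_mul_of_nonneg_left (sum_mul_le_sqrt b y) hκ
  have h4 : ∑ i, (x i + κ * (a i + b i)) * y i =
      ∑ i, x i * y i + κ * ∑ i, a i * y i + κ * ∑ i, b i * y i := by
    rw [Finset.mul_sum, Finset.mul_sum, ← Finset.sum_add_distrib, ← Finset.sum_add_distrib]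
    exact Finset.sum_congr rfl fun i _ => by ring
  rw [h4]
  linarith

/-- Summation of local bounds that are products of two local quantities. -/
theorem sum_mul_le_mul_sqrt {N : ℕ} {X x y : Fin N → ℝ} {c : ℝ} (hc : 0 ≤ c)
    (h : ∀ i, X i ≤ c * x i * y i) :
    ∑ i, X i ≤ c * √(∑ i, x i ^ 2) * √(∑ i, y i ^ 2) := by
  refine (Finset.sum_le_sum fun i _ => h i).trans ?_
  simp only [mul_assoc]
  rw [← Finset.mul_sum]
  exact mul_le_mul_of_nonneg_left (sum_mul_le_sqrt x y) hc

/-- The energy argument in terms of the local contributions: coercivity `h` of the discrete form,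
the discrete problem `hdisc`, and the continuous problem `hcont`. -/
theorem mul_sum_le_of_local {N : ℕ} {m : ℝ} {g A a B b c F K W : Fin N → ℝ}
    (h : ∀ i, m * g i ≤ (A i - a i) + (B i - b i)) (hdisc : ∑ i, A i + ∑ i, B i = ∑ i, c i)
    (hcont : ∑ i, K i + ∑ i, W i = ∑ i, F i) :
    m * ∑ i, g i ≤ ∑ i, (c i - F i) + ∑ i, (K i - a i) + ∑ i, (W i - b i) := by
  have hsum := Finset.sum_le_sum fun i (_ : i ∈ Finset.univ) => h i
  rw [← Finset.mul_sum, Finset.sum_add_distrib, Finset.sum_sub_distrib,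
    Finset.sum_sub_distrib] at hsum
  rw [Finset.sum_sub_distrib, Finset.sum_sub_distrib, Finset.sum_sub_distrib]
  linarith

namespace Mesh

variable {Ω : Set Plane} {T : Mesh Ω} {γ : ℝ}

theorem res_sub (hΩ : IsOpen Ω) (i : Fin T.N) (v w : H1 Ω) :
    T.res hΩ i (v - w) = T.res hΩ i v - T.res hΩ i w := map_sub _ _ _

theorem sqrt_sum_norm_grad_res (hΩ : IsOpen Ω) (v : H1 Ω) :
    √(∑ i, ‖H1.grad (T.res hΩ i v)‖ ^ 2) = ‖H1.grad v‖ :=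
  T.sqrt_sum_norm_restrict_sq (H1.grad v)

theorem sqrt_sum_norm_val_res (hΩ : IsOpen Ω) (v : H1 Ω) :
    √(∑ i, ‖H1.val (T.res hΩ i v)‖ ^ 2) = ‖H1.val v‖ :=
  T.sqrt_sum_norm_restrict_sq (H1.val v)

theorem IsRegular.sub_mem_space (hT : T.IsRegular γ) (hγ : 0 < γ) (hΩ : IsOpen Ω) {p : ℕ}
    {v w : H1 Ω} (hv : v ∈ T.space hΩ p) (hw : w ∈ T.space hΩ p) : v - w ∈ T.space hΩ p := by
  obtain ⟨h1, ⟨a, ha, hva⟩, h2⟩ := hv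
  obtain ⟨h3, ⟨b, hb, hwb⟩, h4⟩ := hw
  refine ⟨sub_mem_H10 h1 h3, ⟨a - b, ha.sub hb, ?_⟩, fun i => ?_⟩
  · rw [H1.val_sub v w]
    exact L2.sub_ae_eq hva hwb
  · have hs := (hT.exists_isStarShapedBall hγ i).choose_spec.choose_spec.2
    exact Set.mem_of_eq_of_mem (res_sub hΩ i v w) (Polygon.sub_mem_localSpace hs (h2 i) (h4 i))

section Forms

variable {kLo kHi νLo νHi αLo αHi βLo βHi : ℝ} {p : ℕ}
  {S₁ S₀ : ∀ i, LinearMap.BilinForm ℝ (H1 (T.elem i).carrier)}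

/-- The energy of `d = u_n - u_I` is bounded by the errors of consistency of the three discrete
forms: subtract the continuous from the discrete problem, both tested with `d`. -/
theorem IsRegular.energy_le (hT : T.IsRegular γ) (hγ : 0 < γ) (hΩ : IsOpen Ω)
    {k : DiffusionTensor Ω kLo kHi} {V : Potential Ω νLo νHi} (hν : 0 ≤ νLo) (hα : 0 ≤ αLo)
    (hS : ∀ i, (T.elem i).IsStab1 p αLo αHi (S₁ i)) {f u un uI d : H1 Ω}
    (hu : IsSolution k V f u) (hun : T.IsDiscreteSolution hΩ p k V S₁ S₀ f un)
    (huI : uI ∈ T.space hΩ p) (hd : d = un - uI) :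
    min kLo αLo * ‖H1.grad d‖ ^ 2 ≤
      ∑ i, (T.cLoc p S₀ i (T.res hΩ i f) (T.res hΩ i d) -
        inner ℝ (H1.val (T.res hΩ i f)) (H1.val (T.res hΩ i d))) +
      ∑ i, (inner ℝ (k.mul (T.subset i) (H1.grad (T.res hΩ i u))) (H1.grad (T.res hΩ i d)) -
        T.aLoc k p S₁ i (T.res hΩ i uI) (T.res hΩ i d)) +
      ∑ i, (inner ℝ (V.mul (T.subset i) (H1.val (T.res hΩ i u))) (H1.val (T.res hΩ i d)) -
        T.bLoc V p i (T.res hΩ i uI) (T.res hΩ i d)) := by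
  have hmem : d ∈ T.space hΩ p := hd ▸ hT.sub_mem_space hγ hΩ hun.1 huI
  have hloc : ∀ i, min kLo αLo * ‖H1.grad (T.res hΩ i d)‖ ^ 2 ≤
      (T.aLoc k p S₁ i (T.res hΩ i un) (T.res hΩ i d) -
        T.aLoc k p S₁ i (T.res hΩ i uI) (T.res hΩ i d)) +
      (T.bLoc V p i (T.res hΩ i un) (T.res hΩ i d) -
        T.bLoc V p i (T.res hΩ i uI) (T.res hΩ i d)) := by
    intro i
    have hs := (hT.exists_isStarShapedBall hγ i).choose_spec.choose_spec.2
    have e : T.res hΩ i d = T.res hΩ i un - T.res hΩ i uI := hd ▸ res_sub hΩ i un uI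
    have h1 := aLoc_coercive hs k hα (hS i) (hmem.2.2 i)
    have h2 : 0 ≤ T.bLoc V p i (T.res hΩ i d) (T.res hΩ i d) := bLoc_nonneg V hν _
    have h3 := (congrArg (fun z => T.aLoc k p S₁ i z (T.res hΩ i d)) e).trans
      (aLoc_sub hs k (hun.1.2.2 i) (huI.2.2 i) (T.res hΩ i d))
    have h4 := (congrArg (fun z => T.bLoc V p i z (T.res hΩ i d)) e).trans
      (bLoc_sub V (T.res hΩ i un) (T.res hΩ i uI) (T.res hΩ i d))
    linarith
  have e1 : ∑ i, ‖H1.grad (T.res hΩ i d)‖ ^ 2 = ‖H1.grad d‖ ^ 2 :=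
    T.sum_norm_restrict_sq (H1.grad d)
  have e2 : ∑ i, inner ℝ (H1.val (T.res hΩ i f)) (H1.val (T.res hΩ i d)) =
      inner ℝ (H1.val f) (H1.val d) := T.sum_inner_restrict (H1.val f) (H1.val d)
  have e3 : ∑ i, inner ℝ (k.mul (T.subset i) (H1.grad (T.res hΩ i u)))
      (H1.grad (T.res hΩ i d)) = inner ℝ (k.mul subset_rfl (H1.grad u)) (H1.grad d) := 
    (Finset.sum_congr rfl fun i _ => congrArg (fun z => inner ℝ z (H1.grad (T.res hΩ i d)))
      (k.mul_restrict (T.subset i) (H1.grad u))).trans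
      (T.sum_inner_restrict (k.mul subset_rfl (H1.grad u)) (H1.grad d))
  have e4 : ∑ i, inner ℝ (V.mul (T.subset i) (H1.val (T.res hΩ i u)))
      (H1.val (T.res hΩ i d)) = inner ℝ (V.mul subset_rfl (H1.val u)) (H1.val d) := 
    (Finset.sum_congr rfl fun i _ => congrArg (fun z => inner ℝ z (H1.val (T.res hΩ i d)))
      (V.mul_restrict (T.subset i) (H1.val u))).trans
      (T.sum_inner_restrict (V.mul subset_rfl (H1.val u)) (H1.val d))
  have e5 := hu.2 d hmem.1
  exact (congrArg (min kLo αLo * ·) e1).ge.trans (mul_sum_le_of_local hloc (hun.2 d hmem)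
    ((congrArg₂ (· + ·) e3 e4).trans (e5.trans e2.symm)))

end Forms

end Mesh

/-- The passage from the energy estimate for `d = u_n - u_I` to the bound on `e = |u - u_n|`. Here
`I = |u - u_I|`, and `v`, `J` are the `L²` norms of `d` and `u - u_I`. -/
theorem error_le_of_energy_le {m M c P κ ν β e I D J v F A Q R W : ℝ} (hm : 0 < m)
    (hM : M = m⁻¹) (hc : 0 ≤ c) (hP : 0 ≤ P) (hκ : 0 ≤ κ) (hν : 0 ≤ ν) (hβ : 0 ≤ β)
    (hI : 0 ≤ I) (hD : 0 ≤ D) (hF : 0 ≤ F) (hA : 0 ≤ A) (hQ : 0 ≤ Q) (hR : 0 ≤ R) (hW : 0 ≤ W)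
    (he : e ≤ I + D) (hv₀ : 0 ≤ v) (hv : v ≤ P * D) (hJ : J ≤ P * I)
    (h : m * D ^ 2 ≤ c * β * F * D + (R + κ * (A + I)) * D + (W + ν * (Q + J)) * v) :
    e ≤ (1 + c + P + P ^ 2) * (M * β * F + (1 + M * (κ + ν)) * I + M * κ * A + M * ν * Q +
      M * R + M * W) := by
  have hM0 : 0 ≤ M := hM ▸ (inv_pos.2 hm).le
  have hMm : M * m = 1 := by rw [hM, inv_mul_cancel₀ hm.ne']
  have h1 : D ≤ M * (c * β * F + (R + κ * (A + I)) + (W + ν * (Q + P * I)) * P) := by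
    rcases hD.eq_or_lt with h0 | h0
    · rw [← h0]
      positivity
    · have h2 : (W + ν * (Q + J)) * v ≤ (W + ν * (Q + P * I)) * (P * D) :=
        (mul_le_mul_of_nonneg_right (by gcongr) hv₀).trans
          (mul_le_mul_of_nonneg_left hv (by positivity))
      have h3 : m * D ≤ c * β * F + (R + κ * (A + I)) + (W + ν * (Q + P * I)) * P := by
        refine le_of_mul_le_mul_right ?_ h0
        linarith
      have h4 := mul_le_mul_of_nonneg_left h3 hM0
      rwa [← mul_assoc, hMm, one_mul] at h4
  refine (he.trans (add_le_add_right h1 I)).trans ?_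
  rw [← sub_nonneg]
  have : (1 + c + P + P ^ 2) * (M * β * F + (1 + M * (κ + ν)) * I + M * κ * A + M * ν * Q +
      M * R + M * W) - (I + M * (c * β * F + (R + κ * (A + I)) + (W + ν * (Q + P * I)) * P)) =
      (1 + P + P ^ 2) * (M * β * F) + (c + P + P ^ 2) * (I + M * κ * I + M * κ * A + M * R) +
      (1 + c + P) * (M * ν * I) + (1 + c + P ^ 2) * (M * ν * Q + M * W) := by ring
  rw [this]
  positivity

theorem L2.norm_eq_zero_of_eq_empty {D : Set Plane} (hD : D = ∅) {F : Type}
    [NormedAddCommGroup F] (a : L2 D F) : ‖a‖ = 0 := by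
  subst hD
  rw [norm_eq_zero]
  exact Lp.ext ((ae_restrict_iff' MeasurableSet.empty).2 (ae_of_all _ fun x hx => hx.elim))

theorem norm_sub_le_norm_sub_add_norm_sub_right {E : Type} [SeminormedAddCommGroup E]
    (a b z : E) : ‖a - b‖ ≤ ‖a - z‖ + ‖b - z‖ := by
  simpa only [dist_eq_norm] using dist_triangle_right a b z

theorem H1.norm_grad_sub_le {D : Set Plane} (u w z : H1 D) :
    ‖H1.grad (u - w)‖ ≤ ‖H1.grad (u - z)‖ + ‖H1.grad (w - z)‖ :=
  (congrArg norm (H1.grad_sub u w)).le.trans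
    ((norm_sub_le_norm_sub_add_norm_sub_right (H1.grad u) (H1.grad w) (H1.grad z)).trans
      (add_le_add (congrArg norm (H1.grad_sub u z)).ge (congrArg norm (H1.grad_sub w z)).ge))

section Estimate

variable {Ω : Set Plane} {T : Mesh Ω} {γ kLo kHi νLo νHi αLo αHi βLo βHi : ℝ} {p : ℕ}
  {S₁ S₀ : ∀ i, LinearMap.BilinForm ℝ (H1 (T.elem i).carrier)}

theorem Mesh.IsRegular.sum_cLoc_sub_inner_le (hT : T.IsRegular γ) (hγ : 0 < γ) (hΩ : IsOpen Ω)
    (hβ : 0 ≤ βHi) (hS : ∀ i, (T.elem i).IsStab0 p βLo βHi (S₀ i)) (f d : H1 Ω) :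
    ∑ i, (T.cLoc p S₀ i (T.res hΩ i f) (T.res hΩ i d) -
        inner ℝ (H1.val (T.res hΩ i f)) (H1.val (T.res hΩ i d))) ≤
      (4 / γ ^ 2 + 1) * max 1 βHi * √(∑ i, ((T.elem i).h ^ 2 *
        ‖H1.grad (T.res hΩ i f - (T.elem i).projGrad (p - 1) (T.res hΩ i f))‖) ^ 2) *
        ‖H1.grad d‖ :=
  (sum_mul_le_mul_sqrt (by positivity) fun i =>
    hT.cLoc_sub_inner_le hγ hβ (hS i) (T.res hΩ i f) (T.res hΩ i d)).trans
    (congrArg _ (T.sqrt_sum_norm_grad_res hΩ d)).le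

theorem Mesh.IsRegular.sum_inner_sub_aLoc_le (hT : T.IsRegular γ) (hγ : 0 < γ) (hΩ : IsOpen Ω)
    (k : DiffusionTensor Ω kLo kHi) (hk : 0 ≤ kLo) (hk' : 0 ≤ kHi) (hα : 0 ≤ αHi)
    (hS : ∀ i, (T.elem i).IsStab1 p αLo αHi (S₁ i)) (u : H1 Ω) {w d : H1 Ω}
    (hw : w ∈ T.space hΩ p) (hd : d ∈ T.space hΩ p) {q : ∀ i, H1 (T.elem i).carrier}
    (hq : ∀ i, q i ∈ (T.elem i).polyH1 p) :
    ∑ i, (inner ℝ (k.mul (T.subset i) (H1.grad (T.res hΩ i u))) (H1.grad (T.res hΩ i d)) -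
        T.aLoc k p S₁ i (T.res hΩ i w) (T.res hΩ i d)) ≤
      (√(∑ i, ‖k.mul (T.subset i) (H1.grad (T.res hΩ i u)) -
          (T.elem i).proj0Vec (p - 1) (k.mul (T.subset i) (H1.grad (T.res hΩ i u)))‖ ^ 2) +
        (kHi + αHi) * (√(∑ i, ‖H1.grad (T.res hΩ i u - q i)‖ ^ 2) + ‖H1.grad (u - w)‖)) *
          ‖H1.grad d‖ := by
  refine sum_le_add_mul_sqrt (by positivity) (fun i => ?_) (T.sqrt_sum_norm_grad_res hΩ (u - w))
    (T.sqrt_sum_norm_grad_res hΩ d)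
  have hs := (hT.exists_isStarShapedBall hγ i).choose_spec.choose_spec.2
  have h := Mesh.inner_sub_aLoc_le hs k hk hk' hα (hS i) (T.res hΩ i u) (hw.2.2 i) (hd.2.2 i)
    (hq i)
  exact h.trans (congrArg (fun z => (_ + (kHi + αHi) * (_ + ‖H1.grad z‖)) * _)
    (T.res_sub hΩ i u w)).ge

theorem Mesh.sum_inner_sub_bLoc_le (T : Mesh Ω) (hΩ : IsOpen Ω)
    (V : Potential Ω νLo νHi) (hν : 0 ≤ νLo) (hν' : 0 ≤ νHi) (u w d : H1 Ω) :
    ∑ i, (inner ℝ (V.mul (T.subset i) (H1.val (T.res hΩ i u))) (H1.val (T.res hΩ i d)) -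
        T.bLoc V p i (T.res hΩ i w) (T.res hΩ i d)) ≤
      (√(∑ i, ‖V.mul (T.subset i) (H1.val (T.res hΩ i u)) -
          (T.elem i).proj0 (p - 1) (V.mul (T.subset i) (H1.val (T.res hΩ i u)))‖ ^ 2) +
        νHi * (√(∑ i, ‖H1.val (T.res hΩ i u) -
          (T.elem i).proj0 (p - 1) (H1.val (T.res hΩ i u))‖ ^ 2) + ‖H1.val (u - w)‖)) *
          ‖H1.val d‖ := by
  refine sum_le_add_mul_sqrt hν' (fun i => ?_) (T.sqrt_sum_norm_val_res hΩ (u - w))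
    (T.sqrt_sum_norm_val_res hΩ d)
  have h := Mesh.inner_sub_bLoc_le (T := T) (p := p) V hν hν' (T.res hΩ i u) (T.res hΩ i w)
    (T.res hΩ i d)
  exact h.trans (congrArg (fun z => (_ + νHi * (_ + ‖H1.val z‖)) * _) (T.res_sub hΩ i u w)).ge

/-- The error estimate on a nonempty domain, with the constant in terms of a Poincaré constant. -/
theorem Mesh.IsRegular.error_estimate (hT : T.IsRegular γ) (hγ : 0 < γ) (hΩ : IsOpen Ω)
    (hne : Ω.Nonempty) {P : ℝ} (hP : 0 ≤ P) (hpoinc : ∀ v ∈ H10 Ω, ‖H1.val v‖ ≤ P * ‖H1.grad v‖)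
    (hk : 0 < kLo) (hkk : kLo ≤ kHi) (hν : 0 ≤ νLo) (k : DiffusionTensor Ω kLo kHi)
    (V : Potential Ω νLo νHi) (hα : 0 < αLo) (hα' : 0 < αHi) (hβ : 0 < βHi)
    (hS₁ : ∀ i, (T.elem i).IsStab1 p αLo αHi (S₁ i))
    (hS₀ : ∀ i, (T.elem i).IsStab0 p βLo βHi (S₀ i)) {f u un : H1 Ω} (hu : IsSolution k V f u)
    (hun : T.IsDiscreteSolution hΩ p k V S₁ S₀ f un) {uI : H1 Ω} (huI : uI ∈ T.space hΩ p)
    {q : ∀ i, H1 (T.elem i).carrier} (hq : ∀ i, q i ∈ (T.elem i).polyH1 p) :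
    ‖H1.grad (u - un)‖ ≤ (1 + (4 / γ ^ 2 + 1) + P + P ^ 2) * (
      max kLo⁻¹ αLo⁻¹ * max 1 βHi * √(∑ i, ((T.elem i).h ^ 2 *
        ‖H1.grad (T.res hΩ i f - (T.elem i).projGrad (p - 1) (T.res hΩ i f))‖) ^ 2) +
      (1 + max kLo⁻¹ αLo⁻¹ * (kHi + αHi + νHi)) * ‖H1.grad (u - uI)‖ +
      max kLo⁻¹ αLo⁻¹ * (kHi + αHi) * √(∑ i, ‖H1.grad (T.res hΩ i u - q i)‖ ^ 2) +
      max kLo⁻¹ αLo⁻¹ * νHi * √(∑ i, ‖H1.val (T.res hΩ i u) -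
        (T.elem i).proj0 (p - 1) (H1.val (T.res hΩ i u))‖ ^ 2) +
      max kLo⁻¹ αLo⁻¹ * √(∑ i, ‖k.mul (T.subset i) (H1.grad (T.res hΩ i u)) -
        (T.elem i).proj0Vec (p - 1) (k.mul (T.subset i) (H1.grad (T.res hΩ i u)))‖ ^ 2) +
      max kLo⁻¹ αLo⁻¹ * √(∑ i, ‖V.mul (T.subset i) (H1.val (T.res hΩ i u)) -
        (T.elem i).proj0 (p - 1) (V.mul (T.subset i) (H1.val (T.res hΩ i u)))‖ ^ 2)) := by
  have hν' := V.upper_nonneg hν hΩ hne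
  have hk' : 0 ≤ kHi := hk.le.trans hkk
  have hd := hT.sub_mem_space hγ hΩ hun.1 huI
  have henergy := (hT.energy_le hγ hΩ hν hα.le hS₁ hu hun huI rfl).trans
    (add_le_add (add_le_add (hT.sum_cLoc_sub_inner_le hγ hΩ hβ.le hS₀ f (un - uI))
      (hT.sum_inner_sub_aLoc_le hγ hΩ k hk.le hk' hα'.le hS₁ u huI hd hq))
      (T.sum_inner_sub_bLoc_le hΩ V hν hν' u uI (un - uI)))
  have hM : max kLo⁻¹ αLo⁻¹ = (min kLo αLo)⁻¹ := by
    rcases le_total kLo αLo with h | h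
    · rw [min_eq_left h, max_eq_left (inv_anti₀ hk h)]
    · rw [min_eq_right h, max_eq_right (inv_anti₀ hα h)]
  exact error_le_of_energy_le (lt_min hk hα) hM (by positivity) hP (by positivity) hν'
    (le_max_of_le_left zero_le_one) (norm_nonneg _) (norm_nonneg _) (Real.sqrt_nonneg _)
    (Real.sqrt_nonneg _) (Real.sqrt_nonneg _) (Real.sqrt_nonneg _) (Real.sqrt_nonneg _)
    (H1.norm_grad_sub_le u un uI)
    (norm_nonneg _) (hpoinc _ hd.1) (hpoinc _ (sub_mem_H10 hu.1 huI.1)) henergy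

end Estimate

end VEM

theorem mainTheorem6 (Ω : Set VEM.Plane) (hΩ : IsOpen Ω) (hΩb : Bornology.IsBounded Ω)
    (γ : ℝ) (hγ : 0 < γ) :
    ∃ C : ℝ, 0 < C ∧
      ∀ (T : VEM.Mesh Ω), T.IsRegular γ →
      ∀ (p : ℕ), 1 ≤ p →
      ∀ (kLo kHi νLo νHi : ℝ), 0 < kLo → kLo ≤ kHi → 0 ≤ νLo →
      ∀ (k : VEM.DiffusionTensor Ω kLo kHi) (V : VEM.Potential Ω νLo νHi),
      ∀ (αLo αHi βLo βHi : ℝ), 0 < αLo → 0 < αHi → 0 < βLo → 0 < βHi →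
      ∀ (S₁ S₀ : ∀ i, LinearMap.BilinForm ℝ (VEM.H1 (T.elem i).carrier)),
        (∀ i, (T.elem i).IsStab1 p αLo αHi (S₁ i)) →
        (∀ i, (T.elem i).IsStab0 p βLo βHi (S₀ i)) →
      ∀ (f u un : VEM.H1 Ω), VEM.IsSolution k V f u →
        T.IsDiscreteSolution hΩ p k V S₁ S₀ f un →
      ∀ uI ∈ T.space hΩ p,
      ∀ (uπ : ∀ i, VEM.H1 (T.elem i).carrier), (∀ i, uπ i ∈ (T.elem i).polyH1 p) →
      ∀ (μ₁ μ₂ μ₃ μ₄ μ₅ : ℝ),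
        μ₁ = max kLo⁻¹ αLo⁻¹ * max 1 βHi →
        μ₂ = 1 + max kLo⁻¹ αLo⁻¹ * (kHi + αHi + νHi) →
        μ₃ = max kLo⁻¹ αLo⁻¹ * (kHi + αHi) →
        μ₄ = max kLo⁻¹ αLo⁻¹ * νHi →
        μ₅ = max kLo⁻¹ αLo⁻¹ →
        ‖VEM.H1.grad (u - un)‖ ≤ C * (
          μ₁ * √(∑ i, ((T.elem i).h ^ 2 *
            ‖VEM.H1.grad (T.res hΩ i f - (T.elem i).projGrad (p - 1) (T.res hΩ i f))‖) ^ 2) +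
          μ₂ * ‖VEM.H1.grad (u - uI)‖ +
          μ₃ * √(∑ i, ‖VEM.H1.grad (T.res hΩ i u - uπ i)‖ ^ 2) +
          μ₄ * √(∑ i, ‖VEM.H1.val (T.res hΩ i u) -
            (T.elem i).proj0 (p - 1) (VEM.H1.val (T.res hΩ i u))‖ ^ 2) +
          μ₅ * √(∑ i, ‖k.mul (T.subset i) (VEM.H1.grad (T.res hΩ i u)) -
            (T.elem i).proj0Vec (p - 1)
              (k.mul (T.subset i) (VEM.H1.grad (T.res hΩ i u)))‖ ^ 2) +
          μ₅ * √(∑ i, ‖V.mul (T.subset i) (VEM.H1.val (T.res hΩ i u)) -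
            (T.elem i).proj0 (p - 1)
              (V.mul (T.subset i) (VEM.H1.val (T.res hΩ i u)))‖ ^ 2)) := by
  refine (VEM.exists_poincare_H10 hΩb hΩ).elim fun P hP =>
    ⟨1 + (4 / γ ^ 2 + 1) + P + P ^ 2, by have := hP.1; positivity, ?_⟩
  intro T hT p _ kLo kHi νLo νHi hk hkk hν k V αLo αHi βLo βHi hα hα' _ hβ S₁ S₀ hS₁ hS₀ f u un hu
    hun uI huI uπ huπ μ₁ μ₂ μ₃ μ₄ μ₅ h₁ h₂ h₃ h₄ h₅
  subst h₁ h₂ h₃ h₄ h₅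
  refine Ω.eq_empty_or_nonempty.elim (fun h0 => ?_) fun hne =>
    hT.error_estimate hγ hΩ hne hP.1 hP.2 hk hkk hν k V hα hα' hβ hS₁ hS₀ hu hun huI huπ
  -- no element fits into the empty set, so that both sides of the estimate vanish
  have : IsEmpty (Fin T.N) := ⟨fun i => (T.elem i).nonempty.ne_empty
    (Set.subset_empty_iff.1 ((T.subset i).trans h0.subset))⟩
  have h1 := VEM.L2.norm_eq_zero_of_eq_empty h0 (VEM.H1.grad (u - un))
  have h2 := VEM.L2.norm_eq_zero_of_eq_empty h0 (VEM.H1.grad (u - uI))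
  refine h1.le.trans ?_
  simp only [Finset.univ_eq_empty, Finset.sum_empty, Real.sqrt_zero, mul_zero, add_zero, zero_add]
  exact (by rw [h2, mul_zero, mul_zero] : _ = (0 : ℝ)).ge
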